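/- Let $1<p<\infty$. For $\alpha\in\mathbb R$ and $x>0$ consider the principal value integral $$K_\alpha f(x) := \frac{2}{\pi}\,\mathrm{p.v.}\!\int_0^\infty \frac{x^\alpha y^{1-\alpha}}{x^2-y^2}\,f(y)\,dy =\lim_{\varepsilon\to0^+}\frac 2\pi\int_{y>0,\ |x-y|>\varepsilon}\frac{x^\alpha y^{1-\alpha}}{x^2-y^2}\,f(y)\,dy ,$$ where the truncated integrals are required to converge absolutely. Then $K_\alpha$ is bounded on $L_p(\mathbb R_+;\mathbb C)$, $\mathbb R_+=(0,\infty)$, if and only if $\alpha\in(-1/p,\,2-1/p)$. Here boundedness can be taken in either of the following two senses, and the equivalence holds for each of them: (a) there is a bounded linear operator on $L_p(\mathbb R_+;\mathbb C)$, again denoted $K_\alpha$, such that for every $f\in L_p(\mathbb R_+;\mathbb C)$ the principal value exists and equals $(K_\alpha f)(x)$ for almost every $x>0$; (b) there is $C<\infty$ such that for all $f\in C_0^\infty(\mathbb R_+;\mathbb C)$ the principal value exists for almost every $x>0$ and $\|K_\alpha f\|_p\le C\|f\|_p$. Furthermore, if $\alpha\in(-1/p,\,2-1/p)$, $\alpha\ne1$,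 and $k=\tan(\tfrac\pi2\alpha)$, then $I-kK_0$ is invertible in $L_p(\mathbb R_+;\mathbb C)$ with (two-sided, bounded) inverse $$(I-kK_0)^{-1}=\frac1{1+k^2}\,(I+kK_\alpha).$$ -/

import Mathlib

open MeasureTheory Set Filter Topology
open scoped ENNReal NNReal ContDiff

/-- Lebesgue measure on the half line `ℝ₊ = (0, ∞)`. -/
noncomputable abbrev halfLine : Measure ℝ := volume.restrict (Ioi (0 : ℝ))

/-- The space `L_p(ℝ₊; ℂ)`. -/
noncomputable abbrev LpHalf (p : ℝ≥0∞) := Lp ℂ p halfLine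

/-- The kernel `(2/π) x^α y^(1-α) / (x² - y²)`, for `x, y > 0`. -/
noncomputable def kerK (α x y : ℝ) : ℝ :=
  2 / Real.pi * (x ^ α * y ^ (1 - α) / (x ^ 2 - y ^ 2))

/-- The domain `(0, ∞) \ [x - ε, x + ε]` of the truncated integrals. -/
def truncDom (x ε : ℝ) : Set ℝ := {y | 0 < y ∧ ε < |x - y|}

/-- `K_α f (x)` exists and equals `v`: the integral of `kerK α x y * f y` over `y > 0`,
`|x - y| > ε` converges absolutely for every `ε > 0`, and tends to `v` as `ε → 0+`. -/
def HasPV (α : ℝ) (f : ℝ → ℂ) (x : ℝ) (v : ℂ) : Prop :=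
  (∀ ε : ℝ, 0 < ε → IntegrableOn (fun y => (kerK α x y : ℂ) * f y) (truncDom x ε)) ∧
  Tendsto (fun ε : ℝ => ∫ y in truncDom x ε, (kerK α x y : ℂ) * f y) (𝓝[>] 0) (𝓝 v)

/-- The bounded operator `T` on `L_p(ℝ₊; ℂ)` is `K_α`: for every `f` in `L_p`, the principal value
`K_α f (x)` exists and equals `T f (x)` for almost every `x > 0`. -/
def IsOpK (p : ℝ≥0∞) [Fact (1 ≤ p)] (α : ℝ) (T : LpHalf p →L[ℂ] LpHalf p) : Prop :=
  ∀ f : LpHalf p, ∀ᵐ x ∂halfLine, HasPV α f x (T f x)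

/-- Test functions: smooth with compact support contained in `(0, ∞)`. -/
def IsTestFun (f : ℝ → ℂ) : Prop :=
  ContDiff ℝ ∞ f ∧ HasCompactSupport f ∧ tsupport f ⊆ Ioi 0

/-- The a priori estimate `‖K_α f‖_p ≤ C ‖f‖_p` for all test functions `f`. -/
def TestBoundK (p : ℝ≥0∞) (α : ℝ) : Prop :=
  ∃ C : ℝ≥0, ∀ f : ℝ → ℂ, IsTestFun f →
    ∃ g : ℝ → ℂ, MemLp g p halfLine ∧ (∀ᵐ x ∂halfLine, HasPV α f x (g x)) ∧
      eLpNorm g p halfLine ≤ C * eLpNorm f p halfLine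

/-! Boundedness. On the diagonal the kernel of K_α has the same singularity as the Hilbert kernel
1/(π(x - y)). Their difference `diffK` is homogeneous of degree -1, and it is dominated by two Hardy
kernels: x^(σ-1) y^(-σ) on y < x with σ = max(0, α-1), and y^(τ-1) x^(-τ) on x < y with τ = max(0,
-α) (`exists_abs_diffK_le`). Schur's test with weight (y/x)^(-1/p) needs σ < 1 - 1/p and τ < 1/p,
which together say α ∈ (-1/p, 2 - 1/p). The singular part is the Hilbert transform of the zero
extension (`exists_hilbertTransform`).

The Hilbert transform is built from the conjugate Poisson kernels Q_ε. For f ≥ 0 the Cauchy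
transform F = u + iv has positive real part, so F^r is holomorphic in the upper half plane and
integrates to 0 on horizontal lines. Integrating |v|^r ≤ A u^r - B Re F^r gives M. Riesz's bound for
1 < r ≤ 2, and duality gives p > 2. The relations P_ε Q_δ = Q_(ε+δ) = Q_δ P_ε with the Poisson
kernels make Q_ε converge strongly to an operator T with P_ε T = Q_ε. At Lebesgue points P_ε T f
tends to T f and Q_ε f differs from the truncated integral by o(1), so the principal value exists
almost everywhere and equals T f.

Necessity. For a fixed bump f supported in [1, 3], |K_α f| is at least a multiple of x^α near 0 and
of x^(α-2) near infinity. Membership in L_p forces αp > -1 and (α-2)p < -1.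

Inverse. Put θ = πα/2, u = 1/(x²+z), w = x^α/(x²+z). Partial fractions and two Mellin integrals give
K_α u = -cot θ · u + (z^(-α/2)/sin θ) w and K_0 w = cot θ · w - (z^(α/2)/sin θ) u. As k cot θ = 1,
the operators I + kK_α and I - kK_0 carry u to a multiple of w and w to a multiple of u, and the
product of the two factors is k²/sin²θ = 1 + k². Both families (z ≥ 1) span dense subspaces of L_p
(`eq_top_of_classMem_rpow_div`), so the identities hold for operators. -/

/-! ### Bounded operators on L_p from kernels; Schur's test. -/

/-- A pointwise-defined linear bounded operation on `L_p` functions induces a bounded operator. -/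
theorem exists_clm_of_ae_linear {X Y : Type*} {mX : MeasurableSpace X} {mY : MeasurableSpace Y}
    {μ : Measure X} {ν : Measure Y} {p : ℝ≥0∞} [Fact (1 ≤ p)] (Φ : (X → ℂ) → Y → ℂ) (C : ℝ≥0)
    (hmem : ∀ f, MemLp f p μ → MemLp (Φ f) p ν)
    (hb : ∀ f, MemLp f p μ → eLpNorm (Φ f) p ν ≤ C * eLpNorm f p μ)
    (hadd : ∀ f g, MemLp f p μ → MemLp g p μ → Φ (f + g) =ᵐ[ν] Φ f + Φ g)
    (hsmul : ∀ (c : ℂ) f, MemLp f p μ → Φ (c • f) =ᵐ[ν] c • Φ f)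
    (hcongr : ∀ f g, f =ᵐ[μ] g → Φ f =ᵐ[ν] Φ g) :
    ∃ T : Lp ℂ p μ →L[ℂ] Lp ℂ p ν, (∀ f : Lp ℂ p μ, T f =ᵐ[ν] Φ f) ∧ ‖T‖ ≤ C := by
  let L : Lp ℂ p μ →ₗ[ℂ] Lp ℂ p ν :=
    { toFun := fun f => (hmem f (Lp.memLp f)).toLp _
      map_add' := by
        intro f g
        rw [← MemLp.toLp_add, MemLp.toLp_eq_toLp_iff]
        exact (hcongr _ _ (Lp.coeFn_add f g)).trans (hadd _ _ (Lp.memLp f) (Lp.memLp g))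
      map_smul' := by
        intro c f
        simp only [RingHom.id_apply]
        rw [← MemLp.toLp_const_smul, MemLp.toLp_eq_toLp_iff]
        exact (hcongr _ _ (Lp.coeFn_smul c f)).trans (hsmul c _ (Lp.memLp f)) }
  have hL : ∀ f, ‖L f‖ ≤ C * ‖f‖ := by
    intro f
    have h1 : ‖L f‖ = (eLpNorm (Φ f) p ν).toReal := Lp.norm_toLp _ (hmem f (Lp.memLp f))
    rw [h1, Lp.norm_def]
    have := ENNReal.toReal_mono (by finiteness [(Lp.memLp f).2.ne]) (hb f (Lp.memLp f))
    simpa [ENNReal.toReal_mul] using this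
  refine ⟨L.mkContinuous C hL, fun f => ?_, L.mkContinuous_norm_le C.2 hL⟩
  exact MemLp.coeFn_toLp (hmem f (Lp.memLp f))

theorem exists_clm_of_kernel {X Y : Type*} {mX : MeasurableSpace X} {mY : MeasurableSpace Y}
    {μ : Measure X} {ν : Measure Y} {p : ℝ≥0∞} [Fact (1 ≤ p)] (k : Y → X → ℝ) (C : ℝ≥0)
    (hint : ∀ f : X → ℂ, MemLp f p μ → ∀ᵐ y ∂ν, Integrable (fun x => (k y x : ℂ) * f x) μ)
    (hmem : ∀ f : X → ℂ, MemLp f p μ → MemLp (fun y => ∫ x, (k y x : ℂ) * f x ∂μ) p ν)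
    (hb : ∀ f : X → ℂ, MemLp f p μ →
      eLpNorm (fun y => ∫ x, (k y x : ℂ) * f x ∂μ) p ν ≤ C * eLpNorm f p μ) :
    ∃ T : Lp ℂ p μ →L[ℂ] Lp ℂ p ν,
      (∀ f : Lp ℂ p μ, T f =ᵐ[ν] fun y => ∫ x, (k y x : ℂ) * f x ∂μ) ∧ ‖T‖ ≤ C := by
  refine exists_clm_of_ae_linear (fun f y => ∫ x, (k y x : ℂ) * f x ∂μ) C hmem hb ?_ ?_ ?_
  · intro f g hf hg
    filter_upwards [hint f hf, hint g hg] with y h1 h2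
    simp only [Pi.add_apply, mul_add]
    exact integral_add h1 h2
  · intro c f hf
    refine Eventually.of_forall fun y => ?_
    simp only [Pi.smul_apply, smul_eq_mul, ← integral_const_mul]
    congr 1; ext x; ring
  · intro f g hfg
    refine Eventually.of_forall fun y => ?_
    refine integral_congr_ae ?_
    filter_upwards [hfg] with x hx
    rw [hx]

/-- Schur's test with a two-variable weight. -/
theorem lintegral_rpow_lintegral_le_of_schur {X Y : Type*} {mX : MeasurableSpace X}
    {mY : MeasurableSpace Y} {μ : Measure X} {ν : Measure Y} [SFinite μ] [SFinite ν] {r : ℝ}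
    (hr : 1 < r) {k w : Y → X → ℝ≥0∞} (hk : Measurable (Function.uncurry k))
    (hw : Measurable (Function.uncurry w)) (hw0 : ∀ᵐ y ∂ν, ∀ᵐ x ∂μ, w y x ≠ 0 ∧ w y x ≠ ⊤)
    {A B : ℝ≥0∞}
    (hA : ∀ᵐ y ∂ν, ∫⁻ x, k y x * w y x ∂μ ≤ A)
    (hB : ∀ᵐ x ∂μ, ∫⁻ y, k y x * (w y x) ^ (-(r - 1)) ∂ν ≤ B)
    {f : X → ℝ≥0∞} (hf : AEMeasurable f μ) :
    ∫⁻ y, (∫⁻ x, k y x * f x ∂μ) ^ r ∂ν ≤ A ^ (r - 1) * B * ∫⁻ x, f x ^ r ∂μ := by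
  wlog hfm : Measurable f generalizing f
  · have h := this hf.measurable_mk.aemeasurable hf.measurable_mk
    have e1 : ∀ y, ∫⁻ x, k y x * f x ∂μ = ∫⁻ x, k y x * hf.mk f x ∂μ := fun y =>
      lintegral_congr_ae (by filter_upwards [hf.ae_eq_mk] with x hx; rw [hx])
    have e2 : ∫⁻ x, f x ^ r ∂μ = ∫⁻ x, hf.mk f x ^ r ∂μ :=
      lintegral_congr_ae (by filter_upwards [hf.ae_eq_mk] with x hx; rw [hx])
    simp_rw [e1, e2]; exact h
  have hr0 : 0 < r := by linarith
  set q := Real.conjExponent r with hq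
  have hrq : r.HolderConjugate q := Real.HolderConjugate.conjExponent hr
  have hq0 : 0 < q := hrq.symm.pos
  have hrq1 : r / q = r - 1 := by
    rw [hq, Real.conjExponent]; field_simp
  have key : ∀ᵐ y ∂ν, (∫⁻ x, k y x * f x ∂μ) ^ r ≤
      A ^ (r - 1) * ∫⁻ x, k y x * (w y x) ^ (-(r - 1)) * f x ^ r ∂μ := by
    filter_upwards [hA, hw0] with y hy hwy
    have hky : Measurable (k y) := hk.comp measurable_prodMk_left
    have hwy' : Measurable (w y) := hw.comp measurable_prodMk_left
    -- Hölder splitting k f = (k w)^(1/q) · (k w^(-(r-1)) f^r)^(1/r). The powers of w cancel because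
    -- r/q = r - 1, which needs w to be neither 0 nor ∞.
    have e1 : ∫⁻ x, k y x * f x ∂μ = ∫⁻ x, ((fun x => (k y x * w y x) ^ (1 / q)) *
        (fun x => (k y x * (w y x) ^ (-(r - 1)) * f x ^ r) ^ (1 / r))) x ∂μ := by
      refine lintegral_congr_ae ?_
      filter_upwards [hwy] with x hx
      obtain ⟨h0, ht⟩ := hx
      have hq1 : 1 / q + 1 / r = 1 := by
        have := hrq.inv_add_inv_eq_one; simp only [one_div]; linarith
      have e : (w y x) ^ (1 / q) * (w y x) ^ (-(r - 1) * (1 / r)) = 1 := by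
        rw [← ENNReal.rpow_add _ _ h0 ht, ← hrq1]
        have : 1 / q + -(r / q) * (1 / r) = 0 := by field_simp; ring
        rw [this, ENNReal.rpow_zero]
      have e' : (k y x) ^ (1 / q) * (k y x) ^ (1 / r) = k y x := by
        rw [← ENNReal.rpow_add_of_nonneg _ _ (by positivity) (by positivity), hq1,
          ENNReal.rpow_one]
      simp only [Pi.mul_apply]
      rw [ENNReal.mul_rpow_of_nonneg _ _ (by positivity : (0:ℝ) ≤ 1 / q),
        ENNReal.mul_rpow_of_nonneg _ _ (by positivity : (0:ℝ) ≤ 1 / r),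
        ENNReal.mul_rpow_of_nonneg _ _ (by positivity : (0:ℝ) ≤ 1 / r), ← ENNReal.rpow_mul,
        ← ENNReal.rpow_mul, mul_one_div_cancel hr0.ne', ENNReal.rpow_one]
      calc k y x * f x = ((k y x) ^ (1 / q) * (k y x) ^ (1 / r)) *
            ((w y x) ^ (1 / q) * (w y x) ^ (-(r - 1) * (1 / r))) * f x := by rw [e, e', mul_one]
        _ = _ := by ring
    have H := ENNReal.lintegral_mul_le_Lp_mul_Lq μ hrq.symm
      (f := fun x => (k y x * w y x) ^ (1 / q))
      (g := fun x => (k y x * (w y x) ^ (-(r - 1)) * f x ^ r) ^ (1 / r))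
      (((hky.mul hwy').pow_const _).aemeasurable)
      ((((hky.mul (hwy'.pow_const _)).mul (hfm.pow_const _)).pow_const _).aemeasurable)
    simp only [← ENNReal.rpow_mul, one_div_mul_cancel hr0.ne', one_div_mul_cancel hq0.ne',
      ENNReal.rpow_one] at H
    rw [e1]
    calc _ ≤ ((∫⁻ x, k y x * w y x ∂μ) ^ (1 / q) *
          (∫⁻ x, k y x * (w y x) ^ (-(r - 1)) * f x ^ r ∂μ) ^ (1 / r)) ^ r :=
          ENNReal.rpow_le_rpow H hr0.le
      _ = (∫⁻ x, k y x * w y x ∂μ) ^ (r - 1) *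
          (∫⁻ x, k y x * (w y x) ^ (-(r - 1)) * f x ^ r ∂μ) := by
          rw [ENNReal.mul_rpow_of_nonneg _ _ hr0.le, ← ENNReal.rpow_mul, ← ENNReal.rpow_mul,
            one_div_mul_cancel hr0.ne', ENNReal.rpow_one, ← hrq1]
          congr 2; field_simp
      _ ≤ _ := by gcongr
  have hmeas : Measurable (Function.uncurry fun y x => k y x * (w y x) ^ (-(r - 1)) * f x ^ r) :=
    (hk.mul (hw.pow_const _)).mul ((hfm.comp measurable_snd).pow_const _)
  calc ∫⁻ y, (∫⁻ x, k y x * f x ∂μ) ^ r ∂ν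
      ≤ ∫⁻ y, A ^ (r - 1) * ∫⁻ x, k y x * (w y x) ^ (-(r - 1)) * f x ^ r ∂μ ∂ν :=
        lintegral_mono_ae key
    _ = A ^ (r - 1) * ∫⁻ y, ∫⁻ x, k y x * (w y x) ^ (-(r - 1)) * f x ^ r ∂μ ∂ν :=
        lintegral_const_mul _ hmeas.lintegral_prod_right'
    _ = A ^ (r - 1) * ∫⁻ x, ∫⁻ y, k y x * (w y x) ^ (-(r - 1)) * f x ^ r ∂ν ∂μ := by
        rw [lintegral_lintegral_swap hmeas.aemeasurable]
    _ = A ^ (r - 1) * ∫⁻ x, (∫⁻ y, k y x * (w y x) ^ (-(r - 1)) ∂ν) * f x ^ r ∂μ := by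
        congr 1; refine lintegral_congr fun x => ?_
        rw [lintegral_mul_const]
        exact (hk.mul (hw.pow_const _)).comp measurable_prodMk_right
    _ ≤ A ^ (r - 1) * ∫⁻ x, B * f x ^ r ∂μ := by
        gcongr 1
        refine lintegral_mono_ae ?_
        filter_upwards [hB] with x hx
        gcongr
    _ = _ := by rw [lintegral_const_mul _ (hfm.pow_const _), mul_assoc]

theorem eLpNorm_rpow_toReal {X E : Type*} {mX : MeasurableSpace X} {μ : Measure X}
    [NormedAddCommGroup E] {p : ℝ≥0∞} (hp0 : p ≠ 0) (hp : p ≠ ⊤) (f : X → E) :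
    eLpNorm f p μ ^ p.toReal = ∫⁻ x, ‖f x‖ₑ ^ p.toReal ∂μ := by
  rw [eLpNorm_eq_lintegral_rpow_enorm_toReal hp0 hp, ← ENNReal.rpow_mul,
    one_div_mul_cancel (ENNReal.toReal_pos hp0 hp).ne', ENNReal.rpow_one]

/-- Bounded operators from Schur's test. -/
theorem schur_kernel {X Y : Type*} {mX : MeasurableSpace X}
    {mY : MeasurableSpace Y} {μ : Measure X} {ν : Measure Y} [SFinite μ] [SFinite ν] {p : ℝ≥0∞}
    (hp1 : 1 < p) (hp : p ≠ ⊤) {k : Y → X → ℝ} {w : Y → X → ℝ≥0∞}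
    (hk : Measurable (Function.uncurry k))
    (hw : Measurable (Function.uncurry w)) (hw0 : ∀ᵐ y ∂ν, ∀ᵐ x ∂μ, w y x ≠ 0 ∧ w y x ≠ ⊤)
    {A B : ℝ≥0}
    (hA : ∀ᵐ y ∂ν, ∫⁻ x, ‖k y x‖ₑ * w y x ∂μ ≤ A)
    (hB : ∀ᵐ x ∂μ, ∫⁻ y, ‖k y x‖ₑ * (w y x) ^ (-(p.toReal - 1)) ∂ν ≤ B)
    {E : Type*} [NormedAddCommGroup E] [NormedSpace ℝ E] {f : X → E} (hf : MemLp f p μ) :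
    (∀ᵐ y ∂ν, Integrable (fun x => k y x • f x) μ) ∧
    MemLp (fun y => ∫ x, k y x • f x ∂μ) p ν ∧
    eLpNorm (fun y => ∫ x, k y x • f x ∂μ) p ν ≤
      ((A ^ (p.toReal - 1) * B) ^ (1 / p.toReal) : ℝ≥0) * eLpNorm f p μ := by
  have hp0 : p ≠ 0 := (zero_lt_one.trans hp1).ne'
  set r := p.toReal with hrdef
  have hr : 1 < r := by
    rw [hrdef, ← ENNReal.toReal_one]; exact (ENNReal.toReal_lt_toReal (by simp) hp).2 hp1
  have hr0 : 0 < r := by linarith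
  have S := lintegral_rpow_lintegral_le_of_schur (μ := μ) (ν := ν) hr
    (k := fun y x => ‖k y x‖ₑ) hk.enorm hw hw0 hA hB hf.1.enorm
  have hfr : ∫⁻ x, ‖f x‖ₑ ^ r ∂μ ≠ ⊤ := by
    rw [← eLpNorm_rpow_toReal hp0 hp]
    exact ENNReal.rpow_ne_top_of_nonneg hr0.le hf.2.ne
  have hsm : AEStronglyMeasurable (fun z : Y × X => k z.1 z.2 • f z.2) (ν.prod μ) :=
    (hk.aestronglyMeasurable).smul (hf.1.comp_snd)
  have fin : (A:ℝ≥0∞) ^ (r - 1) * B * ∫⁻ x, ‖f x‖ₑ ^ r ∂μ ≠ ⊤ := by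
    refine ENNReal.mul_ne_top (ENNReal.mul_ne_top ?_ (by simp)) hfr
    exact ENNReal.rpow_ne_top_of_nonneg (by linarith) (by simp)
  have meas : AEMeasurable (fun y => ∫⁻ x, ‖k y x‖ₑ * ‖f x‖ₑ ∂μ) ν := by
    have : AEMeasurable (fun z : Y × X => ‖k z.1 z.2‖ₑ * ‖f z.2‖ₑ) (ν.prod μ) := by
      simpa [enorm_smul] using hsm.enorm
    exact this.lintegral_prod_right'
  have hint : ∀ᵐ y ∂ν, Integrable (fun x => k y x • f x) μ := by
    have h1 := ae_lt_top' (meas.pow_const r) (ne_top_of_le_ne_top fin S)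
    filter_upwards [h1] with y h1
    refine ⟨((hk.comp measurable_prodMk_left).aestronglyMeasurable).smul hf.1, ?_⟩
    have := (ENNReal.rpow_lt_top_iff_of_pos hr0).1 h1
    simpa [HasFiniteIntegral, enorm_smul] using this
  have hbd : eLpNorm (fun y => ∫ x, k y x • f x ∂μ) p ν ≤
      ((A ^ (r - 1) * B) ^ (1 / r) : ℝ≥0) * eLpNorm f p μ := by
    rw [← ENNReal.rpow_le_rpow_iff hr0, ENNReal.mul_rpow_of_nonneg _ _ hr0.le, hrdef,
      eLpNorm_rpow_toReal hp0 hp, eLpNorm_rpow_toReal hp0 hp, ← hrdef]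
    have e : (((A ^ (r - 1) * B) ^ (1 / r) : ℝ≥0) : ℝ≥0∞) ^ r = (A:ℝ≥0∞) ^ (r - 1) * B := by
      rw [← ENNReal.coe_rpow_of_nonneg _ hr0.le, ← NNReal.rpow_mul,
        one_div_mul_cancel hr0.ne', NNReal.rpow_one, ENNReal.coe_mul,
        ENNReal.coe_rpow_of_nonneg _ (by linarith)]
    rw [e]
    refine le_trans (lintegral_mono fun y => ?_) S
    gcongr
    refine (enorm_integral_le_lintegral_enorm _).trans (le_of_eq ?_)
    simp [enorm_smul]
  refine ⟨hint, ⟨hsm.integral_prod_right', lt_of_le_of_lt hbd ?_⟩, hbd⟩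
  exact ENNReal.mul_lt_top (by simp) hf.2

/-! ### Poisson and conjugate Poisson kernels, and their convolutions. -/

/-- The Poisson kernel of the upper half plane. -/
noncomputable def poisK (ε u : ℝ) : ℝ := ε / (Real.pi * (u ^ 2 + ε ^ 2))

/-- The conjugate Poisson kernel of the upper half plane. -/
noncomputable def conjK (ε u : ℝ) : ℝ := u / (Real.pi * (u ^ 2 + ε ^ 2))

theorem sub_ne_zero_of_im_ne_zero {a : ℂ} (ha : a.im ≠ 0) (t : ℝ) : (t : ℂ) - a ≠ 0 := by
  intro h
  have := congrArg Complex.im h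
  simp at this
  exact ha this

theorem one_add_abs_le_norm_sub {ε R : ℝ} (hε : 0 < ε) {a : ℂ} (hR : |a.re| ≤ R)
    (ha : ε ≤ |a.im|) (t : ℝ) : 1 + |t| ≤ ((1 + R) / ε + 1) * ‖(t : ℂ) - a‖ := by
  have h1 : ε ≤ ‖(t : ℂ) - a‖ := by
    refine ha.trans ?_
    have := Complex.abs_im_le_norm ((t : ℂ) - a)
    simpa using this
  have h2 : |t - a.re| ≤ ‖(t : ℂ) - a‖ := by
    have := Complex.abs_re_le_norm ((t : ℂ) - a)
    simpa using this
  have h3 : |t| ≤ |t - a.re| + R := by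
    have := abs_add_le (t - a.re) a.re
    simp only [sub_add_cancel] at this
    linarith
  have hR0 : 0 ≤ R := (abs_nonneg _).trans hR
  have h4 : 1 + R ≤ (1 + R) / ε * ‖(t : ℂ) - a‖ := by
    rw [div_mul_eq_mul_div, le_div_iff₀ hε]
    gcongr
  linarith

theorem norm_inv_sub_le {ε R : ℝ} (hε : 0 < ε) {a : ℂ} (hR : |a.re| ≤ R)
    (ha : ε ≤ |a.im|) (t : ℝ) : ‖((t : ℂ) - a)⁻¹‖ ≤ ((1 + R) / ε + 1) * (1 + |t|)⁻¹ := by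
  have h := one_add_abs_le_norm_sub hε hR ha t
  have h0 : 0 < ‖(t : ℂ) - a‖ := norm_pos_iff.2 <| sub_ne_zero_of_im_ne_zero (by
    intro h; rw [h, abs_zero] at ha; linarith) t
  have h1 : 0 < 1 + |t| := by positivity
  rw [norm_inv, inv_le_iff_one_le_mul₀ h0, mul_right_comm, ← div_eq_mul_inv, one_le_div h1]
  exact h

theorem exists_norm_inv_sub_le {a : ℂ} (ha : a.im ≠ 0) :
    ∃ c : ℝ, 0 ≤ c ∧ ∀ t : ℝ, ‖((t : ℂ) - a)⁻¹‖ ≤ c * (1 + |t|)⁻¹ :=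
  ⟨((1 + |a.re|) / |a.im| + 1), by positivity,
    norm_inv_sub_le (abs_pos.2 ha) le_rfl le_rfl⟩

theorem continuous_inv_sub {a : ℂ} (ha : a.im ≠ 0) : Continuous fun t : ℝ => ((t : ℂ) - a)⁻¹ :=
  (by fun_prop : Continuous fun t : ℝ => (t : ℂ) - a).inv₀ (sub_ne_zero_of_im_ne_zero ha)

theorem integrable_inv_sub_mul_inv_sub {a b : ℂ} (ha : a.im ≠ 0) (hb : b.im ≠ 0) :
    Integrable fun t : ℝ => ((t : ℂ) - a)⁻¹ * ((t : ℂ) - b)⁻¹ := by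
  obtain ⟨c, hc, h1⟩ := exists_norm_inv_sub_le ha
  obtain ⟨d, hd, h2⟩ := exists_norm_inv_sub_le hb
  have h3 : Integrable fun t : ℝ => c * d * (1 + ‖t‖) ^ (-2 : ℝ) :=
    (integrable_one_add_norm (by simp)).const_mul _
  refine h3.mono' (((continuous_inv_sub ha).mul (continuous_inv_sub hb)).aestronglyMeasurable)
    (Eventually.of_forall fun t => ?_)
  rw [norm_mul]
  calc _ ≤ (c * (1 + |t|)⁻¹) * (d * (1 + |t|)⁻¹) := by gcongr; exacts [h1 t, h2 t]
    _ = _ := by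
      rw [Real.rpow_neg (by positivity), Real.norm_eq_abs, Real.rpow_two, pow_two, mul_inv]
      ring

theorem tendsto_log_sub_atTop (a : ℂ) :
    Tendsto (fun t : ℝ => Complex.log ((t : ℂ) - a) - (Real.log |t| : ℂ)) atTop (𝓝 0) := by
  have h1 : Tendsto (fun t : ℝ => (1 : ℂ) - a * ((t⁻¹ : ℝ) : ℂ)) atTop (𝓝 1) := by
    have : Tendsto (fun t : ℝ => ((t⁻¹ : ℝ) : ℂ)) atTop (𝓝 ((0 : ℝ) : ℂ)) :=
      (Complex.continuous_ofReal.tendsto 0).comp tendsto_inv_atTop_zero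
    simpa using (this.const_mul a).const_sub 1
  have h2 := (continuousAt_clog (x := 1) (by simp)).tendsto.comp h1
  rw [Complex.log_one] at h2
  refine h2.congr' ?_
  filter_upwards [eventually_gt_atTop (0 : ℝ), h1.eventually_ne one_ne_zero] with t ht hne
  have : (t : ℂ) - a = (t : ℂ) * (1 - a * ((t⁻¹ : ℝ) : ℂ)) := by
    have : (t : ℂ) ≠ 0 := by exact_mod_cast ht.ne'
    push_cast; field_simp
  rw [Function.comp, this, Complex.log_ofReal_mul ht hne, abs_of_pos ht]
  ring

/-- Here t - a = (-t)(-1 + a/t), and for t < 0 the number -1 + a/t approaches the branch cut from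
the side opposite to the sign of `a.im`. Hence the limit -πi or πi of the principal logarithm. -/
theorem tendsto_log_sub_atBot (a : ℂ) :
    Tendsto (fun t : ℝ => Complex.log ((t : ℂ) - a) - (Real.log |t| : ℂ)) atBot
      (𝓝 (if 0 < a.im then -(Real.pi * Complex.I) else Real.pi * Complex.I)) := by
  have h1 : Tendsto (fun t : ℝ => (-1 : ℂ) + a * ((t⁻¹ : ℝ) : ℂ)) atBot (𝓝 (-1)) := by
    have : Tendsto (fun t : ℝ => ((t⁻¹ : ℝ) : ℂ)) atBot (𝓝 ((0 : ℝ) : ℂ)) :=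
      (Complex.continuous_ofReal.tendsto 0).comp tendsto_inv_atBot_zero
    simpa using (this.const_mul a).const_add (-1)
  have key : Tendsto (fun t : ℝ => Complex.log ((-1 : ℂ) + a * ((t⁻¹ : ℝ) : ℂ))) atBot
      (𝓝 (if 0 < a.im then -(Real.pi * Complex.I) else Real.pi * Complex.I)) := by
    split_ifs with h
    · have := Complex.tendsto_log_nhdsWithin_im_neg_of_re_neg_of_im_zero (z := -1) (by simp)
        (by simp)
      simp only [norm_neg, norm_one, Real.log_one, Complex.ofReal_zero, zero_sub] at this
      refine this.comp (tendsto_nhdsWithin_iff.2 ⟨h1, ?_⟩)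
      filter_upwards [eventually_lt_atBot (0 : ℝ)] with t ht
      have : t⁻¹ < 0 := inv_lt_zero.2 ht
      simp only [Complex.add_im, Complex.neg_im, Complex.one_im,
        Complex.im_mul_ofReal]
      nlinarith
    · have := Complex.tendsto_log_nhdsWithin_im_nonneg_of_re_neg_of_im_zero (z := -1) (by simp)
        (by simp)
      simp only [norm_neg, norm_one, Real.log_one, Complex.ofReal_zero, zero_add] at this
      refine this.comp (tendsto_nhdsWithin_iff.2 ⟨h1, ?_⟩)
      filter_upwards [eventually_lt_atBot (0 : ℝ)] with t ht
      have : t⁻¹ < 0 := inv_lt_zero.2 ht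
      simp only [Complex.add_im, Complex.neg_im, Complex.one_im,
        Complex.im_mul_ofReal]
      push Not at h
      nlinarith
  refine key.congr' ?_
  filter_upwards [eventually_lt_atBot (0 : ℝ), h1.eventually_ne (by norm_num : (-1 : ℂ) ≠ 0)]
    with t ht hne
  have : (t : ℂ) - a = ((-t : ℝ) : ℂ) * (-1 + a * ((t⁻¹ : ℝ) : ℂ)) := by
    have : (t : ℂ) ≠ 0 := by exact_mod_cast ht.ne
    push_cast; field_simp; ring
  rw [this, Complex.log_ofReal_mul (by linarith) hne, abs_of_neg ht]
  ring

/-- A residue computation without contours. A primitive is (log(t - a) - log(t - b))/(a - b), which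
is smooth because t - a and t - b never meet the branch cut. It vanishes at +∞, so only the limits
of the two logarithms at -∞ contribute. -/
theorem integral_inv_sub_mul_inv_sub {a b : ℂ} (ha : a.im ≠ 0) (hb : b.im ≠ 0) (hab : a ≠ b) :
    ∫ t : ℝ, ((t : ℂ) - a)⁻¹ * ((t : ℂ) - b)⁻¹ =
      (a - b)⁻¹ * ((if 0 < b.im then -(Real.pi * Complex.I) else Real.pi * Complex.I) -
        (if 0 < a.im then -(Real.pi * Complex.I) else Real.pi * Complex.I)) := by
  have hab' : a - b ≠ 0 := sub_ne_zero.2 hab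
  have hd : ∀ c : ℂ, c.im ≠ 0 → ∀ t : ℝ,
      HasDerivAt (fun t : ℝ => Complex.log ((t : ℂ) - c)) (((t : ℂ) - c)⁻¹) t := by
    intro c hc t
    have h1 : HasDerivAt (fun t : ℝ => (t : ℂ) - c) 1 t :=
      (Complex.ofRealCLM.hasDerivAt (x := t)).sub_const c
    have := h1.clog_real (Or.inr (by simpa using hc))
    simpa using this
  have hderiv : ∀ t : ℝ, HasDerivAt
      (fun t : ℝ => (a - b)⁻¹ * (Complex.log ((t : ℂ) - a) - Complex.log ((t : ℂ) - b)))
      (((t : ℂ) - a)⁻¹ * ((t : ℂ) - b)⁻¹) t := by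
    intro t
    refine (((hd a ha t).sub (hd b hb t)).const_mul (a - b)⁻¹).congr_deriv ?_
    have h1 := sub_ne_zero_of_im_ne_zero ha t
    have h2 := sub_ne_zero_of_im_ne_zero hb t
    field_simp
    ring
  have l1 : Tendsto (fun t : ℝ => (a - b)⁻¹ * (Complex.log ((t : ℂ) - a) - Complex.log ((t : ℂ) - b)))
      atTop (𝓝 0) := by
    have := ((tendsto_log_sub_atTop a).sub (tendsto_log_sub_atTop b)).const_mul (a - b)⁻¹
    simpa using this
  have l2 := ((tendsto_log_sub_atBot a).sub (tendsto_log_sub_atBot b)).const_mul (a - b)⁻¹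
  simp only [sub_sub_sub_cancel_right] at l2
  rw [integral_of_hasDerivAt_of_tendsto hderiv (integrable_inv_sub_mul_inv_sub ha hb) l2 l1]
  ring

theorem integral_inv_sub_mul_inv_sub_lower {a b : ℂ} (ha : a.im < 0) (hb : b.im < 0) :
    ∫ t : ℝ, ((t : ℂ) - a)⁻¹ * ((t : ℂ) - b)⁻¹ = 0 := by
  by_cases hab : a = b
  · subst hab
    have hderiv : ∀ t : ℝ, HasDerivAt (fun t : ℝ => -((t : ℂ) - a)⁻¹)
        (((t : ℂ) - a)⁻¹ * ((t : ℂ) - a)⁻¹) t := by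
      intro t
      have h1 : HasDerivAt (fun t : ℝ => (t : ℂ) - a) 1 t :=
        (Complex.ofRealCLM.hasDerivAt (x := t)).sub_const a
      have h2 := sub_ne_zero_of_im_ne_zero ha.ne t
      refine (h1.fun_inv h2).neg.congr_deriv ?_
      field_simp
    obtain ⟨c, hc, h1⟩ := exists_norm_inv_sub_le ha.ne
    have lim : ∀ l : Filter ℝ, Tendsto (fun t : ℝ => |t|) l atTop →
        Tendsto (fun t : ℝ => -((t : ℂ) - a)⁻¹) l (𝓝 0) := by
      intro l hl
      rw [← neg_zero]
      refine Tendsto.neg (squeeze_zero_norm h1 ?_)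
      have : Tendsto (fun t : ℝ => c * (1 + |t|)⁻¹) l (𝓝 (c * 0)) :=
        ((tendsto_inv_atTop_zero.comp (tendsto_atTop_add_const_left _ 1 hl))).const_mul c
      simpa using this
    rw [integral_of_hasDerivAt_of_tendsto hderiv (integrable_inv_sub_mul_inv_sub ha.ne ha.ne)
      (lim _ tendsto_abs_atBot_atTop) (lim _ tendsto_abs_atTop_atTop), sub_zero]
  · rw [integral_inv_sub_mul_inv_sub ha.ne hb.ne hab]
    simp [not_lt.2 ha.le, not_lt.2 hb.le]

theorem ofReal_poisK {ε : ℝ} (hε : 0 < ε) (x t : ℝ) : (poisK ε (x - t) : ℂ) =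
    (2 * Real.pi * Complex.I)⁻¹ * (((t : ℂ) - (x + ε * Complex.I))⁻¹
      - ((t : ℂ) - (x - ε * Complex.I))⁻¹) := by
  have h1 := sub_ne_zero_of_im_ne_zero (a := x + ε * Complex.I) (by simpa using hε.ne') t
  have h2 := sub_ne_zero_of_im_ne_zero (a := x - ε * Complex.I) (by simpa using hε.ne') t
  have h3 : ((x : ℂ) - t) ^ 2 + ε ^ 2 ≠ 0 := by norm_cast; positivity
  have h4 : ((x : ℂ) - t) ^ 2 + ε ^ 2 =
      (t - (x + ε * Complex.I)) * (t - (x - ε * Complex.I)) := by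
    linear_combination (ε : ℂ) ^ 2 * Complex.I_sq
  have hpi : (Real.pi : ℂ) ≠ 0 := by simp [Real.pi_ne_zero]
  rw [poisK]
  push_cast
  rw [h4]
  field_simp
  ring

theorem ofReal_conjK_sub_poisK {ε : ℝ} (hε : 0 < ε) (u : ℝ) :
    (conjK ε u : ℂ) - poisK ε u * Complex.I = (Real.pi : ℂ)⁻¹ * ((u : ℂ) - (-(ε * Complex.I)))⁻¹ := by
  have h1 := sub_ne_zero_of_im_ne_zero (a := -(ε * Complex.I)) (by simpa using hε.ne') u
  have h3 : (u : ℂ) ^ 2 + ε ^ 2 ≠ 0 := by norm_cast; positivity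
  have hpi : (Real.pi : ℂ) ≠ 0 := by simp [Real.pi_ne_zero]
  rw [poisK, conjK]
  push_cast
  field_simp
  linear_combination -(ε : ℂ) ^ 2 * Complex.I_sq

/-- P_ε(x - ·) is a difference of Cauchy kernels with poles x ± iε, while the second factor has its
pole at -iδ. The pole x - iε lies on the same side as -iδ and contributes nothing; the other one
evaluates the Cauchy kernel at height ε + δ. Real and imaginary parts give the two convolution rules
for P and Q. -/
theorem integral_poisK_mul_cauchy {ε δ : ℝ} (hε : 0 < ε) (hδ : 0 < δ) (x : ℝ) :
    ∫ t : ℝ, (poisK ε (x - t) : ℂ) * ((conjK δ t : ℂ) - poisK δ t * Complex.I) =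
      (conjK (ε + δ) x : ℂ) - poisK (ε + δ) x * Complex.I := by
  have ia : ((x : ℂ) + ε * Complex.I).im = ε := by simp
  have ib : ((x : ℂ) - ε * Complex.I).im = -ε := by simp
  have ic : (-((δ : ℂ) * Complex.I)).im = -δ := by simp
  have e : ∀ t : ℝ, (poisK ε (x - t) : ℂ) * ((conjK δ t : ℂ) - poisK δ t * Complex.I) =
      (2 * Real.pi * Complex.I)⁻¹ * (Real.pi : ℂ)⁻¹ *
      (((t : ℂ) - (x + ε * Complex.I))⁻¹ * ((t : ℂ) - (-(δ * Complex.I)))⁻¹ -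
        ((t : ℂ) - (x - ε * Complex.I))⁻¹ * ((t : ℂ) - (-(δ * Complex.I)))⁻¹) := by
    intro t
    rw [ofReal_poisK hε, ofReal_conjK_sub_poisK hδ]; ring
  simp_rw [e]
  have hne : (x : ℂ) + ε * Complex.I ≠ -(δ * Complex.I) := by
    intro h
    have := congrArg Complex.im h
    rw [ia, ic] at this; linarith
  rw [integral_const_mul, integral_sub, integral_inv_sub_mul_inv_sub (by rw [ia]; exact hε.ne')
    (by rw [ic]; linarith) hne, integral_inv_sub_mul_inv_sub_lower, ofReal_conjK_sub_poisK (by positivity)]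
  · rw [ia, ic, if_pos hε, if_neg (by linarith)]
    have hpi : (Real.pi : ℂ) ≠ 0 := by simp [Real.pi_ne_zero]
    have h1 : (x : ℂ) + ε * Complex.I - -(δ * Complex.I) ≠ 0 := sub_ne_zero.2 hne
    have h2 : (x : ℂ) - -(((ε + δ : ℝ) : ℂ) * Complex.I) = x + ε * Complex.I - -(δ * Complex.I) := by
      push_cast; ring
    rw [h2]
    have hI := Complex.I_ne_zero
    field_simp
    ring
  · rw [ib]; linarith
  · rw [ic]; linarith
  · exact integrable_inv_sub_mul_inv_sub (by rw [ia]; exact hε.ne') (by rw [ic]; linarith)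
  · exact integrable_inv_sub_mul_inv_sub (by rw [ib]; linarith) (by rw [ic]; linarith)

theorem continuous_poisK {ε : ℝ} (hε : 0 < ε) : Continuous (poisK ε) := by
  unfold poisK
  exact continuous_const.div (by fun_prop) fun u => by positivity

theorem continuous_conjK {ε : ℝ} (hε : 0 < ε) : Continuous (conjK ε) := by
  unfold conjK
  exact continuous_id.div (by fun_prop) fun u => by positivity

theorem poisK_pos {ε : ℝ} (hε : 0 < ε) (u : ℝ) : 0 < poisK ε u := by
  unfold poisK; positivity

theorem conjK_neg (ε u : ℝ) : conjK ε (-u) = -conjK ε u := by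
  unfold conjK; rw [neg_sq, neg_div]

theorem norm_conjK_sub_poisK_le {ε : ℝ} (hε : 0 < ε) (u : ℝ) :
    ‖(conjK ε u : ℂ) - poisK ε u * Complex.I‖ ≤ (1 / ε + 1) * (1 + |u|)⁻¹ := by
  rw [ofReal_conjK_sub_poisK hε, norm_mul]
  have h := norm_inv_sub_le (R := 0) hε (a := -(ε * Complex.I)) (by simp)
    (by simp [abs_of_pos hε]) u
  have h2 : ‖(Real.pi : ℂ)⁻¹‖ ≤ 1 := by
    rw [norm_inv, Complex.norm_real, Real.norm_of_nonneg Real.pi_pos.le]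
    exact inv_le_one_of_one_le₀ (by linarith [Real.pi_gt_three])
  rw [add_zero] at h
  calc _ ≤ 1 * ((1 / ε + 1) * (1 + |u|)⁻¹) := by gcongr
    _ = _ := one_mul _

theorem abs_conjK_le {ε : ℝ} (hε : 0 < ε) (u : ℝ) :
    |conjK ε u| ≤ (1 / ε + 1) * (1 + |u|)⁻¹ := by
  refine le_trans ?_ (norm_conjK_sub_poisK_le hε u)
  simpa using Complex.abs_re_le_norm ((conjK ε u : ℂ) - poisK ε u * Complex.I)

theorem abs_poisK_le {ε : ℝ} (hε : 0 < ε) (u : ℝ) :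
    |poisK ε u| ≤ (1 / ε + 1) * (1 + |u|)⁻¹ := by
  refine le_trans ?_ (norm_conjK_sub_poisK_le hε u)
  simpa using Complex.abs_im_le_norm ((conjK ε u : ℂ) - poisK ε u * Complex.I)

theorem integrable_poisK {ε : ℝ} (hε : 0 < ε) : Integrable (poisK ε) := by
  have h := (integrable_inv_one_add_sq.comp_div hε.ne').const_mul (1 / (Real.pi * ε))
  refine h.congr (Eventually.of_forall fun u => ?_)
  simp only [poisK]
  have : (1 + (u / ε) ^ 2) = (u ^ 2 + ε ^ 2) / ε ^ 2 := by field_simp; ring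
  rw [this]
  have := Real.pi_pos
  field_simp

theorem integral_poisK {ε : ℝ} (hε : 0 < ε) : ∫ u, poisK ε u = 1 := by
  have e : ∀ u, poisK ε u = (1 / (Real.pi * ε)) * (1 + (u / ε) ^ 2)⁻¹ := by
    intro u
    simp only [poisK]
    have : (1 + (u / ε) ^ 2) = (u ^ 2 + ε ^ 2) / ε ^ 2 := by field_simp; ring
    rw [this]
    have := Real.pi_pos
    field_simp
  simp_rw [e]
  rw [integral_const_mul, Measure.integral_comp_div (fun u : ℝ => (1 + u ^ 2)⁻¹) ε,
    integral_univ_inv_one_add_sq, abs_of_pos hε]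
  have := Real.pi_pos
  simp only [smul_eq_mul]
  field_simp

theorem lintegral_poisK {ε : ℝ} (hε : 0 < ε) : ∫⁻ u, ‖poisK ε u‖ₑ = 1 := by
  rw [← ofReal_integral_norm_eq_lintegral_enorm (integrable_poisK hε)]
  simp_rw [Real.norm_of_nonneg (poisK_pos hε _).le]
  simp [integral_poisK hε]

theorem integral_poisK_mul_conjK {ε δ : ℝ} (hε : 0 < ε) (hδ : 0 < δ) (x : ℝ) :
    (∫ t, poisK ε (x - t) * conjK δ t = conjK (ε + δ) x) ∧
    (∫ t, poisK ε (x - t) * poisK δ t = poisK (ε + δ) x) := by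
  have h := integral_poisK_mul_cauchy hε hδ x
  have hi : Integrable fun t : ℝ => (poisK ε (x - t) : ℂ) *
      ((conjK δ t : ℂ) - poisK δ t * Complex.I) := by
    have h1 : Integrable fun t : ℝ => (poisK ε (x - t) : ℂ) :=
      ((integrable_poisK hε).comp_sub_left x).ofReal
    refine h1.mul_bdd (c := 1 / δ + 1) ?_ (Eventually.of_forall fun t => ?_)
    · exact (by
        have := continuous_conjK hδ
        have := continuous_poisK hδ
        fun_prop : Continuous fun t : ℝ => (conjK δ t : ℂ) - poisK δ t * Complex.I).aestronglyMeasurable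
    · refine (norm_conjK_sub_poisK_le hδ t).trans ?_
      refine mul_le_of_le_one_right (by positivity) (inv_le_one_of_one_le₀ ?_)
      linarith [abs_nonneg t]
  constructor
  · have := congrArg Complex.re h
    rw [← Complex.reCLM_apply, ← Complex.reCLM.integral_comp_comm hi] at this
    simpa using this
  · have := congrArg Complex.im h
    rw [← Complex.imCLM_apply, ← Complex.imCLM.integral_comp_comm hi] at this
    simp only [Complex.imCLM_apply, Complex.sub_im, Complex.ofReal_im,
      Complex.mul_im, Complex.ofReal_re, Complex.I_im, mul_one, Complex.I_re, mul_zero, add_zero,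
      zero_sub, mul_neg, zero_mul, integral_neg, neg_inj] at this
    exact this

theorem memLp_one_add_abs_inv {q : ℝ≥0∞} (hq : 1 < q) : MemLp (fun t : ℝ => (1 + |t|)⁻¹) q := by
  have hc : Continuous fun t : ℝ => (1 + |t|)⁻¹ :=
    (by fun_prop : Continuous fun t : ℝ => 1 + |t|).inv₀ fun t => by positivity
  by_cases hqt : q = ⊤
  · subst hqt
    refine memLp_top_of_bound hc.aestronglyMeasurable 1 (Eventually.of_forall fun t => ?_)
    rw [Real.norm_of_nonneg (by positivity)]
    exact inv_le_one_of_one_le₀ (by linarith [abs_nonneg t])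
  · rw [← integrable_norm_rpow_iff hc.aestronglyMeasurable (zero_lt_one.trans hq).ne' hqt]
    have h1 : 1 < q.toReal := by
      rw [← ENNReal.toReal_one]; exact (ENNReal.toReal_lt_toReal (by simp) hqt).2 hq
    have := integrable_one_add_norm (E := ℝ) (μ := volume) (r := q.toReal) (by simpa using h1)
    refine this.congr (Eventually.of_forall fun t => ?_)
    have e : ‖(1 + |t|)⁻¹‖ = (1 + |t|)⁻¹ := Real.norm_of_nonneg (by positivity)
    simp only
    rw [e, Real.norm_eq_abs, Real.inv_rpow (by positivity), Real.rpow_neg (by positivity)]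

/-- Hölder's inequality, as (1 + |t|)⁻¹ lies in L_q for every q > 1. This is why kernels decaying
only like 1/|u| can be convolved with any function of L_p, p < ∞. -/
theorem integrable_inv_mul_norm {E : Type*} [NormedAddCommGroup E] {p : ℝ≥0∞} (hp1 : 1 ≤ p) (hp : p ≠ ⊤) {f : ℝ → E}
    (hf : MemLp f p) : Integrable fun t => (1 + |t|)⁻¹ * ‖f t‖ := by
  have : ENNReal.HolderConjugate p (ENNReal.conjExponent p) :=
    ENNReal.HolderConjugate.conjExponent hp1
  have hq : 1 < ENNReal.conjExponent p := by
    have h := ENNReal.HolderConjugate.symm (p := p) (q := ENNReal.conjExponent p)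
    exact (ENNReal.HolderConjugate.lt_top_iff_one_lt p _).1 hp.lt_top
  have := (memLp_one_add_abs_inv hq).integrable_mul hf.norm
  exact this

/-! ### Convolution with kernels of decay 1/|u|. -/

section kconv

variable {E : Type*} [NormedAddCommGroup E] [NormedSpace ℝ E]

/-- Convolution of a function with a real kernel on the line. -/
noncomputable def kconv (k : ℝ → ℝ) (f : ℝ → E) (x : ℝ) : E := ∫ t, k (x - t) • f t

/-- A continuous kernel on the line which decays at least like `1 / |u|`. -/
def DecayKernel (k : ℝ → ℝ) : Prop := Continuous k ∧ ∃ c, 0 ≤ c ∧ ∀ u, |k u| ≤ c * (1 + |u|)⁻¹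

theorem decayKernel_poisK {ε : ℝ} (hε : 0 < ε) : DecayKernel (poisK ε) :=
  ⟨continuous_poisK hε, _, by positivity, abs_poisK_le hε⟩

theorem decayKernel_conjK {ε : ℝ} (hε : 0 < ε) : DecayKernel (conjK ε) :=
  ⟨continuous_conjK hε, _, by positivity, abs_conjK_le hε⟩

theorem DecayKernel.abs {k : ℝ → ℝ} (hk : DecayKernel k) : DecayKernel fun u => |k u| := by
  obtain ⟨h1, c, hc, h2⟩ := hk
  exact ⟨h1.abs, c, hc, by simpa using h2⟩

/-- A majorant that serves all x in a bounded set at once; it drives the dominated convergence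
behind the continuity of `kconv k f`. -/
theorem DecayKernel.abs_sub_le {k : ℝ → ℝ} (hk : DecayKernel k) (R : ℝ) :
    ∃ c, 0 ≤ c ∧ ∀ x t, |x| ≤ R → |k (x - t)| ≤ c * (1 + |t|)⁻¹ := by
  obtain ⟨-, c, hc, h⟩ := hk
  refine ⟨c * (1 + |R|), by positivity, fun x t hx => (h _).trans ?_⟩
  rw [mul_assoc]
  gcongr
  rw [inv_le_iff_one_le_mul₀ (by positivity), mul_assoc, mul_left_comm,
    ← div_eq_inv_mul, one_le_div (by positivity)]
  have h1 : |t| ≤ |x - t| + |x| := by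
    have := abs_sub x (x - t)
    rw [sub_sub_cancel] at this
    linarith
  have h2 := le_abs_self R
  nlinarith [abs_nonneg (x - t), abs_nonneg R]

theorem DecayKernel.integrable {p : ℝ≥0∞} (hp1 : 1 ≤ p) (hp : p ≠ ⊤) {f : ℝ → E}
    (hf : MemLp f p) {k : ℝ → ℝ} (hk : DecayKernel k) (x : ℝ) :
    Integrable fun t => k (x - t) • f t := by
  obtain ⟨c, hc, h⟩ := hk.abs_sub_le |x|
  refine ((integrable_inv_mul_norm hp1 hp hf).const_mul c).mono'
    ((hk.1.comp (by fun_prop)).aestronglyMeasurable.smul hf.1) (Eventually.of_forall fun t => ?_)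
  rw [norm_smul, ← mul_assoc, Real.norm_eq_abs]
  gcongr
  exact h x t le_rfl

theorem DecayKernel.continuous_kconv {p : ℝ≥0∞} (hp1 : 1 ≤ p) (hp : p ≠ ⊤) {f : ℝ → E}
    (hf : MemLp f p) {k : ℝ → ℝ} (hk : DecayKernel k) : Continuous (kconv k f) := by
  rw [continuous_iff_continuousAt]
  intro x
  obtain ⟨c, hc, h⟩ := hk.abs_sub_le (|x| + 1)
  refine continuousAt_of_dominated (bound := fun t => c * ((1 + |t|)⁻¹ * ‖f t‖)) ?_ ?_
    ((integrable_inv_mul_norm hp1 hp hf).const_mul c) ?_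
  · exact Eventually.of_forall fun y => (hk.integrable hp1 hp hf y).1
  · have : ∀ᶠ y in 𝓝 x, |y| < |x| + 1 :=
      (continuous_abs.tendsto x).eventually (gt_mem_nhds (by linarith))
    filter_upwards [this] with y hy
    refine Eventually.of_forall fun t => ?_
    rw [norm_smul, ← mul_assoc, Real.norm_eq_abs]
    gcongr
    exact h y t hy.le
  · refine Eventually.of_forall fun t => ?_
    have := hk.1
    fun_prop

/-- Fubini, with `hkk` encoding P_ε * k = k'. Integrability of f is what makes the double integral
absolutely convergent for a merely bounded k; general f in L_p are reached later by density. -/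
theorem kconv_comp_of_integrable {f : ℝ → ℂ} (hf : Integrable f) {ε : ℝ} (hε : 0 < ε)
    {k k' : ℝ → ℝ} (hk : DecayKernel k)
    (hkk : ∀ x, ∫ t, poisK ε (x - t) * k t = k' x) (x : ℝ) :
    kconv (poisK ε) (kconv k f) x = kconv k' f x := by
  obtain ⟨hkc, c, hc, hkb⟩ := hk
  have hcb : ∀ u, |k u| ≤ c := fun u => (hkb u).trans <| by
    refine mul_le_of_le_one_right hc (inv_le_one_of_one_le₀ ?_)
    linarith [abs_nonneg u]
  have hP := (integrable_poisK hε).comp_sub_left x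
  have hprod : Integrable (Function.uncurry fun s t => poisK ε (x - s) • k (s - t) • f t)
      (volume.prod volume) := by
    have h1 := (hP.ofReal (𝕜 := ℂ)).mul_prod hf
    refine (h1.norm.const_mul c).mono' ?_ (Eventually.of_forall ?_)
    · have h2 : AEStronglyMeasurable (fun z : ℝ × ℝ => k (z.1 - z.2))
        ((volume : Measure ℝ).prod volume) := (hkc.comp (by fun_prop)).aestronglyMeasurable
      have h3 : AEStronglyMeasurable (fun z : ℝ × ℝ => poisK ε (x - z.1))
        ((volume : Measure ℝ).prod volume) :=
        ((continuous_poisK hε).comp (by fun_prop)).aestronglyMeasurable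
      exact h3.smul (h2.smul hf.1.comp_snd)
    · rintro ⟨s, t⟩
      simp only [Function.uncurry, norm_smul, Real.norm_eq_abs, norm_mul]
      rw [RCLike.norm_ofReal]
      calc _ = |k (s - t)| * (|poisK ε (x - s)| * ‖f t‖) := by ring
        _ ≤ _ := by gcongr; exact hcb _
  unfold kconv
  simp_rw [← integral_smul]
  rw [integral_integral_swap hprod]
  refine integral_congr_ae (Eventually.of_forall fun t => ?_)
  simp only [smul_smul]
  rw [integral_smul_const, ← hkk]
  congr 1
  rw [← integral_sub_right_eq_self (fun s => poisK ε (x - t - s) * k s) t]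
  refine integral_congr_ae (Eventually.of_forall fun s => ?_)
  simp only
  rw [sub_sub, add_sub_cancel]

/-- Schur's test with weight 1: P_ε has total mass 1 in either variable. -/
theorem eLpNorm_kconv_poisK_le {p : ℝ≥0∞} (hp1 : 1 < p) (hp : p ≠ ⊤) {ε : ℝ} (hε : 0 < ε)
    {f : ℝ → E} (hf : MemLp f p) :
    MemLp (kconv (poisK ε) f) p ∧ eLpNorm (kconv (poisK ε) f) p volume ≤ eLpNorm f p volume := by
  have h := schur_kernel (μ := (volume : Measure ℝ)) (ν := (volume : Measure ℝ)) hp1 hp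
    (k := fun x t => poisK ε (x - t)) (w := fun _ _ => 1) (A := 1) (B := 1)
    (((continuous_poisK hε).comp (by fun_prop : Continuous fun z : ℝ × ℝ => z.1 - z.2)).measurable)
    measurable_const (Eventually.of_forall fun _ => Eventually.of_forall fun _ => by simp)
    (Eventually.of_forall fun x => by
      simp only [mul_one]
      rw [lintegral_sub_left_eq_self (fun u => ‖poisK ε u‖ₑ) x, lintegral_poisK hε]
      simp)
    (Eventually.of_forall fun t => by
      simp only [mul_one, ENNReal.one_rpow]
      rw [lintegral_sub_right_eq_self (fun u => ‖poisK ε u‖ₑ) t, lintegral_poisK hε]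
      simp) hf
  refine ⟨h.2.1, ?_⟩
  exact h.2.2.trans (by simp)

end kconv

/-! ### M. Riesz's inequality for 1 < r ≤ 2. -/

/-- The pointwise inequality behind M. Riesz's theorem. -/
theorem exists_abs_im_rpow_le {r : ℝ} (hr : 1 < r) (hr2 : r ≤ 2) :
    ∃ A B : ℝ, 0 ≤ A ∧ ∀ w : ℂ, 0 < w.re →
      |w.im| ^ r ≤ A * w.re ^ r - B * (w ^ (r : ℂ)).re := by
  have hpi := Real.pi_pos
  -- The angle θ₀ < π/2 is taken with rθ₀ > π/2, so cos(rθ₀) < 0. B is chosen to make -B cos(rθ₀) =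
  -- 1, and A to make A cos(θ₀)^r = 1 + B. The bound r ≤ 2 keeps rθ in [0, π], where the cosine
  -- decreases.
  obtain ⟨θ₀, h1, h2⟩ : ∃ θ₀, Real.pi / (2 * r) < θ₀ ∧ θ₀ < Real.pi / 2 := by
    apply exists_between
    rw [div_lt_div_iff₀ (by positivity) (by positivity)]
    nlinarith
  have hr0 : 0 < r := by linarith
  have hθ0 : 0 < θ₀ := lt_trans (by positivity) h1
  have h1' : Real.pi / 2 < r * θ₀ := by
    rw [div_lt_iff₀ (by positivity)] at h1; nlinarith
  have h2' : r * θ₀ < Real.pi := by nlinarith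
  have hc : Real.cos (r * θ₀) < 0 :=
    Real.cos_neg_of_pi_div_two_lt_of_lt h1' (by linarith)
  have hc0 : 0 < Real.cos θ₀ := Real.cos_pos_of_mem_Ioo ⟨by linarith, h2⟩
  set B := -(Real.cos (r * θ₀))⁻¹ with hB
  have hB0 : 0 < B := by rw [hB]; simpa using hc
  set A := (1 + B) / (Real.cos θ₀) ^ r with hA
  have hA0 : 0 < A := by positivity
  refine ⟨A, B, hA0.le, fun w hw => ?_⟩
  have hw0 : 0 < ‖w‖ := norm_pos_iff.2 (by rintro rfl; simp at hw)
  set θ := |w.arg| with hθ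
  have hθ2 : θ < Real.pi / 2 := Complex.abs_arg_lt_pi_div_two_iff.2 (Or.inl hw)
  have hθn : 0 ≤ θ := abs_nonneg _
  have ecos : Real.cos w.arg = Real.cos θ := (Real.cos_abs _).symm
  have ecos' : Real.cos (w.arg * r) = Real.cos (r * θ) := by
    rw [← Real.cos_abs, abs_mul, abs_of_pos hr0, mul_comm]
  have ere : w.re = ‖w‖ * Real.cos θ := by rw [← ecos, Complex.norm_mul_cos_arg]
  have him : |w.im| ≤ ‖w‖ := Complex.abs_im_le_norm w
  have hcos : 0 < Real.cos θ := Real.cos_pos_of_mem_Ioo ⟨by linarith, hθ2⟩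
  rw [Complex.cpow_ofReal_re, ecos', ere, Real.mul_rpow hw0.le hcos.le]
  -- For θ ≤ θ₀ the term with A is at least 1 + B and absorbs B cos(rθ). For θ ≥ θ₀ the term -B
  -- cos(rθ) is already at least 1.
  have key : 1 ≤ A * Real.cos θ ^ r - B * Real.cos (r * θ) := by
    rcases le_total θ θ₀ with h | h
    · have h3 : Real.cos θ₀ ≤ Real.cos θ := Real.cos_le_cos_of_nonneg_of_le_pi hθn (by linarith) h
      have h4 : 1 + B ≤ A * Real.cos θ ^ r := by
        rw [hA, div_mul_eq_mul_div, le_div_iff₀ (by positivity)]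
        gcongr
      have h5 : B * Real.cos (r * θ) ≤ B * 1 := by gcongr; exact Real.cos_le_one _
      linarith
    · have h3 : Real.cos (r * θ) ≤ Real.cos (r * θ₀) := by
        apply Real.cos_le_cos_of_nonneg_of_le_pi (by positivity) _ (by gcongr)
        nlinarith
      have h4 : B * Real.cos (r * θ) ≤ B * Real.cos (r * θ₀) := by gcongr
      have h5 : B * Real.cos (r * θ₀) = -1 := by rw [hB, neg_mul, inv_mul_cancel₀ hc.ne]
      have h6 : 0 ≤ A * Real.cos θ ^ r := by positivity
      linarith
  calc |w.im| ^ r ≤ ‖w‖ ^ r * 1 := by rw [mul_one]; gcongr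
    _ ≤ ‖w‖ ^ r * (A * Real.cos θ ^ r - B * Real.cos (r * θ)) := by gcongr
    _ = _ := by ring

/-- Vanishing of the integral over a horizontal line of a function which is holomorphic and decays
in the half plane above it. -/
theorem integral_line_eq_zero {G : ℂ → ℂ} {δ r C : ℝ} (hδ : 0 < δ) (hr : 1 < r)
    (hG : DifferentiableOn ℂ G {z | 0 < z.im})
    (h1 : ∀ z : ℂ, δ ≤ z.im → ‖G z‖ ≤ C * (1 + |z.re|) ^ (-r))
    (h2 : ∀ z : ℂ, δ ≤ z.im → ‖G z‖ ≤ C * z.im ^ (-r)) :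
    Integrable (fun x : ℝ => G (x + δ * Complex.I)) ∧ ∫ x : ℝ, G (x + δ * Complex.I) = 0 := by
  have hcont : Continuous fun x : ℝ => G (x + δ * Complex.I) := by
    refine hG.continuousOn.comp_continuous (by fun_prop) fun x => ?_
    simpa using hδ
  have hint : Integrable (fun x : ℝ => G (x + δ * Complex.I)) := by
    have h3 : Integrable fun x : ℝ => C * (1 + ‖x‖) ^ (-r) :=
      (integrable_one_add_norm (by simpa using hr)).const_mul _
    refine h3.mono' hcont.aestronglyMeasurable (Eventually.of_forall fun x => ?_)
    have := h1 (x + δ * Complex.I) (by simp)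
    simpa using this
  refine ⟨hint, ?_⟩
  have hC : 0 ≤ C := by
    have := (norm_nonneg _).trans (h2 (δ * Complex.I) (by simp))
    simp only [Complex.mul_im, Complex.ofReal_re, Complex.I_im, mul_one, Complex.ofReal_im,
      Complex.I_re, mul_zero, add_zero] at this
    exact nonneg_of_mul_nonneg_left this (Real.rpow_pos_of_pos hδ _)
  have lim1 : Tendsto (fun R : ℝ => ∫ x in (-R)..R, G (x + δ * Complex.I)) atTop
      (𝓝 (∫ x : ℝ, G (x + δ * Complex.I))) :=
    intervalIntegral_tendsto_integral hint tendsto_neg_atTop_atBot tendsto_id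
  refine tendsto_nhds_unique lim1 ?_
  -- Cauchy's theorem on [-R, R] × [δ, δ + R]. The top edge contributes at most 2R · C R^(-r) and
  -- each vertical side R · C R^(-r), in total 4 C R^(1-r).
  have lim2 : Tendsto (fun R : ℝ => 4 * C * R ^ (-(r - 1))) atTop (𝓝 0) := by
    have := (tendsto_rpow_neg_atTop (y := r - 1) (by linarith)).const_mul (4 * C)
    simpa using this
  refine squeeze_zero_norm' ?_ lim2
  filter_upwards [eventually_gt_atTop (0 : ℝ)] with R hR
  have rect := Complex.integral_boundary_rect_eq_zero_of_differentiableOn G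
    (⟨-R, δ⟩ : ℂ) (⟨R, δ + R⟩ : ℂ) (hG.mono (by
      intro z hz
      have h := hz.2
      simp only [mem_preimage] at h
      rw [uIcc_of_le (by linarith)] at h
      exact lt_of_lt_of_le hδ h.1))
  simp only at rect
  have top : ‖∫ x in (-R)..R, G (x + ((δ + R : ℝ) : ℂ) * Complex.I)‖ ≤ C * R ^ (-r) * |R - -R| := by
    refine intervalIntegral.norm_integral_le_of_norm_le_const fun x _ => ?_
    have := h2 (x + ((δ + R : ℝ) : ℂ) * Complex.I) (by simp [hR.le])
    simp only [Complex.add_im, Complex.ofReal_im, Complex.mul_im, Complex.ofReal_re, Complex.I_im,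
      mul_one, Complex.I_re, mul_zero, add_zero, zero_add] at this
    refine this.trans ?_
    gcongr C * ?_
    exact Real.rpow_le_rpow_of_nonpos hR (by linarith) (by linarith)
  have side : ∀ s : ℝ, |s| = R →
      ‖∫ y in δ..(δ + R), G ((s : ℂ) + (y : ℂ) * Complex.I)‖ ≤ C * R ^ (-r) * |δ + R - δ| := by
    intro s hs
    refine intervalIntegral.norm_integral_le_of_norm_le_const fun y hy => ?_
    rw [uIoc_of_le (by linarith)] at hy
    have := h1 ((s : ℂ) + (y : ℂ) * Complex.I) (by simpa using hy.1.le)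
    simp only [Complex.add_re, Complex.ofReal_re, Complex.mul_re, Complex.I_re, mul_zero,
      Complex.ofReal_im, Complex.I_im, mul_one, sub_self, add_zero, hs] at this
    refine this.trans ?_
    gcongr C * ?_
    exact Real.rpow_le_rpow_of_nonpos hR (by linarith) (by linarith)
  have e : ∫ x in (-R)..R, G (x + δ * Complex.I) =
      (∫ x in (-R)..R, G (x + ((δ + R : ℝ) : ℂ) * Complex.I)) -
        Complex.I • (∫ y in δ..(δ + R), G ((R : ℂ) + (y : ℂ) * Complex.I)) +
        Complex.I • (∫ y in δ..(δ + R), G (((-R : ℝ) : ℂ) + (y : ℂ) * Complex.I)) := by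
    linear_combination rect
  have s1 := side R (abs_of_pos hR)
  have s2 := side (-R) (by rw [abs_neg, abs_of_pos hR])
  have a1 : |R - -R| = 2 * R := by rw [abs_of_nonneg (by linarith)]; ring
  have a2 : |δ + R - δ| = R := by rw [abs_of_nonneg (by linarith)]; ring
  rw [a1] at top
  rw [a2] at s1 s2
  have a3 : R ^ (-(r - 1)) = R ^ (-r) * R := by
    rw [neg_sub, sub_eq_neg_add, Real.rpow_add hR, Real.rpow_one]
  rw [e, a3]
  refine (norm_add_le _ _).trans ?_
  refine (add_le_add_left (norm_sub_le _ _) _).trans ?_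
  rw [norm_smul, norm_smul, Complex.norm_I, one_mul, one_mul]
  linarith

section Riesz

variable {f : ℝ → ℝ}

/-- The holomorphic function on the upper half plane with real part the Poisson integral. -/
noncomputable def cauchyTransform (f : ℝ → ℝ) (z : ℂ) : ℂ :=
  -(Complex.I / Real.pi) * ∫ t, (f t : ℂ) * ((t : ℂ) - z)⁻¹

theorem norm_inv_sub_le_inv_im {z : ℂ} (hz : 0 < z.im) (t : ℝ) :
    ‖((t : ℂ) - z)⁻¹‖ ≤ z.im⁻¹ := by
  rw [norm_inv]
  apply inv_anti₀ hz
  have := Complex.abs_im_le_norm ((t : ℂ) - z)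
  simp only [Complex.sub_im, Complex.ofReal_im, zero_sub, abs_neg] at this
  exact (le_abs_self _).trans this

theorem integrable_mul_inv_sub (hf : Integrable f) {z : ℂ} (hz : 0 < z.im) :
    Integrable fun t => (f t : ℂ) * ((t : ℂ) - z)⁻¹ :=
  hf.ofReal.mul_bdd (c := z.im⁻¹) (continuous_inv_sub hz.ne').aestronglyMeasurable
    (Eventually.of_forall (norm_inv_sub_le_inv_im hz))

theorem differentiableOn_cauchyTransform (hf : Integrable f) :
    DifferentiableOn ℂ (cauchyTransform f) {z | 0 < z.im} := by
  intro z hz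
  have hz' : 0 < z.im := hz
  refine DifferentiableAt.differentiableWithinAt ?_
  unfold cauchyTransform
  refine DifferentiableAt.const_mul ?_ _
  have hball : ∀ w ∈ Metric.ball z (z.im / 2), z.im / 2 < w.im := by
    intro w hw
    rw [Metric.mem_ball, dist_eq_norm] at hw
    have := (Complex.abs_im_le_norm (w - z)).trans_lt hw
    rw [Complex.sub_im, abs_lt] at this
    linarith
  refine (hasDerivAt_integral_of_dominated_loc_of_deriv_le (μ := volume)
    (F := fun w t => (f t : ℂ) * ((t : ℂ) - w)⁻¹)
    (F' := fun w t => (f t : ℂ) * (((t : ℂ) - w)⁻¹ * ((t : ℂ) - w)⁻¹))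
    (bound := fun t => ‖f t‖ * ((z.im / 2)⁻¹ * (z.im / 2)⁻¹))
    (s := Metric.ball z (z.im / 2)) (Metric.ball_mem_nhds _ (by positivity)) ?_
    (integrable_mul_inv_sub hf hz) ?_ ?_ ?_ ?_).2.differentiableAt
  · filter_upwards [Metric.ball_mem_nhds z (by positivity : 0 < z.im / 2)] with w hw
    exact (integrable_mul_inv_sub hf (lt_trans (by positivity) (hball w hw))).1
  · exact hf.ofReal.1.mul ((continuous_inv_sub hz'.ne').mul
      (continuous_inv_sub hz'.ne')).aestronglyMeasurable
  · refine Eventually.of_forall fun t w hw => ?_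
    have h1 := hball w hw
    have h2 : ‖((t : ℂ) - w)⁻¹‖ ≤ (z.im / 2)⁻¹ :=
      (norm_inv_sub_le_inv_im (lt_trans (by positivity) h1) t).trans
        (inv_anti₀ (by positivity) h1.le)
    rw [norm_mul, norm_mul, Complex.norm_real]
    gcongr
  · exact hf.norm.mul_const _
  · refine Eventually.of_forall fun t w hw => ?_
    have h1 : w.im ≠ 0 := (lt_trans (by positivity) (hball w hw)).ne'
    have h2 := sub_ne_zero_of_im_ne_zero h1 t
    refine ((((hasDerivAt_id w).const_sub (t : ℂ)).fun_inv h2).const_mul (f t : ℂ)).congr_deriv ?_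
    simp only [id]
    field_simp

theorem cauchyTransform_eq (hf : Integrable f) (x : ℝ) {δ : ℝ} (hδ : 0 < δ) :
    cauchyTransform f (x + δ * Complex.I) =
      ((kconv (poisK δ) f x : ℝ) : ℂ) + ((kconv (conjK δ) f x : ℝ) : ℂ) * Complex.I := by
  have e : ∀ t : ℝ, -(Complex.I / Real.pi) * ((f t : ℂ) * ((t : ℂ) - (x + δ * Complex.I))⁻¹) =
      ((poisK δ (x - t) * f t : ℝ) : ℂ) + ((conjK δ (x - t) * f t : ℝ) : ℂ) * Complex.I := by
    intro t
    have h := ofReal_conjK_sub_poisK hδ (x - t)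
    have e2 : (((x - t : ℝ) : ℂ) - (-(δ * Complex.I)))⁻¹ =
        -((t : ℂ) - (x + δ * Complex.I))⁻¹ := by
      rw [← inv_neg]; congr 1; push_cast; ring
    rw [e2] at h
    push_cast
    rw [div_eq_mul_inv]
    linear_combination -(Complex.I * f t) * h - poisK δ (x - t) * f t * Complex.I_sq
  have b : ∀ k : ℝ → ℝ, DecayKernel k → Integrable fun t => k (x - t) * f t := fun k hk =>
    hk.integrable le_rfl (by simp) (memLp_one_iff_integrable.2 hf) x
  unfold cauchyTransform kconv
  rw [← integral_const_mul]
  simp_rw [e]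
  rw [integral_add, integral_mul_const]
  · simp only [smul_eq_mul]
    rw [integral_complex_ofReal, integral_complex_ofReal]
  · exact (b _ (decayKernel_poisK hδ)).ofReal
  · exact (b _ (decayKernel_conjK hδ)).ofReal.mul_const _

/-- The kernel is bounded only where f does not vanish; for compactly supported f this yields decay
in the real part of z as well. -/
theorem norm_cauchyTransform_le {c : ℝ} {z : ℂ} (hz : 0 < z.im) (hf : Integrable f)
    (h : ∀ t, f t ≠ 0 → ‖((t : ℂ) - z)⁻¹‖ ≤ c) :
    ‖cauchyTransform f z‖ ≤ (∫ t, ‖f t‖) * c := by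
  unfold cauchyTransform
  have h2 : ‖-(Complex.I / (Real.pi : ℂ))‖ ≤ 1 := by
    rw [norm_neg, norm_div, Complex.norm_I, Complex.norm_real, Real.norm_of_nonneg Real.pi_pos.le,
      one_div]
    exact inv_le_one_of_one_le₀ (by linarith [Real.pi_gt_three])
  rw [norm_mul]
  calc _ ≤ 1 * ‖∫ t, (f t : ℂ) * ((t : ℂ) - z)⁻¹‖ := by gcongr
    _ = ‖∫ t, (f t : ℂ) * ((t : ℂ) - z)⁻¹‖ := one_mul _
    _ ≤ ∫ t, ‖(f t : ℂ) * ((t : ℂ) - z)⁻¹‖ := norm_integral_le_integral_norm _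
    _ ≤ ∫ t, ‖f t‖ * c := by
      refine integral_mono (integrable_mul_inv_sub hf hz).norm (hf.norm.mul_const _) fun t => ?_
      simp only [norm_mul, Complex.norm_real]
      by_cases hft : f t = 0
      · simp [hft]
      · gcongr; exact h t hft
    _ = _ := integral_mul_const _ _

theorem kconv_poisK_pos (hf : Integrable f) (h0 : 0 ≤ f) (hne : ¬ f =ᵐ[volume] 0) {δ : ℝ}
    (hδ : 0 < δ) (x : ℝ) : 0 < kconv (poisK δ) f x := by
  unfold kconv
  rw [integral_pos_iff_support_of_nonneg]
  · have : (Function.support fun t => poisK δ (x - t) • f t) = Function.support f := by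
      ext t; simp [(poisK_pos hδ (x - t)).ne']
    rw [this, pos_iff_ne_zero]
    intro h
    apply hne
    rw [Filter.EventuallyEq, ae_iff]
    exact h
  · intro t
    exact mul_nonneg (poisK_pos hδ _).le (h0 t)
  · exact (decayKernel_poisK hδ).integrable le_rfl (by simp) (memLp_one_iff_integrable.2 hf) x

/-- M. Riesz's inequality for nonnegative compactly supported functions. -/
theorem exists_riesz_bound {r : ℝ} (hr : 1 < r) (hr2 : r ≤ 2) : ∃ A : ℝ≥0, ∀ δ : ℝ, 0 < δ →
    ∀ f : ℝ → ℝ, Integrable f → 0 ≤ f → (∃ S, ∀ t, f t ≠ 0 → |t| ≤ S) →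
      ∫⁻ x, ‖kconv (conjK δ) f x‖ₑ ^ r ≤ A * ∫⁻ x, ‖kconv (poisK δ) f x‖ₑ ^ r := by
  obtain ⟨A, B, hA, hAB⟩ := exists_abs_im_rpow_le hr hr2
  refine ⟨⟨A, hA⟩, fun δ hδ f hf h0 ⟨S, hS⟩ => ?_⟩
  -- The null case is set apart because the argument needs the Poisson integral to be strictly
  -- positive.
  by_cases hne : f =ᵐ[volume] 0
  · have : ∀ x, kconv (conjK δ) f x = 0 := fun x => by
      unfold kconv
      refine integral_eq_zero_of_ae ?_
      filter_upwards [hne] with t ht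
      simp [ht]
    simp [this, show 0 < r by linarith]
  have hr0 : 0 < r := by linarith
  set F := cauchyTransform f with hF
  have hFd := differentiableOn_cauchyTransform hf
  have hre : ∀ z : ℂ, 0 < z.im → 0 < (F z).re := by
    intro z hz
    have := cauchyTransform_eq hf z.re hz
    rw [Complex.re_add_im] at this
    rw [hF, this]
    simpa using kconv_poisK_pos hf h0 hne hz z.re
  -- F takes values in the right half plane, so the principal branch of the power is holomorphic
  -- along F.
  have hGd : DifferentiableOn ℂ (fun z => F z ^ (r : ℂ)) {z | 0 < z.im} :=
    hFd.cpow (differentiableOn_const _) fun z hz => Or.inl (hre z hz)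
  have hG : ∀ z : ℂ, 0 < z.im → ‖F z ^ (r : ℂ)‖ = ‖F z‖ ^ r := fun z _ =>
    Complex.norm_cpow_real _ _
  set M := ∫ t, ‖f t‖ with hM
  have hM0 : 0 ≤ M := integral_nonneg fun t => norm_nonneg _
  set c := (1 + |S|) / δ + 1 with hc
  have hc1 : 1 ≤ c := by
    have : 0 ≤ (1 + |S|) / δ := by positivity
    linarith
  have hc0 : 0 ≤ c := by linarith
  have b1 : ∀ z : ℂ, δ ≤ z.im → ‖F z ^ (r : ℂ)‖ ≤ (M * c) ^ r * (1 + |z.re|) ^ (-r) := by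
    intro z hz
    rw [hG z (hδ.trans_le hz), Real.rpow_neg (by positivity), ← Real.inv_rpow (by positivity),
      ← Real.mul_rpow (by positivity) (by positivity), mul_assoc]
    gcongr
    refine norm_cauchyTransform_le (hδ.trans_le hz) hf fun t ht => ?_
    have h := norm_inv_sub_le (R := |S|) (a := (t : ℂ) - z.im * Complex.I) hδ
      (by simpa using (hS t ht).trans (le_abs_self S)) (by simpa using hz.trans (le_abs_self _))
      z.re
    rw [← norm_neg, ← inv_neg]
    refine le_trans (le_of_eq ?_) h
    congr 2
    nth_rewrite 1 [← Complex.re_add_im z]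
    ring
  have b2 : ∀ z : ℂ, δ ≤ z.im → ‖F z ^ (r : ℂ)‖ ≤ (M * c) ^ r * z.im ^ (-r) := by
    intro z hz
    have hz0 := hδ.trans_le hz
    rw [hG z hz0, Real.rpow_neg hz0.le, ← Real.inv_rpow hz0.le,
      ← Real.mul_rpow (by positivity) (inv_nonneg.2 hz0.le)]
    gcongr
    refine (norm_cauchyTransform_le hz0 hf fun t _ => norm_inv_sub_le_inv_im hz0 t).trans ?_
    gcongr
    exact le_mul_of_one_le_right hM0 hc1
  obtain ⟨hi, hI⟩ := integral_line_eq_zero hδ hr hGd b1 b2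
  set u := kconv (poisK δ) f with hu
  set v := kconv (conjK δ) f with hv
  have hfm : MemLp f 1 := memLp_one_iff_integrable.2 hf
  have hucont : Continuous u := (decayKernel_poisK hδ).continuous_kconv le_rfl (by simp) hfm
  have hvcont : Continuous v := (decayKernel_conjK hδ).continuous_kconv le_rfl (by simp) hfm
  have hFx : ∀ x : ℝ, F (x + δ * Complex.I) = (u x : ℂ) + (v x : ℂ) * Complex.I :=
    fun x => cauchyTransform_eq hf x hδ
  have hnorm : ∀ x : ℝ, ‖F (x + δ * Complex.I) ^ (r : ℂ)‖ = ‖F (x + δ * Complex.I)‖ ^ r :=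
    fun x => hG _ (by simpa using hδ)
  have hupos : ∀ x, 0 < u x := kconv_poisK_pos hf h0 hne hδ
  have hui : Integrable fun x => |u x| ^ r := by
    refine hi.norm.mono' (hucont.abs.rpow_const fun _ => Or.inr hr0.le).aestronglyMeasurable
      (Eventually.of_forall fun x => ?_)
    rw [Real.norm_of_nonneg (by positivity), hnorm]
    gcongr
    have := Complex.abs_re_le_norm (F (x + δ * Complex.I))
    rw [hFx] at this ⊢
    simpa using this
  have hvi : Integrable fun x => |v x| ^ r := by
    refine hi.norm.mono' (hvcont.abs.rpow_const fun _ => Or.inr hr0.le).aestronglyMeasurable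
      (Eventually.of_forall fun x => ?_)
    rw [Real.norm_of_nonneg (by positivity), hnorm]
    gcongr
    have := Complex.abs_im_le_norm (F (x + δ * Complex.I))
    rw [hFx] at this ⊢
    simpa using this
  have hrei : ∫ x : ℝ, (F (x + δ * Complex.I) ^ (r : ℂ)).re = 0 := by
    have := congrArg Complex.re hI
    rwa [← Complex.reCLM_apply, ← Complex.reCLM.integral_comp_comm hi] at this
  -- The pointwise inequality is integrated along the line Im z = δ, where Re F^r has integral zero.
  -- The constant A depends on r alone, hence the uniformity in δ and f.
  have main : ∫ x, |v x| ^ r ≤ A * ∫ x, |u x| ^ r := by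
    have hre_int : Integrable fun x : ℝ => (F (x + δ * Complex.I) ^ (r : ℂ)).re :=
      Complex.reCLM.integrable_comp hi
    calc ∫ x, |v x| ^ r ≤ ∫ x, (A * |u x| ^ r - B * (F (x + δ * Complex.I) ^ (r : ℂ)).re) := by
          refine integral_mono hvi ((hui.const_mul A).sub (hre_int.const_mul B)) fun x => ?_
          have := hAB (F (x + δ * Complex.I)) (hre _ (by simpa using hδ))
          have e1 : (F (x + δ * Complex.I)).re = |u x| := by
            rw [hFx, abs_of_pos (hupos x)]; simp
          have e2 : (F (x + δ * Complex.I)).im = v x := by rw [hFx]; simp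
          rw [e1, e2] at this
          exact this
      _ = A * ∫ x, |u x| ^ r := by
          rw [integral_sub (hui.const_mul A) (hre_int.const_mul B), integral_const_mul,
            integral_const_mul, hrei]
          simp
  have conv : ∀ g : ℝ → ℝ, (Integrable fun x => |g x| ^ r) →
      ∫⁻ x, ‖g x‖ₑ ^ r = ENNReal.ofReal (∫ x, |g x| ^ r) := by
    intro g hg
    rw [ofReal_integral_eq_lintegral_ofReal hg (Eventually.of_forall fun x => by positivity)]
    refine lintegral_congr fun x => ?_
    rw [Real.enorm_eq_ofReal_abs, ENNReal.ofReal_rpow_of_nonneg (abs_nonneg _) hr0.le]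
  rw [conv v hvi, conv u hui]
  refine (ENNReal.ofReal_le_ofReal main).trans (le_of_eq ?_)
  rw [ENNReal.ofReal_mul hA]
  congr 1
  exact ENNReal.ofReal_eq_coe_nnreal hA

end Riesz

/-! ### Uniform L_p bounds for the conjugate Poisson integrals. -/

theorem one_lt_toReal {p : ℝ≥0∞} (hp1 : 1 < p) (hp : p ≠ ⊤) : 1 < p.toReal := by
  rw [← ENNReal.toReal_one]; exact (ENNReal.toReal_lt_toReal (by simp) hp).2 hp1

section

variable {E : Type*} [NormedAddCommGroup E] [NormedSpace ℝ E]

theorem kconv_sub {p : ℝ≥0∞} (hp1 : 1 ≤ p) (hp : p ≠ ⊤) {k : ℝ → ℝ} (hk : DecayKernel k)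
    {f g : ℝ → E} (hf : MemLp f p) (hg : MemLp g p) (x : ℝ) :
    kconv k (f - g) x = kconv k f x - kconv k g x := by
  unfold kconv
  rw [← integral_sub (hk.integrable hp1 hp hf x) (hk.integrable hp1 hp hg x)]
  simp [smul_sub]

theorem tendsto_kconv_indicator {p : ℝ≥0∞} (hp1 : 1 ≤ p) (hp : p ≠ ⊤) {k : ℝ → ℝ}
    (hk : DecayKernel k) {f : ℝ → E} (hf : MemLp f p) (x : ℝ) :
    Tendsto (fun n : ℕ => kconv k ((Icc (-(n : ℝ)) n).indicator f) x) atTop (𝓝 (kconv k f x)) := by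
  unfold kconv
  refine tendsto_integral_of_dominated_convergence (fun t => ‖k (x - t) • f t‖) ?_
    (hk.integrable hp1 hp hf x).norm ?_ ?_
  · intro n
    have h : MemLp ((Icc (-(n : ℝ)) n).indicator f) p := hf.indicator measurableSet_Icc
    exact (hk.integrable hp1 hp h x).1
  · intro n
    refine Eventually.of_forall fun t => ?_
    rw [norm_smul, norm_smul]
    gcongr
    exact norm_indicator_le_norm_self _ _
  · refine Eventually.of_forall fun t => ?_
    refine tendsto_const_nhds.congr' ?_
    filter_upwards [eventually_ge_atTop ⌈|t|⌉₊] with n hn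
    rw [indicator_of_mem]
    exact abs_le.1 ((Nat.le_ceil _).trans (by exact_mod_cast hn))

end

/-- The uniform bound on `L_p` for the conjugate Poisson integrals of real functions. -/
def ConjBound (p : ℝ≥0∞) : Prop := ∃ C : ℝ≥0, ∀ δ : ℝ, 0 < δ → ∀ f : ℝ → ℝ, MemLp f p →
  eLpNorm (kconv (conjK δ) f) p ≤ C * eLpNorm f p

theorem conjBound_of_le_two {p : ℝ≥0∞} (hp1 : 1 < p) (hp2 : p ≤ 2) : ConjBound p := by
  have hp : p ≠ ⊤ := ne_top_of_le_ne_top (by simp) hp2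
  have hp0 : p ≠ 0 := (zero_lt_one.trans hp1).ne'
  set r := p.toReal with hr
  have hr1 : 1 < r := one_lt_toReal hp1 hp
  have hr0 : 0 < r := by linarith
  have hr2 : r ≤ 2 := by simpa using ENNReal.toReal_mono (by simp) hp2
  obtain ⟨A, hA⟩ := exists_riesz_bound hr1 hr2
  have pos : ∀ δ : ℝ, 0 < δ → ∀ f : ℝ → ℝ, 0 ≤ f → MemLp f p →
      eLpNorm (kconv (conjK δ) f) p ≤ (A ^ (1 / r) : ℝ≥0) * eLpNorm f p := by
    intro δ hδ f h0 hf
    have hk := decayKernel_conjK hδ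
    rw [← ENNReal.rpow_le_rpow_iff hr0, ENNReal.mul_rpow_of_nonneg _ _ hr0.le,
      ← ENNReal.coe_rpow_of_nonneg _ hr0.le, ← NNReal.rpow_mul, one_div_mul_cancel hr0.ne',
      NNReal.rpow_one, hr, eLpNorm_rpow_toReal hp0 hp (kconv (conjK δ) f), ← hr]
    -- Truncation to [-n, n] gives integrable functions of bounded support, to which Riesz's
    -- inequality applies; Fatou's lemma then removes the truncation.
    obtain ⟨fn, hfn⟩ : ∃ fn : ℕ → ℝ → ℝ, ∀ n, fn n = (Icc (-(n : ℝ)) n).indicator f := ⟨_, fun _ => rfl⟩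
    have hfnp : ∀ n, MemLp (fn n) p := fun n => by
      rw [hfn]; exact hf.indicator measurableSet_Icc
    have hlim : ∀ x, Tendsto (fun n => kconv (conjK δ) (fn n) x) atTop
        (𝓝 (kconv (conjK δ) f x)) := fun x => by
      simp_rw [hfn]; exact tendsto_kconv_indicator hp1.le hp hk hf x
    have hfn1 : ∀ n, Integrable (fn n) := by
      intro n
      rw [hfn, integrable_indicator_iff measurableSet_Icc]
      exact (hf.restrict _).integrable hp1.le
    have bd : ∀ n, ∫⁻ x, ‖kconv (conjK δ) (fn n) x‖ₑ ^ r ≤ A * eLpNorm f p ^ r := by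
      intro n
      refine (hA δ hδ (fn n) (hfn1 n) (fun t => by rw [hfn]; exact indicator_nonneg (fun _ _ => h0 _) t)
        ⟨n, fun t ht => ?_⟩).trans ?_
      · rw [hfn] at ht
        have := mem_of_indicator_ne_zero ht
        exact abs_le.2 this
      · rw [hr, ← eLpNorm_rpow_toReal hp0 hp, ← hr]
        gcongr
        refine (eLpNorm_kconv_poisK_le hp1 hp hδ (hfnp n)).2.trans ?_
        rw [hfn]
        exact eLpNorm_indicator_le f
    have h1 : ∫⁻ x, ‖kconv (conjK δ) f x‖ₑ ^ r
        = ∫⁻ x, liminf (fun n => ‖kconv (conjK δ) (fn n) x‖ₑ ^ r) atTop := by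
          refine lintegral_congr fun x => ?_
          refine (Tendsto.liminf_eq ?_).symm
          exact ((ENNReal.continuous_rpow_const.tendsto _).comp
            (hlim x).enorm)
    rw [h1]
    have h2 : ∫⁻ x, liminf (fun n => ‖kconv (conjK δ) (fn n) x‖ₑ ^ r) atTop ≤
        liminf (fun n => ∫⁻ x, ‖kconv (conjK δ) (fn n) x‖ₑ ^ r) atTop :=
      lintegral_liminf_le fun n =>
            ((hk.continuous_kconv hp1.le hp (hfnp n)).measurable.enorm.pow_const _)
    have h3 : liminf (fun n => ∫⁻ x, ‖kconv (conjK δ) (fn n) x‖ₑ ^ r) atTop ≤ A * eLpNorm f p ^ r := by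
      apply liminf_le_of_frequently_le' (Frequently.of_forall bd)
    exact h2.trans h3
  -- The factor 2 comes from treating the positive and negative parts separately.
  refine ⟨2 * A ^ (1 / r), fun δ hδ f hf => ?_⟩
  have hk := decayKernel_conjK hδ
  have hpm : MemLp (fun x => max (f x) 0) p := hf.pos_part
  have hnm : MemLp (fun x => max (-f x) 0) p := hf.neg_part
  have e : kconv (conjK δ) f = kconv (conjK δ) (fun x => max (f x) 0) -
      kconv (conjK δ) (fun x => max (-f x) 0) := by
    ext x
    rw [Pi.sub_apply, ← kconv_sub hp1.le hp hk hpm hnm]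
    congr 1
    ext t
    simp only [Pi.sub_apply]
    rcases le_total 0 (f t) with h | h
    · rw [max_eq_left h, max_eq_right (by linarith), sub_zero]
    · rw [max_eq_right h, max_eq_left (by linarith)]; ring
  rw [e]
  refine (eLpNorm_sub_le (hk.continuous_kconv hp1.le hp hpm).aestronglyMeasurable
    (hk.continuous_kconv hp1.le hp hnm).aestronglyMeasurable hp1.le).trans ?_
  have h1 := pos δ hδ _ (fun t => le_max_right (f t) 0) hpm
  have h2 := pos δ hδ _ (fun t => le_max_right (-f t) 0) hnm
  have h3 : eLpNorm (fun x => max (f x) 0) p ≤ eLpNorm f p := eLpNorm_mono fun x => by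
    simp only [Real.norm_eq_abs]
    rw [abs_of_nonneg (le_max_right _ _)]
    exact max_le (le_abs_self _) (abs_nonneg _)
  have h4 : eLpNorm (fun x => max (-f x) 0) p ≤ eLpNorm f p := eLpNorm_mono fun x => by
    simp only [Real.norm_eq_abs]
    rw [abs_of_nonneg (le_max_right _ _)]
    exact max_le (neg_le_abs _) (abs_nonneg _)
  calc _ ≤ (A ^ (1 / r) : ℝ≥0) * eLpNorm f p + (A ^ (1 / r) : ℝ≥0) * eLpNorm f p :=
        add_le_add (h1.trans (by gcongr)) (h2.trans (by gcongr))
    _ = _ := by push_cast; ring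

/-- Q_δ is odd, so convolution with it is antisymmetric. Fubini is legitimate because g is a
continuous function cut off to a compact interval, on which the continuous function |Q_δ| * |f| is
bounded. -/
theorem integral_mul_kconv_conjK {p : ℝ≥0∞} (hp1 : 1 ≤ p) (hp : p ≠ ⊤) {δ : ℝ} (hδ : 0 < δ)
    {f g : ℝ → ℝ} (hf : MemLp f p) {n : ℝ} {h : ℝ → ℝ} (hh : Continuous h)
    (hg : g = (Icc (-n) n).indicator h) :
    ∫ x, g x * kconv (conjK δ) f x = -∫ t, f t * kconv (conjK δ) g t := by
  have hk := decayKernel_conjK hδ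
  have hgm : AEStronglyMeasurable g := by
    rw [hg]; exact hh.aestronglyMeasurable.indicator measurableSet_Icc
  have hprod : Integrable (Function.uncurry fun x t => g x * (conjK δ (x - t) * f t))
      (volume.prod volume) := by
    have hm : AEStronglyMeasurable (Function.uncurry fun x t => g x * (conjK δ (x - t) * f t))
        ((volume : Measure ℝ).prod (volume : Measure ℝ)) := by
      have h2 : AEStronglyMeasurable (fun z : ℝ × ℝ => conjK δ (z.1 - z.2))
        ((volume : Measure ℝ).prod volume) := (hk.1.comp (by fun_prop)).aestronglyMeasurable
      exact hgm.comp_fst.mul (h2.mul hf.1.comp_snd)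
    rw [integrable_prod_iff hm]
    constructor
    · exact Eventually.of_forall fun x => (hk.integrable hp1 hp hf x).const_mul (g x)
    · have e : (fun x => ∫ t, ‖Function.uncurry (fun x t => g x * (conjK δ (x - t) * f t)) (x, t)‖)
          = (Icc (-n) n).indicator fun x => |h x| * kconv (fun u => |conjK δ u|) (fun t => |f t|) x := by
        ext x
        simp only [Function.uncurry, norm_mul, Real.norm_eq_abs]
        rw [integral_const_mul, hg, indicator]
        unfold kconv
        split_ifs with hx
        · rw [indicator_of_mem hx]; rfl
        · rw [indicator_of_notMem hx]; simp
      rw [e, integrable_indicator_iff measurableSet_Icc]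
      exact (hh.abs.mul (hk.abs.continuous_kconv hp1 hp hf.abs)).continuousOn.integrableOn_Icc
  unfold kconv
  simp_rw [← integral_const_mul]
  have := integral_integral_swap hprod
  simp only [smul_eq_mul] at this ⊢
  rw [this, ← integral_neg]
  refine integral_congr_ae (Eventually.of_forall fun t => ?_)
  simp only
  rw [← integral_neg]
  refine integral_congr_ae (Eventually.of_forall fun x => ?_)
  simp only
  rw [← neg_sub t x, conjK_neg]
  ring

/-- Duality by hand. With h = Q_δ * f, the test function h|h|^(r-2) cut off to [-n, n] has L_q norm
J^(1/s), where J is the integral of |h|^r over [-n, n]. Antisymmetry and the bound on L_q give J ≤ C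
‖f‖ J^(1/s). The cut-off makes J finite, so it can be divided out, and then n tends to infinity. -/
theorem conjBound_of_holderConjugate {p q : ℝ≥0∞} (hp2 : 2 < p) (hp : p ≠ ⊤)
    [hpq : ENNReal.HolderConjugate p q] (H : ConjBound q) : ConjBound p := by
  obtain ⟨C, hC⟩ := H
  have hp1 : 1 < p := lt_trans (by norm_num) hp2
  have hp0 : p ≠ 0 := (zero_lt_one.trans hp1).ne'
  have hq1 : 1 < q := (ENNReal.HolderConjugate.lt_top_iff_one_lt p q).1 hp.lt_top
  have hq : q ≠ ⊤ := by
    have := hpq.symm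
    exact ((ENNReal.HolderConjugate.lt_top_iff_one_lt q p).2 hp1).ne
  have hq0 : q ≠ 0 := (zero_lt_one.trans hq1).ne'
  set r := p.toReal with hr
  set s := q.toReal with hs
  have hr2 : 2 < r := by
    have := (ENNReal.toReal_lt_toReal (by simp) hp).2 hp2
    simpa using this
  have hr0 : 0 < r := by linarith
  have hs1 : 1 < s := one_lt_toReal hq1 hq
  have hs0 : 0 < s := by linarith
  have hrs : r.HolderConjugate s := ENNReal.HolderConjugate.toReal (one_lt_toReal hp1 hp)
  have hrs' : (r - 1) * s = r := hrs.sub_one_mul_conj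
  refine ⟨C, fun δ hδ f hf => ?_⟩
  have hk := decayKernel_conjK hδ
  set h := kconv (conjK δ) f with hh
  have hhc : Continuous h := hk.continuous_kconv hp1.le hp hf
  have hwc : Continuous fun x => h x * |h x| ^ (r - 2) :=
    hhc.mul (hhc.abs.rpow_const fun _ => Or.inr (by linarith))
  have hw : ∀ x, ‖h x * |h x| ^ (r - 2)‖ₑ = ‖h x‖ₑ ^ (r - 1) := by
    intro x
    rw [Real.enorm_eq_ofReal_abs, Real.enorm_eq_ofReal_abs, abs_mul, abs_of_nonneg
      (by positivity : 0 ≤ |h x| ^ (r - 2)), ENNReal.ofReal_rpow_of_nonneg (abs_nonneg _) (by linarith)]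
    congr 1
    nth_rewrite 1 [← Real.rpow_one |h x|]
    rw [← Real.rpow_add_of_nonneg (abs_nonneg _) (by norm_num) (by linarith)]
    congr 1; ring
  have step : ∀ n : ℝ, ∫⁻ x in Icc (-n) n, ‖h x‖ₑ ^ r ≤ (C * eLpNorm f p) ^ r := by
    intro n
    set g := (Icc (-n) n).indicator fun x => h x * |h x| ^ (r - 2) with hg
    set J := ∫⁻ x in Icc (-n) n, ‖h x‖ₑ ^ r with hJ
    have hJi : IntegrableOn (fun x => |h x| ^ r) (Icc (-n) n) :=
      (hhc.abs.rpow_const fun _ => Or.inr hr0.le).continuousOn.integrableOn_Icc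
    have hJ1 : J = ENNReal.ofReal (∫ x in Icc (-n) n, |h x| ^ r) := by
      rw [ofReal_integral_eq_lintegral_ofReal hJi (Eventually.of_forall fun x => by positivity)]
      refine lintegral_congr fun x => ?_
      rw [Real.enorm_eq_ofReal_abs, ENNReal.ofReal_rpow_of_nonneg (abs_nonneg _) hr0.le]
    have hJt : J ≠ ⊤ := by rw [hJ1]; exact ENNReal.ofReal_ne_top
    have hgm : AEStronglyMeasurable g := hwc.aestronglyMeasurable.indicator measurableSet_Icc
    have hgs : eLpNorm g q ^ s = J := by
      rw [hs, eLpNorm_rpow_toReal hq0 hq, ← hs, hJ, ← lintegral_indicator measurableSet_Icc]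
      refine lintegral_congr fun x => ?_
      rw [hg]
      by_cases hx : x ∈ Icc (-n) n
      · rw [indicator_of_mem hx, indicator_of_mem hx, hw, ← ENNReal.rpow_mul, hrs']
      · rw [indicator_of_notMem hx, indicator_of_notMem hx]
        simp [hs0]
    have hgs' : eLpNorm g q = J ^ (1 / s) := by
      rw [← hgs, ← ENNReal.rpow_mul, mul_one_div_cancel hs0.ne', ENNReal.rpow_one]
    have hgL : MemLp g q := by
      refine ⟨hgm, ?_⟩
      rw [hgs']
      exact (ENNReal.rpow_ne_top_of_nonneg (by positivity) hJt).lt_top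
    have e1 : ∫ x in Icc (-n) n, |h x| ^ r = -∫ t, f t * kconv (conjK δ) g t := by
      rw [← integral_mul_kconv_conjK hp1.le hp hδ hf hwc hg, ← integral_indicator measurableSet_Icc]
      refine integral_congr_ae (Eventually.of_forall fun x => ?_)
      simp only [hg]
      by_cases hx : x ∈ Icc (-n) n
      · rw [indicator_of_mem hx, indicator_of_mem hx, ← hh, mul_right_comm, ← sq, ← sq_abs,
          ← Real.rpow_two, ← Real.rpow_add_of_nonneg (abs_nonneg _) (by norm_num) (by linarith)]
        congr 1; ring
      · rw [indicator_of_notMem hx, indicator_of_notMem hx, zero_mul]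
    have e2 : J ≤ eLpNorm f p * eLpNorm (kconv (conjK δ) g) q := by
      rw [hJ1, e1]
      have hQm : AEStronglyMeasurable (kconv (conjK δ) g) :=
        (hk.continuous_kconv hq1.le hq hgL).aestronglyMeasurable
      have := eLpNorm_smul_le_mul_eLpNorm (p := p) (q := q) (r := 1) (μ := volume) hQm hf.1
      refine le_trans ?_ this
      rw [eLpNorm_one_eq_lintegral_enorm]
      refine le_trans ?_ (enorm_integral_le_lintegral_enorm _)
      rw [Real.enorm_eq_ofReal_abs]
      exact ENNReal.ofReal_le_ofReal (neg_le_abs _)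
    have e3 : J ≤ C * eLpNorm f p * J ^ (1 / s) := by
      refine e2.trans ?_
      calc _ ≤ eLpNorm f p * (C * eLpNorm g q) := by gcongr; exact hC δ hδ g hgL
        _ = _ := by rw [hgs']; ring
    by_cases hJ0 : J = 0
    · rw [hJ0]; simp
    have e4 : J ^ (1 / r) ≤ C * eLpNorm f p := by
      have e5 : J ^ (1 / r) = J * (J ^ (1 / s))⁻¹ := by
        rw [← ENNReal.rpow_neg]
        nth_rewrite 2 [← ENNReal.rpow_one J]
        rw [← ENNReal.rpow_add _ _ hJ0 hJt]
        congr 1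
        have := hrs.inv_add_inv_eq_one
        simp only [one_div]; linarith
      rw [e5, ← div_eq_mul_inv]
      exact ENNReal.div_le_of_le_mul e3
    calc J = (J ^ (1 / r)) ^ r := by
          rw [← ENNReal.rpow_mul, one_div_mul_cancel hr0.ne', ENNReal.rpow_one]
      _ ≤ _ := by gcongr
  rw [← ENNReal.rpow_le_rpow_iff hr0]
  nth_rewrite 1 [hr]
  rw [eLpNorm_rpow_toReal hp0 hp, ← hr]
  have lim := (aecover_Icc (μ := (volume : Measure ℝ)) tendsto_neg_atTop_atBot
    tendsto_id).lintegral_tendsto_of_countably_generated (f := fun x => ‖h x‖ₑ ^ r)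
    (hhc.measurable.enorm.pow_const _).aemeasurable
  exact le_of_tendsto' lim step

theorem conjBound {p : ℝ≥0∞} (hp1 : 1 < p) (hp : p ≠ ⊤) : ConjBound p := by
  rcases le_or_gt p 2 with h | h
  · exact conjBound_of_le_two hp1 h
  · have hpq : ENNReal.HolderConjugate p (ENNReal.conjExponent p) :=
      ENNReal.HolderConjugate.conjExponent hp1.le
    have := hpq.symm
    refine conjBound_of_holderConjugate (q := ENNReal.conjExponent p) h hp
      (conjBound_of_le_two ?_ ?_)
    · exact (ENNReal.HolderConjugate.lt_top_iff_one_lt p _).1 hp.lt_top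
    · rw [ENNReal.conjExponent]
      have h1 : (p - 1)⁻¹ ≤ 1 := by
        rw [ENNReal.inv_le_one]
        refine ENNReal.le_sub_of_add_le_left (by simp) ?_
        norm_num
        exact h.le
      calc 1 + (p - 1)⁻¹ ≤ 1 + 1 := by gcongr
        _ = 2 := by norm_num

/-- Uniform boundedness on `L_p` of the conjugate Poisson integrals. -/
theorem exists_eLpNorm_kconv_conjK_le {p : ℝ≥0∞} (hp1 : 1 < p) (hp : p ≠ ⊤) :
    ∃ C : ℝ≥0, ∀ δ : ℝ, 0 < δ → ∀ f : ℝ → ℂ, MemLp f p →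
      eLpNorm (kconv (conjK δ) f) p ≤ C * eLpNorm f p := by
  obtain ⟨C, hC⟩ := conjBound hp1 hp
  refine ⟨2 * C, fun δ hδ f hf => ?_⟩
  have hk := decayKernel_conjK hδ
  have hre : MemLp (fun x => (f x).re) p := hf.re
  have him : MemLp (fun x => (f x).im) p := hf.im
  have e : ∀ x, ‖kconv (conjK δ) f x‖ ≤ ‖‖kconv (conjK δ) (fun x => (f x).re) x‖ +
      ‖kconv (conjK δ) (fun x => (f x).im) x‖‖ := by
    intro x
    rw [Real.norm_of_nonneg (by positivity)]
    have h1 : (kconv (conjK δ) f x).re = kconv (conjK δ) (fun x => (f x).re) x := by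
      unfold kconv
      rw [← Complex.reCLM_apply, ← Complex.reCLM.integral_comp_comm (hk.integrable hp1.le hp hf x)]
      simp
    have h2 : (kconv (conjK δ) f x).im = kconv (conjK δ) (fun x => (f x).im) x := by
      unfold kconv
      rw [← Complex.imCLM_apply, ← Complex.imCLM.integral_comp_comm (hk.integrable hp1.le hp hf x)]
      simp
    rw [← h1, ← h2]
    exact Complex.norm_le_abs_re_add_abs_im _
  have h1 := hC δ hδ _ hre
  have h2 := hC δ hδ _ him
  have h3 : eLpNorm (fun x => (f x).re) p ≤ eLpNorm f p :=
    eLpNorm_mono fun x => Complex.abs_re_le_norm _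
  have h4 : eLpNorm (fun x => (f x).im) p ≤ eLpNorm f p :=
    eLpNorm_mono fun x => Complex.abs_im_le_norm _
  refine (eLpNorm_mono e).trans ((eLpNorm_add_le
    (hk.continuous_kconv hp1.le hp hre).norm.aestronglyMeasurable
    (hk.continuous_kconv hp1.le hp him).norm.aestronglyMeasurable hp1.le).trans ?_)
  rw [eLpNorm_norm, eLpNorm_norm]
  calc _ ≤ C * eLpNorm f p + C * eLpNorm f p :=
        add_le_add (h1.trans (by gcongr)) (h2.trans (by gcongr))
    _ = _ := by push_cast; ring

/-! ### Pointwise convergence at Lebesgue points. -/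

/-- Dyadic majorization. Where |x - t| ≤ ε the term k = 0 suffices; where 2^n ε ≤ |x - t| < 2^(n+1)
ε the term k = n + 1 does, since the kernel is at most ε/(2^n ε)² there. -/
theorem enorm_poisK_sub_le_tsum {ε : ℝ} (hε : 0 < ε) (x t : ℝ) :
    ‖poisK ε (x - t)‖ₑ ≤ ∑' k : ℕ, (Metric.closedBall x (2 ^ k * ε)).indicator
      (fun _ => ENNReal.ofReal (4 * (1 / 4) ^ k / ε)) t := by
  have hpi : 1 ≤ Real.pi := by linarith [Real.pi_gt_three]
  obtain ⟨k, hk1, hk2⟩ : ∃ k : ℕ, |x - t| ≤ 2 ^ k * ε ∧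
      poisK ε (x - t) ≤ 4 * (1 / 4) ^ k / ε := by
    rcases le_or_gt |x - t| ε with h | h
    · refine ⟨0, by simpa using h, ?_⟩
      rw [poisK, pow_zero, mul_one, div_le_div_iff₀ (by positivity) hε]
      nlinarith [sq_nonneg (x - t), mul_pos hε hε, mul_nonneg (sub_nonneg.2 hpi) (sq_nonneg (x - t)),
        mul_nonneg (sub_nonneg.2 hpi) (sq_nonneg ε)]
    · obtain ⟨n, h1, h2⟩ := exists_nat_pow_near (x := |x - t| / ε) (y := 2)
        ((one_le_div hε).2 h.le) one_lt_two
      rw [le_div_iff₀ hε] at h1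
      rw [div_lt_iff₀ hε] at h2
      refine ⟨n + 1, h2.le, ?_⟩
      have h3 : (2 ^ n * ε) ^ 2 ≤ (x - t) ^ 2 := by
        rw [← sq_abs (x - t)]
        gcongr
      have h4 : 4 * (1 / 4 : ℝ) ^ (n + 1) / ε = ε / (2 ^ n * ε) ^ 2 := by
        rw [mul_pow, ← pow_mul, mul_comm n 2, pow_mul, pow_succ, div_pow, one_pow]
        norm_num
        field_simp
      rw [h4, poisK]
      gcongr
      refine h3.trans ?_
      nlinarith [sq_nonneg (x - t), sq_nonneg ε, mul_nonneg (sub_nonneg.2 hpi) (sq_nonneg (x - t)),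
        mul_nonneg (sub_nonneg.2 hpi) (sq_nonneg ε)]
  refine le_trans ?_ (ENNReal.le_tsum k)
  rw [indicator_of_mem (by rw [Metric.mem_closedBall, Real.dist_eq, abs_sub_comm]; exact hk1),
    Real.enorm_eq_ofReal (poisK_pos hε _).le]
  exact ENNReal.ofReal_le_ofReal hk2

/-- Small radii are controlled by the Lebesgue point. For large radii ‖h‖ ≤ ‖h‖^p + 1, and the first
summand has finite total integral, divided by a length at least 2ρ₀. -/
theorem exists_bound_average {p : ℝ≥0∞} (hp1 : 1 ≤ p) (hp : p ≠ ⊤) {h : ℝ → ℂ} (hh : MemLp h p)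
    {x : ℝ} (hx : Tendsto (fun ρ : ℝ => (∫⁻ t in Metric.closedBall x ρ, ‖h t - h x‖ₑ) /
      volume (Metric.closedBall x ρ)) (𝓝[>] 0) (𝓝 0)) :
    ∃ K : ℝ≥0∞, K ≠ ⊤ ∧ ∀ ρ : ℝ, 0 < ρ → (∫⁻ t in Metric.closedBall x ρ, ‖h t - h x‖ₑ) /
      volume (Metric.closedBall x ρ) ≤ K := by
  have hp0 : p ≠ 0 := (zero_lt_one.trans_le hp1).ne'
  have h1 := hx.eventually (gt_mem_nhds zero_lt_one)
  obtain ⟨ρ₀, hρ₀, h2⟩ := (mem_nhdsGT_iff_exists_Ioo_subset).1 h1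
  have hρ0 : 0 < ρ₀ := hρ₀
  set N := ∫⁻ t, ‖h t‖ₑ ^ p.toReal with hN
  have hNt : N ≠ ⊤ := by
    rw [hN, ← eLpNorm_rpow_toReal hp0 hp]
    exact ENNReal.rpow_ne_top_of_nonneg ENNReal.toReal_nonneg hh.2.ne
  have hr : 1 ≤ p.toReal := by
    rw [← ENNReal.toReal_one]; exact ENNReal.toReal_mono hp hp1
  refine ⟨1 + (N / ENNReal.ofReal (2 * ρ₀) + (1 + ‖h x‖ₑ)), ?_, fun ρ hρ => ?_⟩
  · have : ENNReal.ofReal (2 * ρ₀) ≠ 0 := by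
      rw [ne_eq, ENNReal.ofReal_eq_zero]; linarith
    have := ENNReal.div_ne_top hNt this
    finiteness
  · rcases lt_or_ge ρ ρ₀ with hlt | hge
    · exact le_add_right (h2 ⟨hρ, hlt⟩ : _ < (1 : ℝ≥0∞)).le
    · refine le_add_left ?_
      have hv : volume (Metric.closedBall x ρ) = ENNReal.ofReal (2 * ρ) := Real.volume_closedBall _ _
      have hv0 : volume (Metric.closedBall x ρ) ≠ 0 := by
        rw [hv, ne_eq, ENNReal.ofReal_eq_zero]; linarith
      have hvt : volume (Metric.closedBall x ρ) ≠ ⊤ := by rw [hv]; exact ENNReal.ofReal_ne_top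
      have key : ∫⁻ t in Metric.closedBall x ρ, ‖h t - h x‖ₑ ≤
          N + (1 + ‖h x‖ₑ) * volume (Metric.closedBall x ρ) := by
        calc _ ≤ ∫⁻ t in Metric.closedBall x ρ, (‖h t‖ₑ ^ p.toReal + (1 + ‖h x‖ₑ)) := by
              refine lintegral_mono fun t => ?_
              refine enorm_sub_le.trans ?_
              rw [← add_assoc]
              gcongr
              rcases le_total ‖h t‖ₑ 1 with h3 | h3
              · exact le_add_left h3
              · exact le_add_right (ENNReal.le_rpow_self_of_one_le h3 hr)
          _ = (∫⁻ t in Metric.closedBall x ρ, ‖h t‖ₑ ^ p.toReal) +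
              (1 + ‖h x‖ₑ) * volume (Metric.closedBall x ρ) := by
              rw [lintegral_add_right _ measurable_const, setLIntegral_const]
          _ ≤ _ := by gcongr; exact setLIntegral_le_lintegral _ _
      calc _ ≤ (N + (1 + ‖h x‖ₑ) * volume (Metric.closedBall x ρ)) /
            volume (Metric.closedBall x ρ) := by gcongr
        _ = N / volume (Metric.closedBall x ρ) + (1 + ‖h x‖ₑ) := by
            rw [ENNReal.add_div, ENNReal.mul_div_cancel_right hv0 hvt]
        _ ≤ _ := by rw [hv]; gcongr

/-- At a Lebesgue point the dyadic majorant bounds the integral by the sum of 8 · 2^(-k) times the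
mean oscillation over the ball of radius 2^k ε, the factor being 4 · 4^(-k)/ε times the length 2 ·
2^k ε. Each mean tends to 0 and all are bounded by one K, so dominated convergence for the counting
measure applies. -/
theorem ae_tendsto_lintegral_poisK_mul_sub {p : ℝ≥0∞} (hp1 : 1 ≤ p) (hp : p ≠ ⊤) {h : ℝ → ℂ}
    (hh : MemLp h p) : ∀ᵐ x, Tendsto
      (fun ε : ℝ => ∫⁻ t, ‖poisK ε (x - t)‖ₑ * ‖h t - h x‖ₑ) (𝓝[>] 0) (𝓝 0) := by
  have hloc : LocallyIntegrable h := hh.locallyIntegrable hp1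
  filter_upwards [(IsUnifLocDoublingMeasure.vitaliFamily (volume : Measure ℝ)
    1).ae_tendsto_lintegral_enorm_sub_div hloc] with x hx
  have hx1 : Tendsto (fun ρ : ℝ => (∫⁻ t in Metric.closedBall x ρ, ‖h t - h x‖ₑ) /
      volume (Metric.closedBall x ρ)) (𝓝[>] 0) (𝓝 0) :=
    hx.comp (IsUnifLocDoublingMeasure.tendsto_closedBall_filterAt (μ := (volume : Measure ℝ)) (K := 1)
      (fun _ => x) id tendsto_id (by
        filter_upwards [self_mem_nhdsWithin] with ρ hρ
        have : (0 : ℝ) < ρ := hρ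
        simp [this.le]))
  obtain ⟨K, hK, hbd⟩ := exists_bound_average hp1 hp hh hx1
  set a : ℝ → ℝ≥0∞ := fun ρ => (∫⁻ t in Metric.closedBall x ρ, ‖h t - h x‖ₑ) /
      volume (Metric.closedBall x ρ) with ha
  have hub : ∀ ε : ℝ, 0 < ε → ∫⁻ t, ‖poisK ε (x - t)‖ₑ * ‖h t - h x‖ₑ ≤
      ∫⁻ k : ℕ, ENNReal.ofReal (8 * (1 / 2) ^ k) * a (2 ^ k * ε) ∂Measure.count := by
    intro ε hε
    rw [lintegral_count]
    calc ∫⁻ t, ‖poisK ε (x - t)‖ₑ * ‖h t - h x‖ₑ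
        ≤ ∫⁻ t, ∑' k : ℕ, (Metric.closedBall x (2 ^ k * ε)).indicator
            (fun t => ENNReal.ofReal (4 * (1 / 4) ^ k / ε) * ‖h t - h x‖ₑ) t := by
          refine lintegral_mono fun t => ?_
          refine (mul_le_mul_left (enorm_poisK_sub_le_tsum hε x t) _).trans (le_of_eq ?_)
          rw [← ENNReal.tsum_mul_right]
          refine tsum_congr fun k => ?_
          by_cases ht : t ∈ Metric.closedBall x (2 ^ k * ε)
          · rw [indicator_of_mem ht, indicator_of_mem ht]
          · rw [indicator_of_notMem ht, indicator_of_notMem ht, zero_mul]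
      _ = ∑' k : ℕ, ENNReal.ofReal (4 * (1 / 4) ^ k / ε) *
            ∫⁻ t in Metric.closedBall x (2 ^ k * ε), ‖h t - h x‖ₑ := by
          have hm : AEMeasurable (fun t => ‖h t - h x‖ₑ) :=
            (hh.1.sub aestronglyMeasurable_const).enorm
          rw [lintegral_tsum fun k => (hm.const_mul _).indicator measurableSet_closedBall]
          refine tsum_congr fun k => ?_
          rw [lintegral_indicator measurableSet_closedBall, lintegral_const_mul'' _ hm.restrict]
      _ ≤ _ := by
          refine ENNReal.tsum_le_tsum fun k => ?_
          have hρ : 0 < 2 ^ k * ε := by positivity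
          have hv : volume (Metric.closedBall x (2 ^ k * ε)) = ENNReal.ofReal (2 * (2 ^ k * ε)) :=
            Real.volume_closedBall _ _
          have hv0 : volume (Metric.closedBall x (2 ^ k * ε)) ≠ 0 := by
            rw [hv, ne_eq, ENNReal.ofReal_eq_zero]; linarith
          have hvt : volume (Metric.closedBall x (2 ^ k * ε)) ≠ ⊤ := by
            rw [hv]; exact ENNReal.ofReal_ne_top
          have e1 : ∫⁻ t in Metric.closedBall x (2 ^ k * ε), ‖h t - h x‖ₑ =
              a (2 ^ k * ε) * ENNReal.ofReal (2 * (2 ^ k * ε)) := by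
            rw [← hv, ha]
            exact (ENNReal.div_mul_cancel hv0 hvt).symm
          rw [e1, mul_left_comm, ← mul_assoc, mul_comm (a _), mul_assoc, mul_comm (a _), ← mul_assoc,
            ← ENNReal.ofReal_mul (by positivity)]
          refine mul_le_mul_left (ENNReal.ofReal_le_ofReal (le_of_eq ?_)) _
          have : (1 / 4 : ℝ) ^ k = (1 / 2) ^ k * (1 / 2) ^ k := by rw [← mul_pow]; norm_num
          rw [this]
          have h2 : (2 : ℝ) ^ k * (1 / 2) ^ k = 1 := by rw [← mul_pow]; norm_num
          generalize (1 / 2 : ℝ) ^ k = b at h2 ⊢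
          generalize (2 : ℝ) ^ k = d at h2 ⊢
          field_simp
          linear_combination 8 * b * h2
  have hlim : Tendsto (fun ε : ℝ => ∫⁻ k : ℕ, ENNReal.ofReal (8 * (1 / 2) ^ k) * a (2 ^ k * ε)
      ∂Measure.count) (𝓝[>] 0) (𝓝 (∫⁻ k : ℕ, 0 ∂Measure.count)) := by
    refine tendsto_lintegral_filter_of_dominated_convergence
      (fun k => ENNReal.ofReal (8 * (1 / 2) ^ k) * K) ?_ ?_ ?_ ?_
    · exact Eventually.of_forall fun ε => measurable_from_nat
    · filter_upwards [self_mem_nhdsWithin] with ε hε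
      refine Eventually.of_forall fun k => ?_
      have : (0 : ℝ) < ε := hε
      gcongr
      exact hbd _ (by positivity)
    · rw [lintegral_count, ENNReal.tsum_mul_right]
      refine ENNReal.mul_ne_top ?_ hK
      rw [← ENNReal.ofReal_tsum_of_nonneg (fun k => by positivity)
        ((summable_geometric_of_lt_one (by norm_num) (by norm_num)).mul_left 8)]
      exact ENNReal.ofReal_ne_top
    · refine Eventually.of_forall fun k => ?_
      have h1 : Tendsto (fun ε : ℝ => 2 ^ k * ε) (𝓝[>] 0) (𝓝[>] 0) := by
        refine tendsto_nhdsWithin_iff.2 ⟨?_, ?_⟩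
        · have : Tendsto (fun ε : ℝ => 2 ^ k * ε) (𝓝 0) (𝓝 (2 ^ k * 0)) :=
            (continuous_const.mul continuous_id).tendsto 0
          rw [mul_zero] at this
          exact this.mono_left nhdsWithin_le_nhds
        · filter_upwards [self_mem_nhdsWithin] with ε hε
          have : (0 : ℝ) < ε := hε
          exact (by positivity : (0 : ℝ) < 2 ^ k * ε)
      have h2 := ENNReal.Tendsto.const_mul (a := ENNReal.ofReal (8 * (1 / 2) ^ k)) (hx1.comp h1)
        (Or.inr ENNReal.ofReal_ne_top)
      rw [mul_zero] at h2
      exact h2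
  rw [lintegral_zero] at hlim
  refine tendsto_of_tendsto_of_tendsto_of_le_of_le' tendsto_const_nhds hlim
    (Eventually.of_forall fun _ => zero_le) ?_
  filter_upwards [self_mem_nhdsWithin] with ε hε using hub ε hε

/-- Kernels dominated by the Poisson kernel average at Lebesgue points. -/
theorem tendsto_integral_of_abs_le_poisK {p : ℝ≥0∞} (hp1 : 1 ≤ p) (hp : p ≠ ⊤) {h : ℝ → ℂ}
    (hh : MemLp h p) {x : ℝ} (hx : Tendsto
      (fun ε : ℝ => ∫⁻ t, ‖poisK ε (x - t)‖ₑ * ‖h t - h x‖ₑ) (𝓝[>] 0) (𝓝 0))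
    {φ : ℝ → ℝ → ℝ} (hφm : ∀ ε, Measurable (φ ε))
    (hφ : ∀ ε, 0 < ε → ∀ u, |φ ε u| ≤ poisK ε u) {c : ℝ} (hc : ∀ ε, 0 < ε → ∫ u, φ ε u = c) :
    (∀ ε, 0 < ε → Integrable fun t => φ ε (x - t) • h t) ∧
    Tendsto (fun ε : ℝ => kconv (φ ε) h x) (𝓝[>] 0) (𝓝 (c • h x)) := by
  have hφi : ∀ ε, 0 < ε → Integrable (φ ε) := fun ε hε =>
    (integrable_poisK hε).mono' (hφm ε).aestronglyMeasurable (Eventually.of_forall (hφ ε hε))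
  have hi : ∀ ε, 0 < ε → Integrable fun t => φ ε (x - t) • h t := by
    intro ε hε
    refine ((decayKernel_poisK hε).integrable hp1 hp hh x).norm.mono'
      (((hφm ε).comp (by fun_prop)).aestronglyMeasurable.smul hh.1) (Eventually.of_forall fun t => ?_)
    rw [norm_smul, norm_smul, Real.norm_eq_abs, Real.norm_of_nonneg (poisK_pos hε _).le]
    gcongr
    exact hφ ε hε _
  refine ⟨hi, ?_⟩
  rw [tendsto_iff_edist_tendsto_0]
  refine tendsto_of_tendsto_of_tendsto_of_le_of_le' tendsto_const_nhds hx
    (Eventually.of_forall fun _ => zero_le) ?_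
  filter_upwards [self_mem_nhdsWithin] with ε hε
  have hε' : 0 < ε := hε
  -- As φ_ε has integral c, the constant h x can be moved under the integral.
  have e : kconv (φ ε) h x - c • h x = ∫ t, φ ε (x - t) • (h t - h x) := by
    simp_rw [smul_sub]
    rw [integral_sub (hi ε hε) (((hφi ε hε).comp_sub_left x).smul_const _), integral_smul_const,
      integral_sub_left_eq_self (φ ε), hc ε hε]
    rfl
  rw [edist_eq_enorm_sub, e]
  refine (enorm_integral_le_lintegral_enorm _).trans (lintegral_mono fun t => ?_)
  rw [enorm_smul]
  gcongr
  rw [enorm_le_iff_norm_le, Real.norm_eq_abs, Real.norm_of_nonneg (poisK_pos hε _).le]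
  exact hφ ε hε _

theorem tendsto_kconv_poisK {p : ℝ≥0∞} (hp1 : 1 ≤ p) (hp : p ≠ ⊤) {h : ℝ → ℂ}
    (hh : MemLp h p) {x : ℝ} (hx : Tendsto
      (fun ε : ℝ => ∫⁻ t, ‖poisK ε (x - t)‖ₑ * ‖h t - h x‖ₑ) (𝓝[>] 0) (𝓝 0)) :
    Tendsto (fun ε : ℝ => kconv (poisK ε) h x) (𝓝[>] 0) (𝓝 (h x)) := by
  have := (tendsto_integral_of_abs_le_poisK hp1 hp hh hx (φ := poisK) (c := 1)
    (fun ε => by unfold poisK; fun_prop)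
    (fun ε hε u => (abs_of_pos (poisK_pos hε u)).le) (fun ε hε => integral_poisK hε)).2
  simpa using this

/-- The truncated Hilbert kernel. -/
noncomputable def truncK (ε u : ℝ) : ℝ := {u : ℝ | ε < |u|}.indicator (fun u => (Real.pi * u)⁻¹) u

theorem measurableSet_truncK (ε : ℝ) : MeasurableSet {u : ℝ | ε < |u|} :=
  measurableSet_lt measurable_const (by fun_prop)

/-- For |u| > ε the difference equals -(ε/u) P_ε(u); for |u| ≤ ε it is Q_ε(u) = (u/ε) P_ε(u). In
both cases the factor is at most 1 in modulus. -/
theorem abs_conjK_sub_truncK_le {ε : ℝ} (hε : 0 < ε) (u : ℝ) :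
    |conjK ε u - truncK ε u| ≤ poisK ε u := by
  have hpi := Real.pi_pos
  by_cases hu : ε < |u|
  · have hu0 : 0 < |u| := hε.trans hu
    have hu' : u ≠ 0 := abs_pos.1 hu0
    have e : conjK ε u - truncK ε u = -(ε / u) * poisK ε u := by
      rw [truncK, indicator_of_mem (show u ∈ {u : ℝ | ε < |u|} from hu), conjK, poisK]
      field_simp
      ring
    rw [e, abs_mul, abs_of_pos (poisK_pos hε u), abs_neg, abs_div, abs_of_pos hε]
    exact mul_le_of_le_one_left (poisK_pos hε u).le ((div_le_one hu0).2 hu.le)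
  · rw [truncK, indicator_of_notMem (show u ∉ {u : ℝ | ε < |u|} from hu), sub_zero, conjK, poisK, abs_div,
      abs_of_pos (by positivity : 0 < Real.pi * (u ^ 2 + ε ^ 2))]
    gcongr
    exact not_lt.1 hu

/-- The difference of the kernels is odd, hence of integral 0, and dominated by the Poisson kernel.
Truncated integrals and conjugate Poisson integrals therefore have the same limit at Lebesgue
points. -/
theorem ae_tendsto_kconv_conjK_sub_truncK {p : ℝ≥0∞} (hp1 : 1 ≤ p) (hp : p ≠ ⊤) {h : ℝ → ℂ}
    (hh : MemLp h p) : ∀ᵐ x, (∀ ε, 0 < ε → Integrable fun t => truncK ε (x - t) • h t) ∧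
    Tendsto (fun ε : ℝ => kconv (conjK ε) h x - kconv (truncK ε) h x) (𝓝[>] 0) (𝓝 0) := by
  filter_upwards [ae_tendsto_lintegral_poisK_mul_sub hp1 hp hh] with x hx
  have hodd : ∀ ε, 0 < ε → ∫ u, (conjK ε u - truncK ε u) = 0 := by
    intro ε hε
    have h1 : ∫ u, (conjK ε u - truncK ε u) = ∫ u, (conjK ε (-u) - truncK ε (-u)) :=
      (integral_neg_eq_self (fun u => conjK ε u - truncK ε u) volume).symm
    have h2 : ∀ u, conjK ε (-u) - truncK ε (-u) = -(conjK ε u - truncK ε u) := by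
      intro u
      have : truncK ε (-u) = -truncK ε u := by
        unfold truncK
        by_cases hu : ε < |u|
        · rw [indicator_of_mem (by simpa using hu), indicator_of_mem (by exact hu), mul_neg, inv_neg]
        · rw [indicator_of_notMem (by simpa using hu), indicator_of_notMem (by exact hu), neg_zero]
      rw [conjK_neg, this]; ring
    simp_rw [h2] at h1
    rw [integral_neg] at h1
    linarith
  obtain ⟨hi, ht⟩ := tendsto_integral_of_abs_le_poisK hp1 hp hh hx
    (φ := fun ε u => conjK ε u - truncK ε u) (c := 0)
    (fun ε => by
      have h1 : Measurable (conjK ε) := by unfold conjK; fun_prop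
      have h2 : Measurable (truncK ε) :=
        (by fun_prop : Measurable fun u : ℝ => (Real.pi * u)⁻¹).indicator (measurableSet_truncK ε)
      exact h1.sub h2)
    (fun ε hε u => abs_conjK_sub_truncK_le hε u) hodd
  have hi2 : ∀ ε, 0 < ε → Integrable fun t => truncK ε (x - t) • h t := by
    intro ε hε
    refine (((decayKernel_conjK hε).integrable hp1 hp hh x).sub (hi ε hε)).congr
      (Eventually.of_forall fun t => ?_)
    simp [sub_smul]
  refine ⟨hi2, ?_⟩
  rw [zero_smul] at ht
  refine ht.congr' ?_
  filter_upwards [self_mem_nhdsWithin] with ε hε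
  unfold kconv
  rw [← integral_sub ((decayKernel_conjK hε).integrable hp1 hp hh x) (hi2 ε hε)]
  simp [sub_smul]

/-! ### The Poisson semigroup and the Hilbert transform on L_p. -/

theorem kconv_comp_of_integrable' {f : ℝ → ℂ} (hf : Integrable f) {ε : ℝ} (hε : 0 < ε)
    {k k' : ℝ → ℝ} (hk : DecayKernel k)
    (hkk : ∀ x, ∫ t, poisK ε (x - t) * k t = k' x) (x : ℝ) :
    kconv k (kconv (poisK ε) f) x = kconv k' f x := by
  obtain ⟨hkc, c, hc, hkb⟩ := hk
  have hcb : ∀ u, |k u| ≤ c := fun u => (hkb u).trans <| by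
    refine mul_le_of_le_one_right hc (inv_le_one_of_one_le₀ ?_)
    linarith [abs_nonneg u]
  have hprod : Integrable (Function.uncurry fun s t => k (x - s) • poisK ε (s - t) • f t)
      (volume.prod volume) := by
    have h1 := hf.convolution_integrand (ContinuousLinearMap.lsmul ℝ ℝ (E := ℂ)).flip
      (integrable_poisK hε) (μ := (volume : Measure ℝ)) (ν := (volume : Measure ℝ))
    simp only [ContinuousLinearMap.flip_apply, ContinuousLinearMap.lsmul_apply] at h1
    refine h1.bdd_smul (φ := fun z : ℝ × ℝ => k (x - z.1)) c ?_ (Eventually.of_forall fun z => hcb _)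
    exact (hkc.comp (by fun_prop : Continuous fun z : ℝ × ℝ => x - z.1)).aestronglyMeasurable
  unfold kconv
  simp_rw [← integral_smul]
  rw [integral_integral_swap hprod]
  refine integral_congr_ae (Eventually.of_forall fun t => ?_)
  simp only [smul_smul]
  rw [integral_smul_const, ← hkk]
  congr 1
  rw [← integral_sub_left_eq_self (fun s => poisK ε (x - t - s) * k s) volume x]
  refine integral_congr_ae (Eventually.of_forall fun s => ?_)
  simp only
  rw [mul_comm]
  congr 2
  ring

theorem memLp_poisK {p : ℝ≥0∞} (hp1 : 1 < p) {ε : ℝ} (hε : 0 < ε) : MemLp (poisK ε) p :=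
  ((memLp_one_add_abs_inv hp1).const_mul (1 / ε + 1)).mono
    (continuous_poisK hε).aestronglyMeasurable (Eventually.of_forall fun u => by
      rw [Real.norm_eq_abs, Real.norm_of_nonneg (by positivity)]
      exact abs_poisK_le hε u)

theorem poisK_add_le {ε : ℝ} (hε : 0 < ε) (hε1 : ε ≤ 1) (u : ℝ) :
    poisK (ε + 1) u ≤ 2 * poisK 1 u := by
  have := Real.pi_pos
  unfold poisK
  rw [← mul_div_assoc]
  gcongr <;> linarith

/-- From |g| ≤ M P_1 and the semigroup rule, |P_ε * g| ≤ M P_(ε+1) ≤ 2M P_1 for ε ≤ 1. So 3M P_1 ∈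
L_p dominates the difference, which tends to 0 almost everywhere. -/
theorem tendsto_eLpNorm_kconv_poisK_sub_of_compact {p : ℝ≥0∞} (hp1 : 1 < p) (hp : p ≠ ⊤)
    {g : ℝ → ℂ} (hg : Continuous g) (hgc : HasCompactSupport g) :
    Tendsto (fun ε : ℝ => eLpNorm (kconv (poisK ε) g - g) p) (𝓝[>] 0) (𝓝 0) := by
  have hp0 : p ≠ 0 := (zero_lt_one.trans hp1).ne'
  have hr0 : 0 < p.toReal := ENNReal.toReal_pos hp0 hp
  have hgp : MemLp g p := hg.memLp_of_hasCompactSupport hgc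
  have hgi : Integrable g := hg.integrable_of_hasCompactSupport hgc
  obtain ⟨M, hM0, hM⟩ : ∃ M, 0 ≤ M ∧ ∀ t, ‖g t‖ ≤ M * poisK 1 t := by
    have hc : Continuous fun t => (poisK 1 t)⁻¹ * ‖g t‖ :=
      ((continuous_poisK one_pos).inv₀ fun t => (poisK_pos one_pos t).ne').mul hg.norm
    obtain ⟨M, hM⟩ := (hgc.norm.mul_left (f := fun t => (poisK 1 t)⁻¹)).exists_bound_of_continuous hc
    refine ⟨|M|, abs_nonneg _, fun t => ?_⟩
    have h1 := (hM t).trans (le_abs_self M)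
    have h2 := poisK_pos one_pos t
    simp only [Pi.mul_apply] at h1
    rw [Real.norm_of_nonneg (by positivity), inv_mul_le_iff₀ h2] at h1
    linarith
  have hPb : ∀ ε : ℝ, 0 < ε → ε ≤ 1 → ∀ x, ‖kconv (poisK ε) g x‖ ≤ 2 * M * poisK 1 x := by
    intro ε hε hε1 x
    have hi : Integrable fun t => poisK ε (x - t) * poisK 1 t :=
      (decayKernel_poisK hε).integrable (E := ℝ) le_rfl (by simp)
        (memLp_one_iff_integrable.2 (integrable_poisK one_pos)) x
    calc ‖kconv (poisK ε) g x‖ ≤ ∫ t, ‖poisK ε (x - t) • g t‖ := norm_integral_le_integral_norm _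
      _ ≤ ∫ t, M * (poisK ε (x - t) * poisK 1 t) := by
          refine integral_mono ((decayKernel_poisK hε).integrable hp1.le hp hgp x).norm
            (hi.const_mul M) fun t => ?_
          simp only
          rw [norm_smul, Real.norm_of_nonneg (poisK_pos hε _).le, mul_left_comm]
          exact mul_le_mul_of_nonneg_left (hM t) (poisK_pos hε _).le
      _ = M * poisK (ε + 1) x := by
          rw [integral_const_mul, (integral_poisK_mul_conjK hε one_pos x).2]
      _ ≤ M * (2 * poisK 1 x) := by gcongr; exact poisK_add_le hε hε1 x
      _ = _ := by ring
  have hlim : Tendsto (fun ε : ℝ => ∫⁻ x, ‖(kconv (poisK ε) g - g) x‖ₑ ^ p.toReal) (𝓝[>] 0)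
      (𝓝 (∫⁻ _ : ℝ, 0)) := by
    have hev : ∀ᶠ ε : ℝ in 𝓝[>] 0, 0 < ε ∧ ε ≤ 1 := by
      filter_upwards [Ioc_mem_nhdsGT (zero_lt_one (α := ℝ))] with ε hε using hε
    refine tendsto_lintegral_filter_of_dominated_convergence
      (fun x => ‖3 * M * poisK 1 x‖ₑ ^ p.toReal) ?_ ?_ ?_ ?_
    · filter_upwards [hev] with ε hε
      exact ((((decayKernel_poisK hε.1).continuous_kconv hp1.le hp hgp).sub
        hg).measurable.enorm.pow_const _)
    · filter_upwards [hev] with ε hε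
      refine Eventually.of_forall fun x => ?_
      gcongr
      rw [enorm_le_iff_norm_le, Pi.sub_apply, Real.norm_of_nonneg
        (by have := poisK_pos one_pos x; positivity)]
      refine (norm_sub_le _ _).trans ?_
      have h1 := hPb ε hε.1 hε.2 x
      have h2 := hM x
      linarith
    · have : MemLp (fun x => 3 * M * poisK 1 x) p := (memLp_poisK hp1 one_pos).const_mul _
      rw [← eLpNorm_rpow_toReal hp0 hp]
      exact ENNReal.rpow_ne_top_of_nonneg hr0.le this.2.ne
    · filter_upwards [ae_tendsto_lintegral_poisK_mul_sub hp1.le hp hgp] with x hx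
      have h1 := (tendsto_kconv_poisK hp1.le hp hgp hx).sub_const (g x)
      rw [sub_self] at h1
      have h2 := (ENNReal.continuous_rpow_const (y := p.toReal)).tendsto _ |>.comp h1.enorm
      rw [enorm_zero, ENNReal.zero_rpow_of_pos hr0] at h2
      exact h2
  rw [lintegral_zero] at hlim
  have h3 := (ENNReal.continuous_rpow_const (y := 1 / p.toReal)).tendsto _ |>.comp hlim
  rw [ENNReal.zero_rpow_of_pos (by positivity)] at h3
  refine h3.congr fun ε => ?_
  rw [Function.comp, ← eLpNorm_rpow_toReal hp0 hp, ← ENNReal.rpow_mul,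
    mul_one_div_cancel hr0.ne', ENNReal.rpow_one]

/-- Density of continuous compactly supported functions, as an induction principle. -/
theorem Lp_induction_of_compact {p : ℝ≥0∞} [Fact (1 ≤ p)] (hp : p ≠ ⊤)
    {S : Set (Lp ℂ p (volume : Measure ℝ))} (hS : IsClosed S)
    (h : ∀ (f : Lp ℂ p (volume : Measure ℝ)) (g : ℝ → ℂ), Continuous g → HasCompactSupport g →
      f =ᵐ[volume] g → f ∈ S) (f : Lp ℂ p (volume : Measure ℝ)) : f ∈ S := by
  rw [← hS.closure_eq, EMetric.mem_closure_iff]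
  intro ε hε
  obtain ⟨g, hgc, hge, hg, hgp⟩ := (Lp.memLp f).exists_hasCompactSupport_eLpNorm_sub_le hp
    (ENNReal.half_pos hε.ne').ne'
  by_cases hεt : ε = ⊤
  · exact ⟨hgp.toLp g, h _ g hg hgc hgp.coeFn_toLp, by rw [hεt]; exact edist_lt_top _ _⟩
  refine ⟨hgp.toLp g, h _ g hg hgc hgp.coeFn_toLp, ?_⟩
  rw [Lp.edist_def]
  refine lt_of_le_of_lt ?_ (ENNReal.half_lt_self hε.ne' hεt)
  refine le_trans (le_of_eq (eLpNorm_congr_ae ?_)) hge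
  filter_upwards [hgp.coeFn_toLp] with x hx
  simp [hx]

theorem exists_clm_of_kconv {p : ℝ≥0∞} [Fact (1 ≤ p)] (hp : p ≠ ⊤) {k : ℝ → ℝ}
    (hk : DecayKernel k) (C : ℝ≥0) (hC : ∀ f : ℝ → ℂ, MemLp f p →
      eLpNorm (kconv k f) p ≤ C * eLpNorm f p) :
    ∃ T : Lp ℂ p (volume : Measure ℝ) →L[ℂ] Lp ℂ p (volume : Measure ℝ),
      (∀ f : Lp ℂ p (volume : Measure ℝ), T f =ᵐ[volume] kconv k f) ∧ ‖T‖ ≤ C := by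
  have hp1 : 1 ≤ p := Fact.out
  have e : ∀ f : ℝ → ℂ, (fun y => ∫ x, (k (y - x) : ℂ) * f x) = kconv k f := by
    intro f; ext y; simp [kconv]
  have := exists_clm_of_kernel (μ := (volume : Measure ℝ)) (ν := (volume : Measure ℝ)) (p := p)
    (fun y x => k (y - x)) C (fun f hf => Eventually.of_forall fun y => by
      simpa using hk.integrable hp1 hp hf y) (fun f hf => by
      rw [e]
      exact ⟨(hk.continuous_kconv hp1 hp hf).aestronglyMeasurable,
        (hC f hf).trans_lt (ENNReal.mul_lt_top (by simp) hf.2)⟩) (fun f hf => by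
      rw [e]; exact hC f hf)
  obtain ⟨T, hT, hTn⟩ := this
  exact ⟨T, fun f => by rw [← e]; exact hT f, hTn⟩

theorem kconv_congr_ae {k : ℝ → ℝ} {f g : ℝ → ℂ} (h : f =ᵐ[volume] g) : kconv k f = kconv k g := by
  ext x
  refine integral_congr_ae ?_
  filter_upwards [h] with t ht
  rw [ht]

/-- **M. Riesz**: the Hilbert transform, as a bounded operator on `L_p` of the line given by the
almost everywhere limit of the truncated integrals. -/
theorem exists_hilbertTransform {p : ℝ≥0∞} [Fact (1 ≤ p)] (hp1 : 1 < p) (hp : p ≠ ⊤) :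
    ∃ T : Lp ℂ p (volume : Measure ℝ) →L[ℂ] Lp ℂ p (volume : Measure ℝ),
      ∀ f : Lp ℂ p (volume : Measure ℝ), ∀ᵐ x,
        (∀ ε, 0 < ε → Integrable fun t => truncK ε (x - t) • f t) ∧
        Tendsto (fun ε => kconv (truncK ε) f x) (𝓝[>] 0) (𝓝 (T f x)) := by
  obtain ⟨C, hC⟩ := exists_eLpNorm_kconv_conjK_le hp1 hp
  have exP : ∀ ε : ℝ, ∃ T : Lp ℂ p (volume : Measure ℝ) →L[ℂ] Lp ℂ p (volume : Measure ℝ),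
      0 < ε → (∀ f, T f =ᵐ[volume] kconv (poisK ε) f) ∧ ‖T‖ ≤ 1 := fun ε => by
    by_cases hε : 0 < ε
    · obtain ⟨T, hT⟩ := exists_clm_of_kconv (p := p) hp (decayKernel_poisK hε) 1 (fun f hf => by
        simpa using (eLpNorm_kconv_poisK_le hp1 hp hε hf).2)
      exact ⟨T, fun _ => by simpa using hT⟩
    · exact ⟨0, fun h => absurd h hε⟩
  have exQ : ∀ ε : ℝ, ∃ T : Lp ℂ p (volume : Measure ℝ) →L[ℂ] Lp ℂ p (volume : Measure ℝ),
      0 < ε → (∀ f, T f =ᵐ[volume] kconv (conjK ε) f) ∧ ‖T‖ ≤ C := fun ε => by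
    by_cases hε : 0 < ε
    · obtain ⟨T, hT⟩ := exists_clm_of_kconv (p := p) hp (decayKernel_conjK hε) C (hC ε hε)
      exact ⟨T, fun _ => hT⟩
    · exact ⟨0, fun h => absurd h hε⟩
  choose P hP using exP
  choose Q hQ using exQ
  have PQ : ∀ ε δ : ℝ, 0 < ε → 0 < δ → ∀ f, P ε (Q δ f) = Q (ε + δ) f := by
    intro ε δ hε hδ
    refine Lp_induction_of_compact hp (isClosed_eq (by fun_prop) (by fun_prop)) ?_
    intro f g hg hgc hfg
    refine Lp.ext ?_
    have hgi : Integrable g := hg.integrable_of_hasCompactSupport hgc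
    have e1 := (hP ε hε).1 (Q δ f)
    rw [kconv_congr_ae (((hQ δ hδ).1 f).trans (by rw [kconv_congr_ae hfg]))] at e1
    have e2 := (hQ (ε + δ) (by positivity)).1 f
    rw [kconv_congr_ae hfg] at e2
    refine (e1.trans (Eventually.of_forall fun x => ?_)).trans e2.symm
    exact kconv_comp_of_integrable hgi hε (decayKernel_conjK hδ)
      (fun x => (integral_poisK_mul_conjK hε hδ x).1) x
  have QP : ∀ ε δ : ℝ, 0 < ε → 0 < δ → ∀ f, Q δ (P ε f) = Q (ε + δ) f := by
    intro ε δ hε hδ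
    refine Lp_induction_of_compact hp (isClosed_eq (by fun_prop) (by fun_prop)) ?_
    intro f g hg hgc hfg
    refine Lp.ext ?_
    have hgi : Integrable g := hg.integrable_of_hasCompactSupport hgc
    have e1 := (hQ δ hδ).1 (P ε f)
    rw [kconv_congr_ae (((hP ε hε).1 f).trans (by rw [kconv_congr_ae hfg]))] at e1
    have e2 := (hQ (ε + δ) (by positivity)).1 f
    rw [kconv_congr_ae hfg] at e2
    refine (e1.trans (Eventually.of_forall fun x => ?_)).trans e2.symm
    exact kconv_comp_of_integrable' hgi hε (decayKernel_conjK hδ)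
      (fun x => (integral_poisK_mul_conjK hε hδ x).1) x
  set η : ℕ → ℝ := fun n => 1 / ((n : ℝ) + 1) with hη
  have hη0 : ∀ n, 0 < η n := fun n => Nat.one_div_pos_of_nat
  have hηlim : Tendsto η atTop (𝓝[>] 0) :=
    tendsto_nhdsWithin_iff.2 ⟨tendsto_one_div_add_atTop_nhds_zero_nat, Eventually.of_forall hη0⟩
  have Plim : ∀ f, Tendsto (fun n => P (η n) f) atTop (𝓝 f) := by
    refine Lp_induction_of_compact hp (S := {f | Tendsto (fun n => P (η n) f) atTop (𝓝 f)}) ?_ ?_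
    · refine isClosed_of_closure_subset fun f hf => ?_
      rw [mem_ofPred_eq, Metric.tendsto_atTop]
      intro e he
      obtain ⟨g, hg, hfg⟩ := Metric.mem_closure_iff.1 hf (e / 3) (by positivity)
      obtain ⟨N, hN⟩ := Metric.tendsto_atTop.1 (mem_ofPred_eq ▸ hg) (e / 3) (by positivity)
      refine ⟨N, fun n hn => ?_⟩
      have h1 : dist (P (η n) f) (P (η n) g) ≤ dist f g := by
        rw [dist_eq_norm, dist_eq_norm, ← map_sub]
        exact ((P (η n)).le_of_opNorm_le (hP _ (hη0 n)).2 _).trans_eq (one_mul _)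
      have h2 := hN n hn
      have h3 := dist_triangle4 (P (η n) f) (P (η n) g) g f
      rw [dist_comm g f] at h3
      linarith
    · intro f g hg hgc hfg
      have h1 := (tendsto_eLpNorm_kconv_poisK_sub_of_compact hp1 hp hg hgc).comp hηlim
      refine (Lp.tendsto_Lp_iff_tendsto_eLpNorm' _ _).2 (h1.congr fun n => ?_)
      refine eLpNorm_congr_ae ?_
      have h2 := (hP _ (hη0 n)).1 f
      rw [kconv_congr_ae hfg] at h2
      exact h2.symm.sub hfg.symm
  have hCauchy : ∀ f, ∃ g, Tendsto (fun n => Q (η n) f) atTop (𝓝 g) := by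
    intro f
    refine cauchySeq_tendsto_of_complete ?_
    rw [Metric.cauchySeq_iff']
    intro e he
    have hC1 : 0 < (C : ℝ) + 1 := by positivity
    -- On P_m f the sequence converges, since Q_n P_m f = P_n Q_m f tends to Q_m f. The uniform
    -- bound ‖Q_n‖ ≤ C transfers the Cauchy property to f; C + 1 guards against C = 0.
    obtain ⟨m, hm⟩ := (Metric.tendsto_nhds.1 (Plim f) (e / (4 * (C + 1))) (by positivity)).exists
    have h1 : CauchySeq fun n => Q (η n) (P (η m) f) := by
      refine ((Plim (Q (η m) f)).congr fun n => ?_).cauchySeq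
      rw [PQ _ _ (hη0 _) (hη0 _), QP _ _ (hη0 _) (hη0 _), add_comm]
    obtain ⟨N, hN⟩ := Metric.cauchySeq_iff'.1 h1 (e / 2) (by positivity)
    have h2 : ∀ n, dist (Q (η n) f) (Q (η n) (P (η m) f)) < e / 4 := by
      intro n
      rw [dist_eq_norm, ← map_sub]
      refine ((Q (η n)).le_of_opNorm_le (hQ _ (hη0 n)).2 _).trans_lt ?_
      rw [← dist_eq_norm, dist_comm]
      rw [lt_div_iff₀ (by positivity)] at hm
      nlinarith [dist_nonneg (x := P (η m) f) (y := f)]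
    refine ⟨N, fun n hn => ?_⟩
    have h3 := dist_triangle4 (Q (η n) f) (Q (η n) (P (η m) f)) (Q (η N) (P (η m) f)) (Q (η N) f)
    have h4 := h2 N
    rw [dist_comm] at h4
    linarith [hN n hn, h2 n]
  choose T₀ hT₀ using hCauchy
  let T : Lp ℂ p (volume : Measure ℝ) →L[ℂ] Lp ℂ p (volume : Measure ℝ) :=
    continuousLinearMapOfTendsto (fun n => Q (η n)) (tendsto_pi_nhds.2 hT₀)
  have hT : ∀ f, Tendsto (fun n => Q (η n) f) atTop (𝓝 (T f)) := hT₀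
  have PT : ∀ ε : ℝ, 0 < ε → ∀ f, P ε (T f) = Q ε f := by
    intro ε hε f
    have h1 : Tendsto (fun n => P ε (Q (η n) f)) atTop (𝓝 (P ε (T f))) :=
      ((P ε).continuous.tendsto _).comp (hT f)
    refine tendsto_nhds_unique h1 ((Plim (Q ε f)).congr fun n => ?_)
    rw [PQ _ _ (hη0 _) hε, PQ _ _ hε (hη0 _), add_comm]
  refine ⟨T, fun f => ?_⟩
  -- Both sides are continuous in x, so the almost everywhere identity holds at every x; no
  -- exceptional set depending on ε remains when ε tends to 0.
  have hptw : ∀ ε : ℝ, 0 < ε → kconv (poisK ε) (T f) = kconv (conjK ε) f := by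
    intro ε hε
    refine (Continuous.ae_eq_iff_eq volume
      ((decayKernel_poisK hε).continuous_kconv hp1.le hp (Lp.memLp (T f)))
      ((decayKernel_conjK hε).continuous_kconv hp1.le hp (Lp.memLp f))).1 ?_
    have h1 := (hP ε hε).1 (T f)
    rw [PT ε hε] at h1
    exact h1.symm.trans ((hQ ε hε).1 f)
  filter_upwards [ae_tendsto_kconv_conjK_sub_truncK hp1.le hp (Lp.memLp f),
    ae_tendsto_lintegral_poisK_mul_sub hp1.le hp (Lp.memLp (T f))] with x h1 h2
  refine ⟨h1.1, ?_⟩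
  have h3 := (tendsto_kconv_poisK hp1.le hp (Lp.memLp (T f)) h2).sub h1.2
  rw [sub_zero] at h3
  refine h3.congr' ?_
  filter_upwards [self_mem_nhdsWithin] with ε hε
  rw [hptw ε hε]
  ring

/-! ### The non-singular part of the kernel: Hardy kernels and Schur's test. -/

/-- The difference of the kernel of `K_α` and the Hilbert kernel. -/
noncomputable def diffK (α x y : ℝ) : ℝ := kerK α x y - (Real.pi * (x - y))⁻¹

/-- This symmetry reduces the region x < y to y < x, at the cost of replacing α by 1 - α. -/
theorem diffK_swap (α x y : ℝ) : diffK α x y = -diffK (1 - α) y x := by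
  have h1 : x ^ 2 - y ^ 2 = -(y ^ 2 - x ^ 2) := by ring
  have h2 : Real.pi * (x - y) = -(Real.pi * (y - x)) := by ring
  unfold diffK kerK
  rw [h1, h2, div_neg, inv_neg, sub_sub_cancel]
  ring

/-- Bernoulli's inequality for s ≥ 1, monotonicity in the exponent for 0 ≤ s ≤ 1, and for s < 0 the
factorization t^s - 1 = (1 - t^(-s)) t^s. The factor 1 - t is what cancels the diagonal singularity.
-/
theorem abs_rpow_sub_one_le {t : ℝ} (s : ℝ) (ht0 : 0 < t) (ht1 : t < 1) :
    |t ^ s - 1| ≤ max |s| 1 * (1 - t) * max 1 (t ^ s) := by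
  have aux : ∀ s : ℝ, 0 ≤ s → 1 - t ^ s ≤ max s 1 * (1 - t) := by
    intro s hs
    rcases le_total s 1 with h | h
    · rw [max_eq_right h, one_mul]
      have : t ^ (1 : ℝ) ≤ t ^ s := Real.rpow_le_rpow_of_exponent_ge ht0 ht1.le h
      rw [Real.rpow_one] at this
      linarith
    · rw [max_eq_left h]
      have := one_add_mul_self_le_rpow_one_add (s := t - 1) (by linarith) h
      rw [add_sub_cancel] at this
      linarith
  rcases le_total 0 s with h | h
  · have h1 : t ^ s ≤ 1 := Real.rpow_le_one ht0.le ht1.le h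
    rw [max_eq_left h1, mul_one, abs_of_nonpos (by linarith), abs_of_nonneg h]
    linarith [aux s h]
  · have h1 : 1 ≤ t ^ s := Real.one_le_rpow_of_pos_of_le_one_of_nonpos ht0 ht1.le h
    rw [max_eq_right h1, abs_of_nonneg (by linarith), abs_of_nonpos h]
    have h2 := aux (-s) (by linarith)
    have h3 : t ^ s * t ^ (-s) = 1 := by rw [← Real.rpow_add ht0, add_neg_cancel, Real.rpow_zero]
    calc t ^ s - 1 = (1 - t ^ (-s)) * t ^ s := by linear_combination h3
      _ ≤ _ := by gcongr

/-- With t = y/x the kernel is (πx)⁻¹ (2(t^(1-α) - 1) + (1 - t)) / (1 - t²). The numerator is O(1 -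
t) at t = 1, and its growth as t → 0 is at most t^(-σ), σ = max(0, α-1). -/
theorem abs_diffK_le_of_lt (α : ℝ) {x y : ℝ} (hy : 0 < y) (hyx : y < x) :
    |diffK α x y| ≤ (2 * max |1 - α| 1 + 1) * (x ^ (max 0 (α - 1) - 1) * y ^ (-max 0 (α - 1))) := by
  have hx : 0 < x := hy.trans hyx
  set t := y / x with ht
  have ht0 : 0 < t := div_pos hy hx
  have ht1 : t < 1 := (div_lt_one hx).2 hyx
  have hyt : y = t * x := by rw [ht]; field_simp
  set σ := max 0 (α - 1) with hσ
  set M := max |1 - α| 1 with hM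
  have hpi : 1 ≤ Real.pi := by linarith [Real.pi_gt_three]
  have h1 : max 1 (t ^ (1 - α)) ≤ t ^ (-σ) := by
    apply max_le
    · exact Real.one_le_rpow_of_pos_of_le_one_of_nonpos ht0 ht1.le (by simp [hσ])
    · refine Real.rpow_le_rpow_of_exponent_ge ht0 ht1.le ?_
      have : α - 1 ≤ σ := le_max_right _ _
      linarith
  have h1t : 1 ≤ t ^ (-σ) := (le_max_left _ _).trans h1
  have e1 : x ^ (σ - 1) * y ^ (-σ) = x⁻¹ * t ^ (-σ) := by
    rw [hyt, Real.mul_rpow ht0.le hx.le, Real.rpow_sub_one hx.ne', Real.rpow_neg hx.le]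
    have := Real.rpow_pos_of_pos hx σ
    field_simp
  have e2 : diffK α x y =
      (Real.pi * x)⁻¹ * ((2 * (t ^ (1 - α) - 1) + (1 - t)) * ((1 - t) * (1 + t))⁻¹) := by
    have e3 : x ^ α * y ^ (1 - α) = x * t ^ (1 - α) := by
      rw [hyt, Real.mul_rpow ht0.le hx.le, mul_left_comm, ← Real.rpow_add hx,
        add_sub_cancel, Real.rpow_one, mul_comm]
    rw [diffK, kerK, e3, hyt]
    have h3 : (1 - t) ≠ 0 := by linarith
    have h4 : (1 + t) ≠ 0 := by linarith
    have h5 : x ^ 2 - (t * x) ^ 2 = x ^ 2 * ((1 - t) * (1 + t)) := by ring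
    have h6 : x - t * x = x * (1 - t) := by ring
    rw [h5, h6]
    field_simp
    ring
  have hpos : 0 < (1 - t) * (1 + t) := mul_pos (by linarith) (by linarith)
  rw [e1, e2, abs_mul, abs_mul, abs_of_pos (by positivity : 0 < (Real.pi * x)⁻¹),
    abs_of_pos (inv_pos.2 hpos)]
  have h7 : |2 * (t ^ (1 - α) - 1) + (1 - t)| ≤ (1 - t) * ((2 * M + 1) * t ^ (-σ)) := by
    have h8 := abs_rpow_sub_one_le (1 - α) ht0 ht1
    have hM0 : 0 ≤ M := le_max_of_le_right zero_le_one
    have h9 : M * (1 - t) * max 1 (t ^ (1 - α)) ≤ M * (1 - t) * t ^ (-σ) :=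
      mul_le_mul_of_nonneg_left h1 (mul_nonneg hM0 (by linarith))
    calc _ ≤ |2 * (t ^ (1 - α) - 1)| + |1 - t| := abs_add_le _ _
      _ = 2 * |t ^ (1 - α) - 1| + (1 - t) := by
          rw [abs_mul, abs_of_pos (by linarith : 0 < 1 - t)]; norm_num
      _ ≤ 2 * (M * (1 - t) * t ^ (-σ)) + (1 - t) * t ^ (-σ) := by
          have : (1 - t) * 1 ≤ (1 - t) * t ^ (-σ) :=
            mul_le_mul_of_nonneg_left h1t (by linarith)
          linarith
      _ = _ := by ring
  have h10 : |2 * (t ^ (1 - α) - 1) + (1 - t)| * ((1 - t) * (1 + t))⁻¹ ≤ (2 * M + 1) * t ^ (-σ) := by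
    rw [← div_eq_mul_inv, div_le_iff₀ hpos]
    refine h7.trans ?_
    have h11 : 0 ≤ (1 - t) * ((2 * M + 1) * t ^ (-σ)) := (abs_nonneg _).trans h7
    nlinarith
  calc _ ≤ (Real.pi * x)⁻¹ * ((2 * M + 1) * t ^ (-σ)) := by gcongr
    _ ≤ x⁻¹ * ((2 * M + 1) * t ^ (-σ)) := by
        have hM0 : 0 ≤ M := le_max_of_le_right zero_le_one
        gcongr
        exact le_mul_of_one_le_left hx.le hpi
    _ = _ := by ring

/-- A homogeneous kernel of Hardy type. -/
noncomputable def hardyK (σ x y : ℝ) : ℝ := if y < x then x ^ (σ - 1) * y ^ (-σ) else 0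

theorem measurable_hardyK (σ : ℝ) : Measurable (Function.uncurry (hardyK σ)) := by
  unfold hardyK
  exact Measurable.ite (measurableSet_lt measurable_snd measurable_fst) (by fun_prop)
    measurable_const

theorem hardyK_nonneg (σ : ℝ) {x y : ℝ} (hx : 0 < x) (hy : 0 < y) : 0 ≤ hardyK σ x y := by
  unfold hardyK; split_ifs <;> positivity

theorem exists_abs_diffK_le (α : ℝ) : ∃ C : ℝ, 0 ≤ C ∧ ∀ x y : ℝ, 0 < x → 0 < y →
    |diffK α x y| ≤ C * (hardyK (max 0 (α - 1)) x y + hardyK (max 0 (-α)) y x) := by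
  set a := 2 * max |1 - α| 1 + 1 with ha
  set b := 2 * max |α| 1 + 1 with hb
  have ha0 : 0 ≤ a := by positivity
  have hb0 : 0 ≤ b := by positivity
  refine ⟨a + b, by positivity, fun x y hx hy => ?_⟩
  have n1 := hardyK_nonneg (max 0 (α - 1)) hx hy
  have n2 := hardyK_nonneg (max 0 (-α)) hy hx
  rcases lt_trichotomy y x with h | h | h
  · have h1 := abs_diffK_le_of_lt α hy h
    have h2 : hardyK (max 0 (α - 1)) x y = x ^ (max 0 (α - 1) - 1) * y ^ (-max 0 (α - 1)) :=
      if_pos h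
    rw [← h2, ← ha] at h1
    nlinarith [mul_nonneg ha0 n2, mul_nonneg hb0 n1, mul_nonneg hb0 n2]
  -- On the diagonal both kernels are 0 by the convention on division by zero.
  · subst h
    simp only [diffK, kerK, sub_self, div_zero, mul_zero, inv_zero, abs_zero]
    positivity
  · have h1 := abs_diffK_le_of_lt (1 - α) hx h
    have e : 1 - α - 1 = -α := by ring
    rw [sub_sub_cancel, e] at h1
    have h2 : hardyK (max 0 (-α)) y x = y ^ (max 0 (-α) - 1) * x ^ (-max 0 (-α)) :=
      if_pos h
    rw [← h2, ← hb] at h1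
    rw [diffK_swap, abs_neg]
    nlinarith [mul_nonneg ha0 n2, mul_nonneg hb0 n1, mul_nonneg ha0 n1]

/-- By homogeneity the value does not depend on x; the hypothesis σ + c < 1 is integrability at y =
0. In `lintegral_hardyK_right` the condition σ < d plays this role at x = ∞. -/
theorem lintegral_hardyK_left {σ c x : ℝ} (hx : 0 < x) (h : σ + c < 1) :
    ∫⁻ y, ENNReal.ofReal (hardyK σ x y * (y / x) ^ (-c)) ∂halfLine =
      ENNReal.ofReal (1 / (1 - σ - c)) := by
  have e : ∫⁻ y, ENNReal.ofReal (hardyK σ x y * (y / x) ^ (-c)) ∂halfLine =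
      ∫⁻ y in Ioo 0 x, ENNReal.ofReal (x ^ (σ - 1 + c) * y ^ (-(σ + c))) := by
    rw [← lintegral_indicator measurableSet_Ioi, ← lintegral_indicator measurableSet_Ioo]
    refine lintegral_congr fun y => ?_
    by_cases hy : 0 < y
    · by_cases hyx : y < x
      · rw [indicator_of_mem (by exact hy), indicator_of_mem (by exact ⟨hy, hyx⟩), hardyK, if_pos hyx,
          Real.div_rpow hy.le hx.le, Real.rpow_neg hx.le c, div_inv_eq_mul, neg_add,
          Real.rpow_add hy, Real.rpow_add hx]
        congr 1; ring
      · rw [indicator_of_mem (by exact hy), indicator_of_notMem (fun h => hyx h.2), hardyK,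
          if_neg hyx]
        simp
    · rw [indicator_of_notMem (by exact hy), indicator_of_notMem (fun h => hy h.1)]
  have hint : IntegrableOn (fun y : ℝ => y ^ (-(σ + c))) (Ioo 0 x) :=
    (intervalIntegral.integrableOn_Ioo_rpow_iff hx).2 (by linarith)
  rw [e, ← ofReal_integral_eq_lintegral_ofReal (hint.const_mul _)]
  · congr 1
    rw [integral_const_mul, ← integral_Ioc_eq_integral_Ioo,
      ← intervalIntegral.integral_of_le hx.le, integral_rpow (Or.inl (by linarith)),
      Real.zero_rpow (by linarith), sub_zero, ← mul_div_assoc, ← Real.rpow_add hx]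
    have : σ - 1 + c + (-(σ + c) + 1) = 0 := by ring
    rw [this, Real.rpow_zero]
    congr 1; ring
  · filter_upwards [ae_restrict_mem measurableSet_Ioo] with y hy
    have := hy.1
    positivity

theorem lintegral_hardyK_right {σ d y : ℝ} (hy : 0 < y) (h : σ < d) :
    ∫⁻ x, ENNReal.ofReal (hardyK σ x y * (y / x) ^ d) ∂halfLine =
      ENNReal.ofReal (1 / (d - σ)) := by
  have e : ∫⁻ x, ENNReal.ofReal (hardyK σ x y * (y / x) ^ d) ∂halfLine =
      ∫⁻ x in Ioi y, ENNReal.ofReal (y ^ (d - σ) * x ^ (σ - 1 - d)) := by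
    rw [← lintegral_indicator measurableSet_Ioi, ← lintegral_indicator measurableSet_Ioi]
    refine lintegral_congr fun x => ?_
    by_cases hyx : y < x
    · have hx := hy.trans hyx
      rw [indicator_of_mem (by exact hx), indicator_of_mem (by exact hyx), hardyK, if_pos hyx,
          Real.div_rpow hy.le hx.le, sub_eq_add_neg d, Real.rpow_add hy, Real.rpow_sub hx (σ - 1)]
      congr 1; ring
    · rw [indicator_of_notMem (show x ∉ Ioi y from hyx)]
      simp [indicator, hardyK, hyx]
  have hint : IntegrableOn (fun x : ℝ => x ^ (σ - 1 - d)) (Ioi y) :=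
    integrableOn_Ioi_rpow_of_lt (by linarith) hy
  rw [e, ← ofReal_integral_eq_lintegral_ofReal (hint.const_mul _)]
  · congr 1
    rw [integral_const_mul, integral_Ioi_rpow_of_lt (by linarith) hy, ← mul_div_assoc, mul_neg,
      ← Real.rpow_add hy]
    have : d - σ + (σ - 1 - d + 1) = 0 := by ring
    rw [this, Real.rpow_zero, ← neg_div_neg_eq, neg_neg]
    congr 1; ring
  · filter_upwards [ae_restrict_mem measurableSet_Ioi] with x hx
    have : 0 < x := hy.trans hx
    positivity

theorem measurable_diffK (α : ℝ) : Measurable (Function.uncurry (diffK α)) := by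
  unfold diffK kerK; fun_prop

theorem ae_halfLine_pos : ∀ᵐ x ∂halfLine, 0 < x := ae_restrict_mem measurableSet_Ioi

theorem diffK_bounded {p : ℝ≥0∞} (hp1 : 1 < p) (hp : p ≠ ⊤) {α : ℝ}
    (hα : α ∈ Ioo (-(1 / p.toReal)) (2 - 1 / p.toReal)) : ∃ C : ℝ≥0, ∀ f : ℝ → ℂ,
    MemLp f p halfLine → (∀ᵐ x ∂halfLine, Integrable (fun y => diffK α x y • f y) halfLine) ∧
      MemLp (fun x => ∫ y, diffK α x y • f y ∂halfLine) p halfLine ∧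
      eLpNorm (fun x => ∫ y, diffK α x y • f y ∂halfLine) p halfLine ≤
        C * eLpNorm f p halfLine := by
  obtain ⟨C, hC0, hC⟩ := exists_abs_diffK_le α
  set r := p.toReal with hr
  have hr1 : 1 < r := one_lt_toReal hp1 hp
  have hr0 : 0 < r := by linarith
  have hri : 1 / r < 1 := by rw [div_lt_one hr0]; exact hr1
  have hri0 : 0 < 1 / r := by positivity
  set σ := max 0 (α - 1) with hσ
  set τ := max 0 (-α) with hτ
  -- The two ends of the interval for α enter here: the upper one bounds σ, the lower one bounds τ.
  have hσ1 : σ < 1 - 1 / r := max_lt (by linarith) (by linarith [hα.2])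
  have hτ1 : τ < 1 / r := max_lt hri0 (by linarith [hα.1])
  have hb : ∀ x y : ℝ, 0 < x → 0 < y → ∀ w : ℝ, 0 ≤ w →
      ‖diffK α x y‖ₑ * ENNReal.ofReal w ≤ ENNReal.ofReal C *
        (ENNReal.ofReal (hardyK σ x y * w) + ENNReal.ofReal (hardyK τ y x * w)) := by
    intro x y hx hy w hw
    have n1 := hardyK_nonneg σ hx hy
    have n2 := hardyK_nonneg τ hy hx
    rw [Real.enorm_eq_ofReal_abs, ← ENNReal.ofReal_mul (abs_nonneg _), ← ENNReal.ofReal_add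
      (by positivity) (by positivity), ← ENNReal.ofReal_mul hC0]
    apply ENNReal.ofReal_le_ofReal
    calc _ ≤ C * (hardyK σ x y + hardyK τ y x) * w := by gcongr; exact hC x y hx hy
      _ = _ := by ring
  have hmA : ∀ (g : ℝ → ℝ → ℝ), Measurable (Function.uncurry g) → ∀ x, Measurable (g x) :=
    fun g hg x => hg.comp measurable_prodMk_left
  have hmB : ∀ (g : ℝ → ℝ → ℝ), Measurable (Function.uncurry g) → ∀ y, Measurable fun x => g x y :=
    fun g hg x => hg.comp measurable_prodMk_right
  set A : ℝ≥0 := C.toNNReal * ((1 / (1 - σ - 1 / r)).toNNReal + (1 / (1 / r - τ)).toNNReal) with hA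
  have hAe : (A : ℝ≥0∞) = ENNReal.ofReal C *
      (ENNReal.ofReal (1 / (1 - σ - 1 / r)) + ENNReal.ofReal (1 / (1 / r - τ))) := by
    rw [hA]; push_cast; rfl
  refine ⟨(A ^ (r - 1) * A) ^ (1 / r), fun f hf => ?_⟩
  refine schur_kernel hp1 hp (w := fun x y => ENNReal.ofReal ((y / x) ^ (-(1 / r))))
    (measurable_diffK α) (by fun_prop) ?_ (A := A) (B := A) ?_ ?_ hf
  · filter_upwards [ae_halfLine_pos] with x hx
    filter_upwards [ae_halfLine_pos] with y hy
    refine ⟨?_, ENNReal.ofReal_ne_top⟩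
    rw [ne_eq, ENNReal.ofReal_eq_zero, not_le]
    positivity
  · filter_upwards [ae_halfLine_pos] with x hx
    calc _ ≤ ∫⁻ y, ENNReal.ofReal C * (ENNReal.ofReal (hardyK σ x y * (y / x) ^ (-(1 / r))) +
            ENNReal.ofReal (hardyK τ y x * (x / y) ^ (1 / r))) ∂halfLine := by
          refine lintegral_mono_ae ?_
          filter_upwards [ae_halfLine_pos] with y hy
          have e : (x / y) ^ (1 / r) = (y / x) ^ (-(1 / r)) := by
            rw [Real.rpow_neg (by positivity), ← Real.inv_rpow (by positivity), inv_div]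
          rw [e]
          exact hb x y hx hy _ (by positivity)
      _ = A := by
          rw [lintegral_const_mul, lintegral_add_left, lintegral_hardyK_left hx (by linarith),
            lintegral_hardyK_right hx hτ1, hAe]
          · have := hmA _ (measurable_hardyK σ) x
            fun_prop
          · have := hmA _ (measurable_hardyK σ) x
            have := hmB _ (measurable_hardyK τ) x
            fun_prop
  · filter_upwards [ae_halfLine_pos] with y hy
    calc _ ≤ ∫⁻ x, ENNReal.ofReal C * (ENNReal.ofReal (hardyK σ x y * (y / x) ^ (1 - 1 / r)) +
            ENNReal.ofReal (hardyK τ y x * (x / y) ^ (-(1 - 1 / r)))) ∂halfLine := by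
          refine lintegral_mono_ae ?_
          filter_upwards [ae_halfLine_pos] with x hx
          have e : (x / y) ^ (-(1 - 1 / r)) = (y / x) ^ (1 - 1 / r) := by
            rw [Real.rpow_neg (by positivity), ← Real.inv_rpow (by positivity), inv_div]
          -- The dual weight: (1/r)(r - 1) = 1 - 1/r.
          have e2 : ENNReal.ofReal ((y / x) ^ (-(1 / r))) ^ (-(r - 1)) =
              ENNReal.ofReal ((y / x) ^ (1 - 1 / r)) := by
            rw [ENNReal.ofReal_rpow_of_pos (by positivity), ← Real.rpow_mul (by positivity)]
            congr 2
            field_simp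
          rw [e, e2]
          exact hb x y hx hy _ (by positivity)
      _ = A := by
          rw [lintegral_const_mul, lintegral_add_left, lintegral_hardyK_right hy hσ1,
            lintegral_hardyK_left hy (by linarith), hAe]
          · congr 4 <;> ring
          · have := hmB _ (measurable_hardyK σ) y
            fun_prop
          · have := hmB _ (measurable_hardyK σ) y
            have := hmA _ (measurable_hardyK τ) y
            fun_prop

/-! ### Transfer to the half line: K_α is bounded for α in the interval. -/

theorem exists_zeroExtension (p : ℝ≥0∞) [Fact (1 ≤ p)] :
    ∃ T : LpHalf p →L[ℂ] Lp ℂ p (volume : Measure ℝ),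
      ∀ f : LpHalf p, T f =ᵐ[volume] (Ioi (0 : ℝ)).indicator f := by
  obtain ⟨T, hT, -⟩ := exists_clm_of_ae_linear (μ := halfLine) (ν := (volume : Measure ℝ)) (p := p)
    (fun f => (Ioi (0 : ℝ)).indicator f) 1
    (fun f hf => (memLp_indicator_iff_restrict measurableSet_Ioi).2 hf)
    (fun f hf => by simp [eLpNorm_indicator_eq_eLpNorm_restrict measurableSet_Ioi])
    (fun f g _ _ => by rw [indicator_add'])
    (fun c f _ => Eventually.of_forall fun x => by simp [indicator])
    (fun f g h => by
      have := (ae_restrict_iff' measurableSet_Ioi).1 h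
      filter_upwards [this] with x hx
      by_cases hx0 : x ∈ Ioi (0 : ℝ)
      · rw [indicator_of_mem hx0, indicator_of_mem hx0, hx hx0]
      · rw [indicator_of_notMem hx0, indicator_of_notMem hx0])
  exact ⟨T, hT⟩

theorem exists_restriction (p : ℝ≥0∞) [Fact (1 ≤ p)] :
    ∃ T : Lp ℂ p (volume : Measure ℝ) →L[ℂ] LpHalf p,
      ∀ f : Lp ℂ p (volume : Measure ℝ), T f =ᵐ[halfLine] f := by
  obtain ⟨T, hT, -⟩ := exists_clm_of_ae_linear (μ := (volume : Measure ℝ)) (ν := halfLine) (p := p)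
    (fun f => f) 1 (fun f hf => hf.restrict _)
    (fun f hf => by simpa using eLpNorm_mono_measure f Measure.restrict_le_self)
    (fun f g _ _ => EventuallyEq.rfl) (fun c f _ => EventuallyEq.rfl)
    (fun f g h => ae_restrict_of_ae h)
  exact ⟨T, hT⟩

theorem measurableSet_truncDom (x ε : ℝ) : MeasurableSet (truncDom x ε) :=
  (measurableSet_lt measurable_const measurable_id).inter
    (measurableSet_lt measurable_const (by fun_prop : Measurable fun y : ℝ => |x - y|))

/-- Integrals over the truncated domains converge to the full integral. -/
theorem tendsto_integral_truncDom {E : Type*} [NormedAddCommGroup E] [NormedSpace ℝ E] {g : ℝ → E}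
    (hg : Integrable g halfLine) (x : ℝ) :
    Tendsto (fun ε => ∫ y in truncDom x ε, g y) (𝓝[>] 0) (𝓝 (∫ y, g y ∂halfLine)) := by
  have e : ∀ ε, ∫ y in truncDom x ε, g y = ∫ y, (truncDom x ε).indicator g y ∂halfLine := by
    intro ε
    rw [integral_indicator (measurableSet_truncDom x ε), halfLine,
      Measure.restrict_restrict (measurableSet_truncDom x ε), inter_eq_left.2 (fun y hy => hy.1)]
  simp_rw [e]
  refine tendsto_integral_filter_of_dominated_convergence (fun y => ‖g y‖) ?_ ?_ hg.norm ?_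
  · exact Eventually.of_forall fun ε => hg.1.indicator (measurableSet_truncDom x ε)
  · exact Eventually.of_forall fun ε => Eventually.of_forall fun y => norm_indicator_le_norm_self _ _
  · have hne : ∀ᵐ y ∂halfLine, y ≠ x := ae_restrict_of_ae (by simp [ae_iff])
    filter_upwards [ae_halfLine_pos, hne] with y hy hyx
    refine tendsto_const_nhds.congr' ?_
    have h0 : 0 < |x - y| := abs_pos.2 (sub_ne_zero.2 hyx.symm)
    filter_upwards [Ioo_mem_nhdsGT h0] with ε hε
    rw [indicator_of_mem (by exact ⟨hy, hε.2⟩)]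

/-- `K_α` is bounded for `α` in the critical interval. -/
theorem exists_isOpK {p : ℝ≥0∞} [Fact (1 ≤ p)] (hp1 : 1 < p) (hp : p ≠ ⊤) {α : ℝ}
    (hα : α ∈ Ioo (-(1 / p.toReal)) (2 - 1 / p.toReal)) :
    ∃ T : LpHalf p →L[ℂ] LpHalf p, IsOpK p α T := by
  obtain ⟨C, hC⟩ := diffK_bounded hp1 hp hα
  obtain ⟨H, hH⟩ := exists_hilbertTransform hp1 hp
  obtain ⟨E, hE⟩ := exists_zeroExtension p
  obtain ⟨R, hR⟩ := exists_restriction p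
  obtain ⟨N, hN, -⟩ := exists_clm_of_kernel (μ := halfLine) (ν := halfLine) (p := p) (diffK α) C
    (fun f hf => by simpa using (hC f hf).1) (fun f hf => by simpa using (hC f hf).2.1)
    (fun f hf => by simpa using (hC f hf).2.2)
  -- Hilbert transform of the zero extension, restricted to the half line, plus the absolutely
  -- convergent operator with kernel `diffK α`. Only the first summand needs a principal value.
  refine ⟨R.comp (H.comp E) + N, fun f => ?_⟩
  filter_upwards [ae_halfLine_pos, (hC f (Lp.memLp f)).1, hN f, hR (H (E f)),
    ae_restrict_of_ae (hH (E f)), Lp.coeFn_add (R (H (E f))) (N f)] with x hx h1 h2 h3 h4 h5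
  have e1 : (R.comp (H.comp E) + N) f x = H (E f) x + ∫ y, diffK α x y • f y ∂halfLine := by
    change ((R (H (E f)) + N f : LpHalf p) : ℝ → ℂ) x = _
    rw [h5, Pi.add_apply, h3, h2]
    simp
  have e2 : ∀ ε, (fun t => truncK ε (x - t) • E f t) =ᵐ[volume]
      (truncDom x ε).indicator fun t => (Real.pi * (x - t))⁻¹ • f t := by
    intro ε
    filter_upwards [hE f] with t ht
    rw [ht, truncK]
    by_cases h0 : t ∈ Ioi (0 : ℝ)
    · rw [indicator_of_mem h0]
      by_cases hε : x - t ∈ {u : ℝ | ε < |u|}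
      · rw [indicator_of_mem hε, indicator_of_mem (show t ∈ truncDom x ε from ⟨h0, hε⟩)]
      · rw [indicator_of_notMem hε, indicator_of_notMem (fun h => hε h.2), zero_smul]
    · rw [indicator_of_notMem h0, smul_zero, indicator_of_notMem (fun h => h0 h.1)]
  have i1 : ∀ ε, 0 < ε → IntegrableOn (fun t => (Real.pi * (x - t))⁻¹ • f t) (truncDom x ε) := by
    intro ε hε
    rw [← integrable_indicator_iff (measurableSet_truncDom x ε)]
    exact (h4.1 ε hε).congr (e2 ε)
  have i2 : ∀ ε, IntegrableOn (fun t => diffK α x t • f t) (truncDom x ε) := fun ε =>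
    IntegrableOn.mono_set (t := Ioi 0) h1 fun y hy => hy.1
  have e3 : ∀ t, (kerK α x t : ℂ) * f t = (Real.pi * (x - t))⁻¹ • f t + diffK α x t • f t := by
    intro t
    rw [← add_smul, diffK, add_sub_cancel, Complex.real_smul]
  refine ⟨fun ε hε => ?_, ?_⟩
  · simp_rw [e3]
    exact (i1 ε hε).add (i2 ε)
  · rw [e1]
    refine (h4.2.add (tendsto_integral_truncDom h1 x)).congr' ?_
    filter_upwards [self_mem_nhdsWithin] with ε hε
    simp_rw [e3]
    rw [integral_add (i1 ε hε) (i2 ε)]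
    congr 1
    rw [← integral_indicator (measurableSet_truncDom x ε), ← integral_congr_ae (e2 ε)]
    rfl

theorem truncDom_subset (x ε : ℝ) : truncDom x ε ⊆ Ioi 0 := fun _ hy => hy.1

theorem HasPV.congr_ae {α x : ℝ} {f g : ℝ → ℂ} {v : ℂ} (h : HasPV α f x v)
    (hfg : f =ᵐ[halfLine] g) : HasPV α g x v := by
  have hae : ∀ ε, (fun y => (kerK α x y : ℂ) * f y) =ᵐ[volume.restrict (truncDom x ε)]
      fun y => (kerK α x y : ℂ) * g y := by
    intro ε
    have : ∀ᵐ y ∂(volume.restrict (truncDom x ε)), f y = g y :=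
      ae_mono (Measure.restrict_mono (truncDom_subset x ε) le_rfl) hfg
    filter_upwards [this] with y hy
    rw [hy]
  refine ⟨fun ε hε => (h.1 ε hε).congr (hae ε), ?_⟩
  simp_rw [← fun ε => integral_congr_ae (hae ε)]
  exact h.2

theorem testBoundK_of_isOpK {p : ℝ≥0∞} [Fact (1 ≤ p)] {α : ℝ} {T : LpHalf p →L[ℂ] LpHalf p}
    (hT : IsOpK p α T) : TestBoundK p α := by
  refine ⟨‖T‖₊, fun f hf => ?_⟩
  have hfp : MemLp f p halfLine :=
    (hf.1.continuous.memLp_of_hasCompactSupport hf.2.1).restrict _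
  refine ⟨T (hfp.toLp f), Lp.memLp _, ?_, ?_⟩
  · filter_upwards [hT (hfp.toLp f)] with x hx
    exact hx.congr_ae hfp.coeFn_toLp
  · have h := T.le_opENorm (hfp.toLp f)
    rw [Lp.enorm_def, Lp.enorm_def, eLpNorm_congr_ae hfp.coeFn_toLp] at h
    exact h

/-! ### Necessity: the image of a bump near 0 and near infinity. -/

/-- A bump function supported in `(0, ∞)`. -/
noncomputable def testBump : ContDiffBump (2 : ℝ) := ⟨1 / 2, 1, by norm_num, by norm_num⟩

theorem isTestFun_testBump : IsTestFun fun x => (testBump x : ℂ) := by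
  have hts : tsupport (fun x => (testBump x : ℂ)) ⊆ Metric.closedBall 2 1 := by
    have := testBump.tsupport_eq
    rw [show testBump.rOut = 1 from rfl] at this
    rw [← this]
    exact tsupport_comp_subset Complex.ofReal_zero _
  refine ⟨Complex.ofRealCLM.contDiff.comp testBump.contDiff, ?_, ?_⟩
  · exact (isCompact_closedBall (2 : ℝ) 1).of_isClosed_subset (isClosed_tsupport _) hts
  · refine hts.trans fun y hy => ?_
    rw [Metric.mem_closedBall, Real.dist_eq, abs_le] at hy
    exact (by linarith [hy.1] : (0 : ℝ) < y)

theorem testBump_eq_one {y : ℝ} (hy : y ∈ Icc (3 / 2 : ℝ) (5 / 2)) : testBump y = 1 := by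
  apply testBump.one_of_mem_closedBall
  rw [Metric.mem_closedBall, Real.dist_eq, abs_le]
  change -(1 / 2) ≤ y - 2 ∧ y - 2 ≤ 1 / 2
  constructor <;> linarith [hy.1, hy.2]

theorem testBump_eq_zero {y : ℝ} (hy : ¬ (1 < y ∧ y < 3)) : testBump y = 0 := by
  apply testBump.zero_of_le_dist
  change 1 ≤ _
  rw [Real.dist_eq, le_abs]
  by_contra! h
  exact hy ⟨by linarith [h.2], by linarith [h.1]⟩

/-- The sign κ makes the kernel nonnegative on the support, so the integral is at least its part
over [3/2, 5/2], where the bump is 1. That interval has length 1 and, by `hx`, survives every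
truncation with ε < 1/2. -/
theorem le_norm_of_hasPV_testBump {α x κ c : ℝ} {v : ℂ}
    (h : HasPV α (fun x => (testBump x : ℂ)) x v) (hκ : |κ| = 1)
    (hx : ∀ y ∈ Icc (3 / 2 : ℝ) (5 / 2), 1 / 2 ≤ |x - y|)
    (h0 : ∀ y, 1 < y → y < 3 → 0 ≤ κ * kerK α x y)
    (hc : ∀ y ∈ Icc (3 / 2 : ℝ) (5 / 2), c ≤ κ * kerK α x y) : c ≤ ‖v‖ := by
  have lim := (h.2.const_mul (κ : ℂ))
  have lim2 := (Complex.continuous_re.tendsto _).comp lim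
  have hv : (κ * v : ℂ).re ≤ ‖v‖ := by
    refine (Complex.re_le_norm _).trans ?_
    rw [norm_mul, Complex.norm_real, Real.norm_eq_abs, hκ, one_mul]
  refine le_trans (ge_of_tendsto lim2 ?_) hv
  filter_upwards [Ioo_mem_nhdsGT (by norm_num : (0 : ℝ) < 1 / 2)] with ε hε
  have hi := h.1 ε hε.1
  have hre : IntegrableOn (fun y => κ * (kerK α x y * testBump y)) (truncDom x ε) := by
    have h1 : Integrable (fun y => κ * ((kerK α x y : ℂ) * (testBump y : ℂ)).re)
        (volume.restrict (truncDom x ε)) := (Complex.reCLM.integrable_comp hi).const_mul κ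
    simp only [Complex.re_ofReal_mul, Complex.ofReal_re] at h1
    exact h1
  have e : (κ * ∫ y in truncDom x ε, (kerK α x y : ℂ) * (testBump y : ℂ)).re =
      ∫ y in truncDom x ε, κ * (kerK α x y * testBump y) := by
    rw [integral_const_mul, Complex.re_ofReal_mul, ← Complex.reCLM_apply,
      ← Complex.reCLM.integral_comp_comm hi]
    simp
  rw [Function.comp, e]
  have hsub : Icc (3 / 2 : ℝ) (5 / 2) ⊆ truncDom x ε := fun y hy =>
    ⟨by linarith [hy.1], hε.2.trans_le (hx y hy)⟩
  have hnn : ∀ y, 0 ≤ κ * (kerK α x y * testBump y) := by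
    intro y
    by_cases hy : 1 < y ∧ y < 3
    · rw [← mul_assoc]; exact mul_nonneg (h0 y hy.1 hy.2) testBump.nonneg
    · rw [testBump_eq_zero hy, mul_zero, mul_zero]
  calc c = c * volume.real (Icc (3 / 2 : ℝ) (5 / 2)) := by
        rw [Real.volume_real_Icc]; norm_num
    _ ≤ ∫ y in Icc (3 / 2 : ℝ) (5 / 2), κ * (kerK α x y * testBump y) := by
        refine setIntegral_ge_of_const_le_real measurableSet_Icc (by simp) (fun y hy => ?_)
          (hre.mono_set hsub)
        rw [testBump_eq_one hy, mul_one]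
        exact hc y hy
    _ ≤ _ := setIntegral_mono_set hre (Eventually.of_forall hnn) hsub.eventuallyLE

theorem rpow_lower_bound (s : ℝ) {y : ℝ} (hy : y ∈ Icc (3 / 2 : ℝ) (5 / 2)) :
    (5 / 2 : ℝ) ^ (-|s|) ≤ y ^ s := by
  have h1 : (1 : ℝ) ≤ y := by linarith [hy.1]
  calc (5 / 2 : ℝ) ^ (-|s|) ≤ y ^ (-|s|) :=
        Real.rpow_le_rpow_of_nonpos (by linarith) hy.2 (by simp)
    _ ≤ y ^ s := Real.rpow_le_rpow_of_exponent_le h1 (neg_abs_le s)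

/-- One bump function decides: the lower bounds on its image make a power of x integrable near 0 and
another near infinity. -/
theorem mem_Ioo_of_testBoundK {p : ℝ≥0∞} (hp1 : 1 < p) (hp : p ≠ ⊤) {α : ℝ}
    (h : TestBoundK p α) : α ∈ Ioo (-(1 / p.toReal)) (2 - 1 / p.toReal) := by
  obtain ⟨C, hC⟩ := h
  obtain ⟨g, hg, hpv, -⟩ := hC _ isTestFun_testBump
  have hp0 : p ≠ 0 := (zero_lt_one.trans hp1).ne'
  set r := p.toReal with hr
  have hr1 : 1 < r := one_lt_toReal hp1 hp
  have hr0 : 0 < r := by linarith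
  have hpi := Real.pi_pos
  set m : ℝ := (5 / 2 : ℝ) ^ (-|1 - α|) with hm
  have hm0 : 0 < m := by positivity
  have hgi : IntegrableOn (fun x => ‖g x‖ ^ r) (Ioi 0) := hg.integrable_norm_rpow hp0 hp
  have key : ∀ (S : Set ℝ) (b c : ℝ), MeasurableSet S → S ⊆ Ioi 0 → 0 < c →
      (∀ x ∈ S, ∀ v, HasPV α (fun x => (testBump x : ℂ)) x v → c * x ^ b ≤ ‖v‖) →
      IntegrableOn (fun x => x ^ (b * r)) S := by
    intro S b c hS hS0 hc hle
    have h1 : IntegrableOn (fun x => (c ^ r)⁻¹ * ‖g x‖ ^ r) S := (hgi.mono_set hS0).const_mul _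
    refine h1.mono' (by fun_prop) ?_
    have h2 : ∀ᵐ x ∂volume.restrict S, HasPV α (fun x => (testBump x : ℂ)) x (g x) :=
      ae_mono (Measure.restrict_mono hS0 le_rfl) hpv
    filter_upwards [h2, ae_restrict_mem hS] with x hx hxS
    have hx0 : 0 < x := hS0 hxS
    rw [Real.norm_of_nonneg (by positivity), ← div_eq_inv_mul, le_div_iff₀ (by positivity),
      Real.rpow_mul hx0.le, ← Real.mul_rpow (by positivity) hc.le, mul_comm]
    gcongr
    exact hle x hxS _ hx
  constructor
  -- For x < 1 the kernel is negative on the support, hence κ = -1. The denominator y² - x² is at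
  -- most 25/4, so 9 is a safe bound, and the image is at least a multiple of x^α.
  · have h1 := key (Ioo 0 1) α (2 / Real.pi * (m / 9)) measurableSet_Ioo (fun x hx => hx.1)
      (by positivity) (fun x hx v hv => by
        refine le_norm_of_hasPV_testBump (κ := -1) hv (by simp) ?_ ?_ ?_
        · intro y hy
          rw [abs_of_nonpos (by linarith [hx.2, hy.1])]
          linarith [hx.2, hy.1]
        · intro y hy1 hy3
          have hx0 := hx.1
          have hd : 0 < y ^ 2 - x ^ 2 := by nlinarith [hx.1, hx.2]
          rw [kerK, ← neg_sub (y ^ 2), div_neg]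
          have : 0 < y := by linarith
          have h3 : 0 ≤ 2 / Real.pi * (x ^ α * y ^ (1 - α) / (y ^ 2 - x ^ 2)) := by positivity
          linarith
        · intro y hy
          have hx0 := hx.1
          have hy0 : 0 < y := by linarith [hy.1]
          have hd : 0 < y ^ 2 - x ^ 2 := by nlinarith [hx.1, hx.2, hy.1]
          have hd9 : y ^ 2 - x ^ 2 ≤ 9 := by nlinarith [hx.1, hx.2, hy.1, hy.2]
          rw [kerK, ← neg_sub (y ^ 2), div_neg, mul_neg, neg_one_mul, neg_neg, mul_assoc]
          gcongr
          rw [div_mul_eq_mul_div, mul_comm m]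
          gcongr
          exact rpow_lower_bound _ hy)
    have h2 := (intervalIntegral.integrableOn_Ioo_rpow_iff one_pos).1 h1
    rw [← neg_div, div_lt_iff₀ hr0]
    linarith
  -- For x > 4 the denominator lies in (0, x²], so the image is at least a multiple of x^(α-2).
  · have h1 := key (Ioi 4) (α - 2) (2 / Real.pi * m) measurableSet_Ioi
      (fun x hx => (by norm_num : (0 : ℝ) < 4).trans hx)
      (by positivity) (fun x hx v hv => by
        have hx4 : 4 < x := hx
        have hx0 : 0 < x := by linarith
        refine le_norm_of_hasPV_testBump (κ := 1) hv (by simp) ?_ ?_ ?_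
        · intro y hy
          rw [abs_of_nonneg (by linarith [hy.2])]
          linarith [hy.2]
        · intro y hy1 hy3
          have hd : 0 < x ^ 2 - y ^ 2 := by nlinarith
          have : 0 < y := by linarith
          rw [kerK]
          positivity
        · intro y hy
          have hy0 : 0 < y := by linarith [hy.1]
          have hd : 0 < x ^ 2 - y ^ 2 := by nlinarith [hy.2]
          rw [kerK, one_mul, mul_assoc]
          gcongr
          rw [Real.rpow_sub hx0, Real.rpow_two, ← mul_div_assoc, mul_comm m]
          gcongr
          · exact rpow_lower_bound _ hy
          · nlinarith)
    have h2 := (integrableOn_Ioi_rpow_iff (by norm_num : (0 : ℝ) < 4)).1 h1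
    rw [lt_sub_iff_add_lt, ← lt_sub_iff_add_lt', div_lt_iff₀ hr0]
    linarith

theorem exists_isOpK_iff {p : ℝ≥0∞} [Fact (1 ≤ p)] (hp1 : 1 < p) (hp : p ≠ ⊤) (α : ℝ) :
    (∃ T : LpHalf p →L[ℂ] LpHalf p, IsOpK p α T) ↔
      α ∈ Ioo (-(1 / p.toReal)) (2 - 1 / p.toReal) :=
  ⟨fun ⟨_, hT⟩ => mem_Ioo_of_testBoundK hp1 hp (testBoundK_of_isOpK hT), exists_isOpK hp1 hp⟩

theorem testBoundK_iff {p : ℝ≥0∞} [Fact (1 ≤ p)] (hp1 : 1 < p) (hp : p ≠ ⊤) (α : ℝ) :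
    TestBoundK p α ↔ α ∈ Ioo (-(1 / p.toReal)) (2 - 1 / p.toReal) :=
  ⟨mem_Ioo_of_testBoundK hp1 hp, fun h =>
    let ⟨_, hT⟩ := exists_isOpK hp1 hp h
    testBoundK_of_isOpK hT⟩

/-! ### Mellin integrals. -/

/-- A nonzero value of the Bochner integral certifies integrability, since the integral of a
non-integrable function is 0 by convention. -/
theorem lintegral_ofReal_eq_of_integral_eq {Ω : Type*} [MeasurableSpace Ω] {μ : Measure Ω}
    {f : Ω → ℝ} {c : ℝ} (hc : c ≠ 0) (hf : 0 ≤ᵐ[μ] f) (h : ∫ x, f x ∂μ = c) :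
    ∫⁻ x, ENNReal.ofReal (f x) ∂μ = ENNReal.ofReal c := by
  have hi : Integrable f μ := by
    by_contra hn
    exact hc (h.symm.trans (integral_undef hn))
  rw [← ofReal_integral_eq_lintegral_ofReal hi hf, h]

theorem integrable_and_integral_eq_of_lintegral_ofReal {Ω : Type*} [MeasurableSpace Ω]
    {μ : Measure Ω} {f : Ω → ℝ} {c : ℝ} (hc : 0 ≤ c) (hf : 0 ≤ᵐ[μ] f)
    (hm : AEStronglyMeasurable f μ) (h : ∫⁻ x, ENNReal.ofReal (f x) ∂μ = ENNReal.ofReal c) :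
    Integrable f μ ∧ ∫ x, f x ∂μ = c := by
  refine ⟨⟨hm, (hasFiniteIntegral_iff_ofReal hf).2 (by rw [h]; exact ENNReal.ofReal_lt_top)⟩, ?_⟩
  rw [integral_eq_lintegral_of_nonneg_ae hf hm, h, ENNReal.toReal_ofReal hc]

/-- The Mellin transform of `y ↦ 1 / (y ^ 2 + z)`. -/
theorem mellin_inv_sq_add {a z : ℝ} (ha0 : 0 < a) (ha2 : a < 2) (hz : 0 < z) :
    IntegrableOn (fun y : ℝ => y ^ (a - 1) / (y ^ 2 + z)) (Ioi 0) ∧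
    ∫ y in Ioi (0 : ℝ), y ^ (a - 1) / (y ^ 2 + z) =
      Real.pi / 2 * z ^ (a / 2 - 1) / Real.sin (Real.pi * (a / 2)) := by
  have hs : 0 < Real.sin (Real.pi * (a / 2)) :=
    Real.sin_pos_of_pos_of_lt_pi (by positivity) (by nlinarith [Real.pi_pos])
  have hG1 : 0 < Real.Gamma (a / 2) := Real.Gamma_pos_of_pos (by positivity)
  have hG2 : 0 < Real.Gamma (1 - a / 2) := Real.Gamma_pos_of_pos (by linarith)
  refine integrable_and_integral_eq_of_lintegral_ofReal (by positivity) ?_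
    (Measurable.aestronglyMeasurable (by fun_prop)) ?_
  · filter_upwards [ae_restrict_mem measurableSet_Ioi] with y hy
    have hy : 0 < y := hy
    simp only [Pi.zero_apply]
    positivity
  -- 1/(y² + z) is written as the integral of exp(-u(y² + z)) over u > 0. After Tonelli both
  -- integrals are Gamma integrals, and Γ(a/2) Γ(1 - a/2) gives the sine by the reflection formula.
  have e1 : ∀ y ∈ Ioi (0 : ℝ), ENNReal.ofReal (y ^ (a - 1) / (y ^ 2 + z)) =
      ∫⁻ u in Ioi (0 : ℝ), ENNReal.ofReal (y ^ (a - 1) * Real.exp (-(u * (y ^ 2 + z)))) := by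
    intro y hy
    have hy : 0 < y := hy
    have h1 := Real.integral_rpow_mul_exp_neg_mul_Ioi one_pos (by positivity : 0 < y ^ 2 + z)
    refine (lintegral_ofReal_eq_of_integral_eq (by positivity)
      (ae_of_all _ fun u => by simp only [Pi.zero_apply]; positivity) ?_).symm
    rw [integral_const_mul, div_eq_mul_inv]
    congr 1
    simp only [sub_self, Real.rpow_zero, one_mul, Real.rpow_one, Real.Gamma_one, mul_one] at h1
    rw [← one_div, ← h1]
    simp only [mul_comm]
  have e2 : ∀ u ∈ Ioi (0 : ℝ),
      ∫⁻ y in Ioi (0 : ℝ), ENNReal.ofReal (y ^ (a - 1) * Real.exp (-(u * (y ^ 2 + z)))) =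
      ENNReal.ofReal ((1 / 2 * Real.Gamma (a / 2)) *
        (u ^ ((1 - a / 2) - 1) * Real.exp (-(z * u)))) := by
    intro u hu
    have hu : 0 < u := hu
    have h1 := integral_rpow_mul_exp_neg_mul_rpow (p := 2) (q := a - 1) two_pos (by linarith) hu
    refine lintegral_ofReal_eq_of_integral_eq (by positivity) ?_ ?_
    · filter_upwards [ae_restrict_mem measurableSet_Ioi] with y hy
      have hy : 0 < y := hy
      simp only [Pi.zero_apply]
      positivity
    · have h2 : ∀ y ∈ Ioi (0 : ℝ), y ^ (a - 1) * Real.exp (-(u * (y ^ 2 + z))) =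
          y ^ (a - 1) * Real.exp (-u * y ^ (2 : ℝ)) * Real.exp (-(z * u)) := by
        intro y _
        rw [mul_assoc, ← Real.exp_add, Real.rpow_two]
        congr 2
        ring
      rw [setIntegral_congr_fun measurableSet_Ioi h2, integral_mul_const, h1]
      rw [show -(a - 1 + 1) / 2 = 1 - a / 2 - 1 by ring, show (a - 1 + 1) / 2 = a / 2 by ring]
      ring
  rw [setLIntegral_congr_fun measurableSet_Ioi e1, lintegral_lintegral_swap
    (Measurable.aemeasurable (by fun_prop)), setLIntegral_congr_fun measurableSet_Ioi e2]
  refine lintegral_ofReal_eq_of_integral_eq (by positivity) ?_ ?_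
  · filter_upwards [ae_restrict_mem measurableSet_Ioi] with y hy
    have hy : 0 < y := hy
    simp only [Pi.zero_apply]
    positivity
  · rw [integral_const_mul,
      Real.integral_rpow_mul_exp_neg_mul_Ioi (by linarith : 0 < 1 - a / 2) hz, one_div z,
      Real.inv_rpow hz.le, ← Real.rpow_neg hz.le, neg_sub]
    calc _ = 1 / 2 * z ^ (a / 2 - 1) * (Real.Gamma (a / 2) * Real.Gamma (1 - a / 2)) := by ring
      _ = _ := by rw [Real.Gamma_mul_Gamma_one_sub]; ring

theorem integrableOn_rpow_sub_one_div {s : ℝ} (hs : -1 < s) :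
    IntegrableOn (fun t : ℝ => (t ^ s - 1) / (1 - t ^ 2)) (Ioo 0 1) := by
  have h1 : IntegrableOn (fun t : ℝ => max |s| 1 * (1 + t ^ s)) (Ioo 0 1) := by
    refine Integrable.const_mul (Integrable.add (by simp) ?_) _
    exact (intervalIntegral.integrableOn_Ioo_rpow_iff one_pos).2 hs
  refine h1.mono' (Measurable.aestronglyMeasurable (by fun_prop)) ?_
  filter_upwards [ae_restrict_mem measurableSet_Ioo] with t ht
  have h2 := abs_rpow_sub_one_le s ht.1 ht.2
  have h3 : 0 < 1 - t ^ 2 := by nlinarith [ht.1, ht.2]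
  have h4 : 0 < t ^ s := Real.rpow_pos_of_pos ht.1 s
  have h5 : (0 : ℝ) < max |s| 1 := lt_max_of_lt_right one_pos
  rw [norm_div, Real.norm_eq_abs, Real.norm_eq_abs, abs_of_pos h3, div_le_iff₀ h3]
  refine h2.trans ?_
  have h6 : max 1 (t ^ s) ≤ 1 + t ^ s := max_le (by linarith) (by linarith)
  have h7 : 1 - t ≤ 1 - t ^ 2 := by nlinarith [ht.1, ht.2]
  calc _ ≤ max |s| 1 * (1 - t ^ 2) * (1 + t ^ s) := by
        gcongr
    _ = _ := by ring

/-- Geometric expansion of 1/(1 - t²), integrated termwise. Each term has constant sign on (0, 1),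
so its L_1 norm is the modulus of its integral, which is O(n⁻²). -/
theorem hasSum_integral_rpow_sub_one_div {s : ℝ} (hs : -1 < s) :
    HasSum (fun n : ℕ => (1 / (2 * n + s + 1) - 1 / (2 * n + 1) : ℝ))
      (∫ t in Ioo (0 : ℝ) 1, (t ^ s - 1) / (1 - t ^ 2)) := by
  have hI : ∀ r : ℝ, -1 < r → IntegrableOn (fun t : ℝ => t ^ r) (Ioo 0 1) ∧
      ∫ t in Ioo (0 : ℝ) 1, t ^ r = 1 / (r + 1) := by
    intro r hr
    refine ⟨(intervalIntegral.integrableOn_Ioo_rpow_iff one_pos).2 hr, ?_⟩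
    rw [← integral_Ioc_eq_integral_Ioo, ← intervalIntegral.integral_of_le zero_le_one,
      integral_rpow (Or.inl hr), Real.one_rpow, Real.zero_rpow (by linarith), sub_zero]
  set F : ℕ → ℝ → ℝ := fun n t => t ^ (2 * n + s : ℝ) - t ^ (2 * n : ℝ) with hF
  have hn : ∀ n : ℕ, (0 : ℝ) ≤ n := fun n => n.cast_nonneg
  have hFi : ∀ n, IntegrableOn (F n) (Ioo 0 1) := fun n =>
    (hI _ (by linarith [hn n])).1.sub (hI _ (by linarith [hn n])).1
  have hFv : ∀ n, ∫ t in Ioo (0 : ℝ) 1, F n t = 1 / (2 * n + s + 1) - 1 / (2 * n + 1) := by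
    intro n
    rw [hF, integral_sub (hI _ (by linarith [hn n])).1 (hI _ (by linarith [hn n])).1,
      (hI _ (by linarith [hn n])).2, (hI _ (by linarith [hn n])).2]
  have hFe : ∀ n, ∀ t ∈ Ioo (0 : ℝ) 1, F n t = (t ^ s - 1) * (t ^ 2) ^ n := by
    intro n t ht
    simp only [hF]
    rw [Real.rpow_add ht.1, Real.rpow_mul ht.1.le, Real.rpow_two, Real.rpow_natCast]
    ring
  have hnorm : ∀ n, ∫ t in Ioo (0 : ℝ) 1, ‖F n t‖ = |1 / (2 * n + s + 1) - 1 / (2 * n + 1)| := by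
    intro n
    rw [← hFv n]
    rcases le_total 0 s with h | h
    · have h1 : ∀ t ∈ Ioo (0 : ℝ) 1, F n t ≤ 0 := by
        intro t ht
        rw [hFe n t ht]
        exact mul_nonpos_of_nonpos_of_nonneg
          (by linarith [Real.rpow_le_one ht.1.le ht.2.le h]) (by positivity)
      rw [abs_of_nonpos (setIntegral_nonpos measurableSet_Ioo h1), ← integral_neg]
      exact setIntegral_congr_fun measurableSet_Ioo fun t ht => by
        rw [Real.norm_eq_abs, abs_of_nonpos (h1 t ht)]
    · have h1 : ∀ t ∈ Ioo (0 : ℝ) 1, 0 ≤ F n t := by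
        intro t ht
        rw [hFe n t ht]
        exact mul_nonneg
          (by linarith [Real.one_le_rpow_of_pos_of_le_one_of_nonpos ht.1 ht.2.le h])
          (by positivity)
      rw [abs_of_nonneg (setIntegral_nonneg measurableSet_Ioo h1)]
      exact setIntegral_congr_fun measurableSet_Ioo fun t ht => by
        rw [Real.norm_eq_abs, abs_of_nonneg (h1 t ht)]
  have hsum : Summable fun n : ℕ => ∫ t in Ioo (0 : ℝ) 1, ‖F n t‖ := by
    simp only [hnorm]
    rw [← summable_nat_add_iff 1]
    have h1 : Summable fun n : ℕ => |s| * (1 / ((n + 1 : ℕ) : ℝ) ^ 2) :=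
      ((summable_nat_add_iff 1 (f := fun n : ℕ => 1 / (n : ℝ) ^ 2)).2
        (Real.summable_one_div_nat_pow.2 one_lt_two)).mul_left _
    refine Summable.of_nonneg_of_le (fun n => abs_nonneg _) (fun n => ?_) h1
    push_cast
    have h2 : 0 < 2 * ((n : ℝ) + 1) + s + 1 := by linarith [hn n]
    have h3 : 0 < 2 * ((n : ℝ) + 1) + 1 := by linarith [hn n]
    have h4 : 1 / (2 * ((n : ℝ) + 1) + s + 1) - 1 / (2 * ((n : ℝ) + 1) + 1) =
        -s / ((2 * ((n : ℝ) + 1) + s + 1) * (2 * ((n : ℝ) + 1) + 1)) := by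
      field_simp
      ring
    rw [h4, abs_div, abs_neg, abs_of_pos (mul_pos h2 h3), div_eq_mul_one_div |s|]
    have h5 : 0 < (n : ℝ) + 1 := by linarith [hn n]
    gcongr
    nlinarith
  have := hasSum_integral_of_summable_integral_norm hFi hsum
  simp only [hFv] at this
  have hv : ∀ t ∈ Ioo (0 : ℝ) 1, (t ^ s - 1) / (1 - t ^ 2) = ∑' n, F n t := by
    intro t ht
    rw [tsum_congr (fun n => hFe n t ht), tsum_mul_left,
      tsum_geometric_of_lt_one (by positivity) (by nlinarith [ht.1, ht.2]), div_eq_mul_inv]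
  rwa [setIntegral_congr_fun measurableSet_Ioo hv]

theorem integral_Ioi_comp_inv (g : ℝ → ℝ) :
    ∫ t in Ioi (0 : ℝ), (t ^ 2)⁻¹ * g t⁻¹ = ∫ t in Ioi (0 : ℝ), g t := by
  rw [← integral_comp_rpow_Ioi g (neg_ne_zero.2 one_ne_zero)]
  refine setIntegral_congr_fun measurableSet_Ioi fun t ht => ?_
  have ht : 0 < t := ht
  simp only [abs_neg, abs_one, one_mul, smul_eq_mul]
  rw [Real.rpow_neg_one, show (-1 - 1 : ℝ) = -2 by norm_num, Real.rpow_neg ht.le, Real.rpow_two]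

theorem integrableOn_Ioi_comp_inv_iff (g : ℝ → ℝ) :
    IntegrableOn (fun t => (t ^ 2)⁻¹ * g t⁻¹) (Ioi 0) ↔ IntegrableOn g (Ioi 0) := by
  rw [← integrableOn_Ioi_comp_rpow_iff g (neg_ne_zero.2 one_ne_zero)]
  refine integrableOn_congr_fun (fun t ht => ?_) measurableSet_Ioi
  have ht : 0 < t := ht
  simp only [abs_neg, abs_one, one_mul, smul_eq_mul]
  rw [Real.rpow_neg_one, show (-1 - 1 : ℝ) = -2 by norm_num, Real.rpow_neg ht.le, Real.rpow_two]

/-- The partial fraction series of π cot(πx) at x = a/2. Its terms pair 1/(x - (n+1)) with 1/(x +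
(n+1)); adding the telescoping series of 1/(x+n) - 1/(x+n+1), with sum 1/x, shifts the pairing to
the one needed. -/
theorem hasSum_cot_of_pos {a : ℝ} (ha0 : 0 < a) (ha2 : a < 2) :
    HasSum (fun n : ℕ => (1 / (2 * n + a) - 1 / (2 * n + 2 - a) : ℝ))
      (Real.pi / 2 * Real.cot (Real.pi * (a / 2))) := by
  set x : ℝ := a / 2 with hx
  have hxc : (x : ℂ) ∈ Complex.integerComplement := by
    rw [Complex.mem_integerComplement_iff]
    rintro ⟨n, hn⟩
    have hn' : (n : ℝ) = x := by exact_mod_cast hn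
    have h1 : (0 : ℝ) < n := by rw [hn']; linarith
    have h2 : (n : ℝ) < 1 := by rw [hn']; linarith
    have h3 : 0 < n := by exact_mod_cast h1
    have h4 : n < 1 := by exact_mod_cast h2
    omega
  have h1 := (summable_cotTerm hxc).hasSum
  rw [← cot_series_rep' hxc] at h1
  have h2 : HasSum (fun n : ℕ => (1 / (x - (n + 1)) + 1 / (x + (n + 1)) : ℝ))
      (Real.pi * Real.cot (Real.pi * x) - 1 / x) := by
    rw [← Complex.hasSum_ofReal]
    push_cast
    exact h1
  have h3 : HasSum (fun n : ℕ => (1 / (x + n) - 1 / (x + (n + 1)) : ℝ)) (1 / x) := by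
    have h4 : Tendsto (fun n : ℕ => 1 / (x + n)) atTop (𝓝 0) :=
      Tendsto.comp (g := fun y : ℝ => 1 / y) (by simpa using tendsto_inv_atTop_zero)
        (tendsto_atTop_add_const_left _ _ tendsto_natCast_atTop_atTop)
    rw [hasSum_iff_tendsto_nat_of_nonneg]
    · have h6 : ∀ n : ℕ, ∑ i ∈ Finset.range n, (1 / (x + i) - 1 / (x + (i + 1)) : ℝ) =
          1 / x - 1 / (x + n) := by
        intro n
        have := Finset.sum_range_sub' (fun n : ℕ => 1 / (x + n)) n
        push_cast at this
        rw [this, add_zero]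
      simp only [h6]
      simpa using h4.const_sub (1 / x)
    · intro n
      have h5 : (0 : ℝ) ≤ n := n.cast_nonneg
      rw [sub_nonneg]
      gcongr
      linarith
  have h4 := (h2.add h3).mul_left (1 / 2)
  have h5 : (fun n : ℕ => (1 / (2 * n + a) - 1 / (2 * n + 2 - a) : ℝ)) = fun n : ℕ => 1 / 2 *
      (1 / (x - (n + 1)) + 1 / (x + (n + 1)) + (1 / (x + n) - 1 / (x + (n + 1))) : ℝ) := by
    ext n
    have h5 : (0 : ℝ) ≤ n := n.cast_nonneg
    have h8 : x - (n + 1) ≠ 0 := by linarith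
    have h9 : x + n ≠ 0 := by linarith
    rw [show 2 * (n : ℝ) + a = 2 * (x + n) by linarith,
      show 2 * (n : ℝ) + 2 - a = -(2 * (x - (n + 1))) by linarith]
    field_simp
    ring
  rw [h5, show Real.pi / 2 * Real.cot (Real.pi * x) =
    1 / 2 * (Real.pi * Real.cot (Real.pi * x) - 1 / x + 1 / x) by ring]
  exact h4

/-- The regularized Mellin transform of `t ↦ 1 / (1 - t ^ 2)`. -/
theorem integral_rpow_sub_one_div_one_sub_sq {a : ℝ} (ha0 : 0 < a) (ha2 : a < 2) :
    IntegrableOn (fun t : ℝ => (t ^ (a - 1) - 1) / (1 - t ^ 2)) (Ioi 0) ∧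
    ∫ t in Ioi (0 : ℝ), (t ^ (a - 1) - 1) / (1 - t ^ 2) =
      Real.pi / 2 * Real.cot (Real.pi * (a / 2)) := by
  set φ : ℝ → ℝ := fun t => (t ^ (a - 1) - 1) / (1 - t ^ 2) with hφ
  have h1 : IntegrableOn φ (Ioo 0 1) := integrableOn_rpow_sub_one_div (by linarith)
  -- Inversion t ↦ 1/t carries the part over (1, ∞) to (0, 1), turning the exponent a - 1 into 1 - a
  -- and reversing the sign. The two series then subtract to the cotangent series.
  have h2 : ∀ t ∈ Ioi (0 : ℝ), (t ^ 2)⁻¹ * (Ioi (1 : ℝ)).indicator φ t⁻¹ =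
      (Ioo (0 : ℝ) 1).indicator (fun t => -((t ^ (1 - a) - 1) / (1 - t ^ 2))) t := by
    intro t ht
    have ht : 0 < t := ht
    rcases lt_or_ge t 1 with h | h
    · rw [indicator_of_mem (show t⁻¹ ∈ Ioi (1 : ℝ) from (one_lt_inv₀ ht).2 h),
        indicator_of_mem (show t ∈ Ioo (0 : ℝ) 1 from ⟨ht, h⟩)]
      simp only [hφ]
      rw [Real.inv_rpow ht.le, ← Real.rpow_neg ht.le, neg_sub]
      have h3 : 1 - t ^ 2 ≠ 0 := by nlinarith
      have h4 : 1 - t⁻¹ ^ 2 ≠ 0 := by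
        have := (one_lt_inv₀ ht).2 h
        nlinarith
      have h5 : t ^ 2 * (1 - t⁻¹ ^ 2) = -(1 - t ^ 2) := by field_simp; ring
      rw [inv_mul_eq_div, div_div, mul_comm (1 - t⁻¹ ^ 2), h5, div_neg]
    · rw [indicator_of_notMem, indicator_of_notMem, mul_zero]
      · exact fun h' => absurd h'.2 (not_lt.2 h)
      · exact not_lt.2 (inv_le_one_of_one_le₀ h)
  have h3 : IntegrableOn (fun t : ℝ => -((t ^ (1 - a) - 1) / (1 - t ^ 2))) (Ioo 0 1) :=
    (integrableOn_rpow_sub_one_div (by linarith)).neg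
  have hsub : Ioo (0 : ℝ) 1 ⊆ Ioi 0 := Ioo_subset_Ioi_self
  have hsub' : Ioi (1 : ℝ) ⊆ Ioi 0 := Ioi_subset_Ioi zero_le_one
  have h4 : IntegrableOn φ (Ioi 1) := by
    have h5 := (integrableOn_Ioi_comp_inv_iff ((Ioi (1 : ℝ)).indicator φ)).1
      ((integrableOn_congr_fun h2 measurableSet_Ioi).2
        ((integrable_indicator_iff measurableSet_Ioo).2 h3).integrableOn)
    rwa [IntegrableOn, integrable_indicator_iff measurableSet_Ioi, IntegrableOn,
      Measure.restrict_restrict measurableSet_Ioi, inter_eq_left.2 hsub'] at h5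
  have h5 : ∫ t in Ioi (1 : ℝ), φ t =
      -∫ t in Ioo (0 : ℝ) 1, (t ^ (1 - a) - 1) / (1 - t ^ 2) := by
    have h6 := integral_Ioi_comp_inv ((Ioi (1 : ℝ)).indicator φ)
    rwa [setIntegral_congr_fun measurableSet_Ioi h2, setIntegral_indicator measurableSet_Ioo,
      setIntegral_indicator measurableSet_Ioi, inter_eq_right.2 hsub, inter_eq_right.2 hsub',
      integral_neg, eq_comm] at h6
  have hu : (Ioo (0 : ℝ) 1 ∪ Ioi 1 : Set ℝ) =ᵐ[volume] Ioi (0 : ℝ) := by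
    rw [← Ioc_union_Ioi_eq_Ioi (zero_le_one (α := ℝ))]
    exact Ioo_ae_eq_Ioc.union (ae_eq_refl _)
  have h6 := h1.union h4
  refine ⟨h6.congr_set_ae hu.symm, ?_⟩
  have hd : Disjoint (Ioo (0 : ℝ) 1) (Ioi 1) :=
    disjoint_left.2 fun t h h' => lt_asymm h.2 h'
  rw [← setIntegral_congr_set hu, setIntegral_union hd measurableSet_Ioi h1 h4, h5]
  have h7 := (hasSum_integral_rpow_sub_one_div (s := a - 1) (by linarith)).sub
    (hasSum_integral_rpow_sub_one_div (s := 1 - a) (by linarith))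
  rw [← sub_eq_add_neg]
  refine h7.unique ?_
  refine (hasSum_cot_of_pos ha0 ha2).congr_fun fun n => ?_
  ring_nf

theorem integral_rpow_sub_rpow_div {a x : ℝ} (ha0 : 0 < a) (ha2 : a < 2) (hx : 0 < x) :
    IntegrableOn (fun y : ℝ => (y ^ (a - 1) - x ^ (a - 1)) / (x ^ 2 - y ^ 2)) (Ioi 0) ∧
    ∫ y in Ioi (0 : ℝ), (y ^ (a - 1) - x ^ (a - 1)) / (x ^ 2 - y ^ 2) =
      x ^ (a - 2) * (Real.pi / 2 * Real.cot (Real.pi * (a / 2))) := by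
  obtain ⟨h1, h2⟩ := integral_rpow_sub_one_div_one_sub_sq ha0 ha2
  set g : ℝ → ℝ := fun y => (y ^ (a - 1) - x ^ (a - 1)) / (x ^ 2 - y ^ 2) with hg
  have e : ∀ t ∈ Ioi (0 : ℝ), g (x * t) =
      x ^ (a - 3) * ((t ^ (a - 1) - 1) / (1 - t ^ 2)) := by
    intro t ht
    have ht : 0 < t := ht
    simp only [hg]
    rw [Real.mul_rpow hx.le ht.le, show a - 3 = a - 1 - 2 by ring, Real.rpow_sub hx (a - 1),
      Real.rpow_two, show x ^ 2 - (x * t) ^ 2 = x ^ 2 * (1 - t ^ 2) by ring, ← mul_sub_one,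
      mul_div_mul_comm]
  have h3 : IntegrableOn (fun t => g (x * t)) (Ioi 0) :=
    (integrableOn_congr_fun e measurableSet_Ioi).2 (h1.const_mul _)
  rw [integrableOn_Ioi_comp_mul_left_iff g 0 hx, mul_zero] at h3
  refine ⟨h3, ?_⟩
  have h4 := integral_comp_mul_left_Ioi' g 0 hx
  rw [mul_zero] at h4
  rw [← h4, setIntegral_congr_fun measurableSet_Ioi e, integral_const_mul, h2, smul_eq_mul,
    ← mul_assoc, show a - 2 = 1 + (a - 3) by ring, Real.rpow_add hx, Real.rpow_one]

/-! ### Explicit principal values. -/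

theorem hasDerivAt_log_add_sub_log_sub {x y : ℝ} (hx : 0 < x) (hy : 0 ≤ y) (hyx : y ≠ x) :
    HasDerivAt (fun y => (2 * x)⁻¹ * (Real.log (y + x) - Real.log (y - x))) (x ^ 2 - y ^ 2)⁻¹ y := by
  have h1 : y + x ≠ 0 := by linarith
  have h2 : y - x ≠ 0 := sub_ne_zero.2 hyx
  have h3 := (((hasDerivAt_id y).add_const x).log h1).sub (((hasDerivAt_id y).sub_const x).log h2)
  refine (h3.const_mul (2 * x)⁻¹).congr_deriv ?_
  have h4 : x ^ 2 - y ^ 2 = -((y + x) * (y - x)) := by ring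
  have h5 : (y + x) * (y - x) ≠ 0 := mul_ne_zero h1 h2
  simp only [id]
  rw [h4]
  field_simp
  ring

theorem truncDom_eq_union (x ε : ℝ) :
    truncDom x ε = Ioo 0 (x - ε) ∪ Ioi (max 0 (x + ε)) := by
  ext y
  simp only [truncDom, mem_ofPred_eq, mem_union, mem_Ioo, mem_Ioi, lt_abs, max_lt_iff]
  constructor
  · rintro ⟨h1, h | h⟩
    · left; constructor <;> linarith
    · right; constructor <;> linarith
  · rintro (⟨h1, h⟩ | ⟨h1, h⟩)
    · exact ⟨h1, Or.inl (by linarith)⟩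
    · exact ⟨h1, Or.inr (by linarith)⟩

/-- The terms log ε from the two sides of the singularity cancel. What is left tends to 0 with ε, so
1/(x² - y²) has principal value 0 on the half line. -/
theorem integral_truncDom_inv_sq_sub_sq {x ε : ℝ} (hε : 0 < ε) (hεx : ε < x) :
    IntegrableOn (fun y => (x ^ 2 - y ^ 2)⁻¹) (truncDom x ε) ∧
    ∫ y in truncDom x ε, (x ^ 2 - y ^ 2)⁻¹ =
      (2 * x)⁻¹ * (Real.log (2 * x - ε) - Real.log (2 * x + ε)) := by
  have hx : 0 < x := hε.trans hεx
  have hT : truncDom x ε = Ioo 0 (x - ε) ∪ Ioi (x + ε) := by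
    rw [truncDom_eq_union, max_eq_right (by linarith)]
  set F : ℝ → ℝ := fun y => (2 * x)⁻¹ * (Real.log (y + x) - Real.log (y - x)) with hF
  have hd1 : ∀ y ∈ uIcc 0 (x - ε), HasDerivAt F (x ^ 2 - y ^ 2)⁻¹ y := by
    intro y hy
    rw [uIcc_of_le (by linarith)] at hy
    exact hasDerivAt_log_add_sub_log_sub hx hy.1 (by linarith [hy.2])
  have hc : ContinuousOn (fun y : ℝ => (x ^ 2 - y ^ 2)⁻¹) (uIcc 0 (x - ε)) := by
    refine ContinuousOn.inv₀ (by fun_prop) fun y hy => ?_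
    rw [uIcc_of_le (by linarith)] at hy
    nlinarith [hy.1, hy.2]
  have hi1 := hc.intervalIntegrable (μ := volume)
  have h1 := intervalIntegral.integral_eq_sub_of_hasDerivAt hd1 hi1
  rw [intervalIntegrable_iff_integrableOn_Ioo_of_le (by linarith)] at hi1
  rw [intervalIntegral.integral_of_le (by linarith), integral_Ioc_eq_integral_Ioo] at h1
  have hd2 : ∀ y ∈ Ici (x + ε), HasDerivAt F (x ^ 2 - y ^ 2)⁻¹ y := by
    intro y hy
    have hy : x + ε ≤ y := hy
    exact hasDerivAt_log_add_sub_log_sub hx (by linarith) (by linarith)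
  have hneg : ∀ y ∈ Ioi (x + ε), (x ^ 2 - y ^ 2)⁻¹ ≤ 0 := by
    intro y hy
    have hy : x + ε < y := hy
    exact inv_nonpos.2 (by nlinarith)
  have hl : Tendsto F atTop (𝓝 0) := by
    have h2 : Tendsto (fun y : ℝ => (y + x) / (y - x)) atTop (𝓝 1) := by
      have h3 : Tendsto (fun y : ℝ => 1 + 2 * x * (y - x)⁻¹) atTop (𝓝 (1 + 2 * x * 0)) :=
        ((tendsto_inv_atTop_zero.comp (tendsto_atTop_add_const_right _ (-x) tendsto_id)).const_mul
          _).const_add _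
      rw [mul_zero, add_zero] at h3
      refine h3.congr' ?_
      filter_upwards [eventually_gt_atTop x] with y hy
      have : y - x ≠ 0 := by linarith
      field_simp
      ring
    have h3 := (h2.log one_ne_zero).const_mul (2 * x)⁻¹
    rw [Real.log_one, mul_zero] at h3
    refine h3.congr' ?_
    filter_upwards [eventually_gt_atTop x] with y hy
    rw [Real.log_div (by linarith) (by linarith)]
  have hi2 := integrableOn_Ioi_deriv_of_nonpos' hd2 hneg hl
  have h2 := integral_Ioi_of_hasDerivAt_of_nonpos' hd2 hneg hl
  have hdis : Disjoint (Ioo 0 (x - ε)) (Ioi (x + ε)) := by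
    refine disjoint_left.2 fun t h h' => ?_
    have h' : x + ε < t := h'
    linarith [h.2]
  rw [hT]
  refine ⟨hi1.union hi2, ?_⟩
  rw [setIntegral_union hdis measurableSet_Ioi hi1 hi2, h1, h2]
  simp only [hF]
  rw [show x - ε - x = -ε by ring, show (0 : ℝ) - x = -x by ring, Real.log_neg_eq_log,
    Real.log_neg_eq_log, show x - ε + x = 2 * x - ε by ring, show x + ε + x = 2 * x + ε by ring,
    show x + ε - x = ε by ring, zero_add]
  ring

theorem truncDom_anti (x : ℝ) {ε δ : ℝ} (h : δ ≤ ε) : truncDom x ε ⊆ truncDom x δ :=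
  fun _ hy => ⟨hy.1, h.trans_lt hy.2⟩

theorem integrableOn_truncDom_inv_sq_sub_sq {x ε : ℝ} (hx : 0 < x) (hε : 0 < ε) :
    IntegrableOn (fun y => (x ^ 2 - y ^ 2)⁻¹) (truncDom x ε) :=
  (integral_truncDom_inv_sq_sub_sq (lt_min hε (half_pos hx))
    ((min_le_right _ _).trans_lt (half_lt_self hx))).1.mono_set (truncDom_anti x (min_le_left _ _))

theorem tendsto_integral_truncDom_inv_sq_sub_sq {x : ℝ} (hx : 0 < x) :
    Tendsto (fun ε => ∫ y in truncDom x ε, (x ^ 2 - y ^ 2)⁻¹) (𝓝[>] 0) (𝓝 0) := by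
  have h1 : ContinuousAt (fun ε : ℝ =>
      (2 * x)⁻¹ * (Real.log (2 * x - ε) - Real.log (2 * x + ε))) 0 := by
    have h2 : 2 * x - 0 ≠ 0 := by linarith
    have h3 : 2 * x + 0 ≠ 0 := by linarith
    fun_prop (disch := assumption)
  have h2 := h1.tendsto.mono_left (nhdsWithin_le_nhds (s := Ioi 0))
  simp only [sub_zero, add_zero, sub_self, mul_zero] at h2
  refine h2.congr' ?_
  filter_upwards [Ioo_mem_nhdsGT hx] with ε hε
  exact (integral_truncDom_inv_sq_sub_sq hε.1 hε.2).2.symm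

/-- A principal value with explicit singular part `c / (x ^ 2 - y ^ 2)`, which contributes
nothing. -/
theorem hasPV_of_eq_add {α x c : ℝ} {f R : ℝ → ℝ} (hx : 0 < x) (hR : Integrable R halfLine)
    (h : ∀ y, 0 < y → y ≠ x → kerK α x y * f y = c * (x ^ 2 - y ^ 2)⁻¹ + R y) :
    HasPV α (fun y => (f y : ℂ)) x ((∫ y, R y ∂halfLine : ℝ) : ℂ) := by
  have e : ∀ ε : ℝ, 0 < ε → ∀ y ∈ truncDom x ε, (kerK α x y : ℂ) * (f y : ℂ) =
      ((c * (x ^ 2 - y ^ 2)⁻¹ + R y : ℝ) : ℂ) := by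
    intro ε hε y hy
    rw [← h y hy.1, Complex.ofReal_mul]
    rintro rfl
    have := hy.2
    rw [sub_self, abs_zero] at this
    linarith
  have hi1 : ∀ ε : ℝ, 0 < ε → IntegrableOn (fun y => c * (x ^ 2 - y ^ 2)⁻¹) (truncDom x ε) :=
    fun ε hε => (integrableOn_truncDom_inv_sq_sub_sq hx hε).const_mul c
  have hi2 : ∀ ε : ℝ, IntegrableOn R (truncDom x ε) :=
    fun ε => IntegrableOn.mono_set hR (truncDom_subset x ε)
  refine ⟨fun ε hε => (integrableOn_congr_fun (e ε hε) (measurableSet_truncDom x ε)).2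
    ((hi1 ε hε).add (hi2 ε)).ofReal, ?_⟩
  have h1 := ((tendsto_integral_truncDom_inv_sq_sub_sq hx).const_mul c).add
    (tendsto_integral_truncDom hR x)
  rw [mul_zero, zero_add] at h1
  refine ((Complex.continuous_ofReal.tendsto _).comp h1).congr' ?_
  filter_upwards [self_mem_nhdsWithin] with ε hε
  have hε : 0 < ε := hε
  rw [setIntegral_congr_fun (measurableSet_truncDom x ε) (e ε hε), integral_complex_ofReal,
    integral_add (hi1 ε hε) (hi2 ε), integral_const_mul, Function.comp]

/-- Partial fractions in y² separate 1/(x² - y²) from 1/(y² + z). Subtracting a constant multiple of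
1/(x² - y²), whose principal value is 0, leaves two Mellin integrals, which need an exponent a in
(0, 2). -/
theorem hasPV_of_eq_rpow_div {α β m x z : ℝ} {f : ℝ → ℝ} (hβ : |β| < 2) (hβ0 : β ≠ 0) (hx : 0 < x)
    (hz : 0 < z) (h : ∀ y, 0 < y → kerK α x y * f y =
      2 / Real.pi * m * (y ^ (1 + β) / ((x ^ 2 - y ^ 2) * (y ^ 2 + z)))) :
    HasPV α (fun y => (f y : ℂ)) x ((m * (Real.cot (Real.pi * (β / 2)) * x ^ β -
      z ^ (β / 2) / Real.sin (Real.pi * (β / 2))) / (x ^ 2 + z) : ℝ) : ℂ) := by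
  have hpi := Real.pi_ne_zero
  have hxz : x ^ 2 + z ≠ 0 := by positivity
  have hne : ∀ y, 0 < y → y ≠ x → x ^ 2 - y ^ 2 ≠ 0 := by
    intro y hy hyx h0
    have : (x - y) * (x + y) = 0 := by linear_combination h0
    rcases mul_eq_zero.1 this with h | h
    · exact hyx (by linarith)
    · linarith
  obtain ⟨hβ1, hβ2⟩ := abs_lt.1 hβ
  rcases lt_or_gt_of_ne hβ0 with hneg | hpos
  -- For β < 0, a = 2 + β lies in (0, 2), and 1/((x² - y²)(y² + z)) is (1/(x² - y²) + 1/(y² +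
  -- z))/(x² + z). The shift by π in the angle is undone by the periodicity formulas.
  · set a := 2 + β with ha
    obtain ⟨i1, v1⟩ := integral_rpow_sub_rpow_div (a := a) (by linarith) (by linarith) hx
    obtain ⟨i2, v2⟩ := mellin_inv_sq_add (a := a) (by linarith) (by linarith) hz
    have h1 := hasPV_of_eq_add (α := α) (c := 2 / Real.pi * m * (x ^ 2 + z)⁻¹ * x ^ (a - 1))
      (f := f) hx (((i1.add i2).const_mul (2 / Real.pi * m * (x ^ 2 + z)⁻¹))) ?_
    · refine (congrArg (HasPV α (fun y => (f y : ℂ)) x) (congrArg Complex.ofReal ?_)).mp h1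
      rw [integral_const_mul]
      simp only [Pi.add_apply]
      rw [integral_add i1 i2, v1, v2, ha,
        show Real.pi * ((2 + β) / 2) = Real.pi * (β / 2) + Real.pi by ring, Real.sin_add_pi,
        Real.cot_eq_cos_div_sin, Real.cot_eq_cos_div_sin, Real.sin_add_pi, Real.cos_add_pi,
        neg_div_neg_eq, show 2 + β - 2 = β by ring, show (2 + β) / 2 - 1 = β / 2 by ring, div_neg]
      field_simp
      ring
    · intro y hy hyx
      have h2 := hne y hy hyx
      have h3 : y ^ 2 + z ≠ 0 := by positivity
      rw [h y hy, show 1 + β = a - 1 by rw [ha]; ring]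
      simp only [Pi.add_apply]
      field_simp
      ring
  -- For β > 0, a = β is used and y² is taken out of the power: y²/((x² - y²)(y² + z)) is (x²/(x² -
  -- y²) - z/(y² + z))/(x² + z).
  · obtain ⟨i1, v1⟩ := integral_rpow_sub_rpow_div hpos hβ2 hx
    obtain ⟨i2, v2⟩ := mellin_inv_sq_add hpos hβ2 hz
    have h1 := hasPV_of_eq_add (α := α) (c := 2 / Real.pi * m * (x ^ 2 + z)⁻¹ * x ^ 2 * x ^ (β - 1))
      (f := f) hx ((((i1.const_mul (x ^ 2)).sub (i2.const_mul z)).const_mul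
        (2 / Real.pi * m * (x ^ 2 + z)⁻¹))) ?_
    · refine (congrArg (HasPV α (fun y => (f y : ℂ)) x) (congrArg Complex.ofReal ?_)).mp h1
      rw [integral_const_mul]
      simp only [Pi.sub_apply]
      rw [integral_sub (i1.const_mul _) (i2.const_mul _), integral_const_mul, integral_const_mul,
        v1, v2, Real.rpow_sub hx, Real.rpow_sub_one hz.ne', Real.rpow_two]
      field_simp
    · intro y hy hyx
      have h2 := hne y hy hyx
      have h3 : y ^ 2 + z ≠ 0 := by positivity
      have h4 : y ^ (1 + β) = y ^ (β - 1) * y ^ 2 := by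
        rw [← Real.rpow_two, ← Real.rpow_add hy]
        congr 1
        ring
      rw [h y hy, h4]
      simp only [Pi.sub_apply]
      field_simp
      ring

theorem hasPV_inv_sq_add {α x z : ℝ} (hα : |α| < 2) (hα0 : α ≠ 0) (hx : 0 < x) (hz : 0 < z) :
    HasPV α (fun y => ((1 / (y ^ 2 + z) : ℝ) : ℂ)) x
      (((-Real.cot (Real.pi * (α / 2)) + x ^ α * z ^ (-(α / 2)) / Real.sin (Real.pi * (α / 2))) /
        (x ^ 2 + z) : ℝ) : ℂ) := by
  have h1 := hasPV_of_eq_rpow_div (α := α) (β := -α) (m := x ^ α) (f := fun y => 1 / (y ^ 2 + z))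
    (by rwa [abs_neg]) (neg_ne_zero.2 hα0) hx hz fun y hy => by
      rw [kerK, ← sub_eq_add_neg]
      simp only [div_eq_mul_inv, mul_inv]
      ring
  refine (congrArg (HasPV α _ x) (congrArg Complex.ofReal ?_)).mp h1
  have h2 : x ^ α ≠ 0 := (Real.rpow_pos_of_pos hx α).ne'
  rw [show Real.pi * (-α / 2) = -(Real.pi * (α / 2)) by ring, Real.sin_neg, Real.cot_eq_cos_div_sin,
    Real.cot_eq_cos_div_sin, Real.sin_neg, Real.cos_neg, Real.rpow_neg hx.le, neg_div]
  field_simp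
  ring

theorem hasPV_zero_rpow_div {α x z : ℝ} (hα : |α| < 2) (hα0 : α ≠ 0) (hx : 0 < x) (hz : 0 < z) :
    HasPV 0 (fun y => ((y ^ α / (y ^ 2 + z) : ℝ) : ℂ)) x
      (((Real.cot (Real.pi * (α / 2)) * x ^ α - z ^ (α / 2) / Real.sin (Real.pi * (α / 2))) /
        (x ^ 2 + z) : ℝ) : ℂ) := by
  have h1 := hasPV_of_eq_rpow_div (α := 0) (β := α) (m := 1) (f := fun y => y ^ α / (y ^ 2 + z))
    hα hα0 hx hz fun y hy => by
      rw [kerK, Real.rpow_zero, sub_zero, Real.rpow_add hy]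
      simp only [div_eq_mul_inv, mul_inv]
      ring
  rwa [one_mul] at h1

/-! ### Density of the span of x^a/(x² + z) in L_p. -/

theorem eLpNorm_withDensity_enorm_rpow {X : Type*} [MeasurableSpace X] {μ : Measure X}
    {p : ℝ≥0∞} (hp0 : p ≠ 0) (hp : p ≠ ⊤) {W : X → ℂ} (hW : Measurable W) (h : X → ℂ) :
    eLpNorm h p (μ.withDensity fun x => ‖W x‖ₑ ^ p.toReal) =
      eLpNorm (fun x => W x * h x) p μ := by
  have hr : 0 < p.toReal := ENNReal.toReal_pos hp0 hp
  refine ENNReal.rpow_left_injective hr.ne' ?_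
  simp only []
  rw [eLpNorm_rpow_toReal hp0 hp, eLpNorm_rpow_toReal hp0 hp,
    lintegral_withDensity_eq_lintegral_mul_non_measurable _ (by fun_prop)
      (ae_of_all _ fun x => ENNReal.rpow_lt_top_of_nonneg hr.le enorm_ne_top)]
  refine lintegral_congr fun x => ?_
  rw [Pi.mul_apply, enorm_mul, ENNReal.mul_rpow_of_nonneg _ _ hr.le]

/-- Any function in `L_p` is approximated by products `W * g` with `g` continuous of compact
support, if `W ∈ L_p` vanishes nowhere. -/
theorem exists_eLpNorm_sub_mul_le {p : ℝ≥0∞} (hp0 : p ≠ 0) (hp : p ≠ ⊤) {μ : Measure ℝ} {W f : ℝ → ℂ}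
    (hWm : Measurable W) (hW : MemLp W p μ) (hW0 : ∀ᵐ x ∂μ, W x ≠ 0) (hf : MemLp f p μ)
    {ε : ℝ≥0∞} (hε : ε ≠ 0) :
    ∃ g : ℝ → ℂ, HasCompactSupport g ∧ Continuous g ∧ eLpNorm (fun x => f x - W x * g x) p μ ≤ ε := by
  -- Multiplication by W is an isometry from L_p(ν) to L_p(μ), and ν is finite because W ∈ L_p. So
  -- f/W can be approximated in L_p(ν) by continuous functions of compact support.
  set ν := μ.withDensity fun x => ‖W x‖ₑ ^ p.toReal with hν
  have hr : 0 < p.toReal := ENNReal.toReal_pos hp0 hp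
  have : IsFiniteMeasure ν := by
    refine isFiniteMeasure_withDensity ?_
    rw [← eLpNorm_rpow_toReal hp0 hp]
    exact (ENNReal.rpow_lt_top_of_nonneg hr.le hW.2.ne).ne
  have hac : ν ≪ μ := withDensity_absolutelyContinuous _ _
  have e : (fun x => W x * (f x * (W x)⁻¹)) =ᵐ[μ] f := by
    filter_upwards [hW0] with x hx
    field_simp
  have h1 : MemLp (fun x => f x * (W x)⁻¹) p ν := by
    refine ⟨(hf.1.mul hWm.inv.aestronglyMeasurable).mono_ac hac, ?_⟩
    rw [eLpNorm_withDensity_enorm_rpow hp0 hp hWm, eLpNorm_congr_ae e]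
    exact hf.2
  obtain ⟨g, hgs, hg, hgc, -⟩ := h1.exists_hasCompactSupport_eLpNorm_sub_le hp hε
  refine ⟨g, hgs, hgc, ?_⟩
  rw [eLpNorm_withDensity_enorm_rpow hp0 hp hWm] at hg
  refine (eLpNorm_congr_ae ?_).trans_le hg
  filter_upwards [e] with x hx
  rw [Pi.sub_apply, mul_sub, hx]

/-- A continuous function of compact support on the half line is a uniform limit of polynomials in
`1 / (x ^ 2 + 1)`. -/
theorem exists_polynomial_near_of_hasCompactSupport {g : ℝ → ℝ} (hg : Continuous g)
    (hs : HasCompactSupport g) {ε : ℝ} (hε : 0 < ε) :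
    ∃ q : Polynomial ℝ, ∀ x : ℝ, 0 < x → |q.eval (1 / (x ^ 2 + 1)) - g x| < ε := by
  obtain ⟨R, hR, hgR⟩ := hs.exists_pos_le_norm
  -- In the variable v = 1/(x² + 1) the inverse x = √(1/v - 1) blows up at v = 0. Clamping v at v₀,
  -- which corresponds to x = R, changes nothing because g vanishes beyond R, and makes
  -- Weierstrass's theorem applicable on [0, 1].
  set v₀ : ℝ := 1 / (R ^ 2 + 1) with hv₀
  have hv₀pos : 0 < v₀ := by positivity
  have hH : Continuous fun v : ℝ => g (Real.sqrt (1 / max v v₀ - 1)) := by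
    refine hg.comp (Real.continuous_sqrt.comp (Continuous.sub ?_ continuous_const))
    exact continuous_const.div (by fun_prop) fun v => (hv₀pos.trans_le (le_max_right _ _)).ne'
  obtain ⟨q, hq⟩ := exists_polynomial_near_of_continuousOn 0 1 _ hH.continuousOn ε hε
  refine ⟨q, fun x hx => ?_⟩
  have hx1 : 1 / (x ^ 2 + 1) ≤ 1 := (div_le_one (by positivity)).2 (by nlinarith)
  have h1 := hq (1 / (x ^ 2 + 1)) ⟨by positivity, hx1⟩
  have e : g (Real.sqrt (1 / max (1 / (x ^ 2 + 1)) v₀ - 1)) = g x := by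
    rcases le_total v₀ (1 / (x ^ 2 + 1)) with h | h
    · rw [max_eq_left h, one_div_one_div, add_sub_cancel_right, Real.sqrt_sq hx.le]
    · have hRx : R ≤ x := by
        have h2 := (one_div_le_one_div (by positivity) (by positivity)).1 h
        nlinarith
      rw [max_eq_right h, hv₀, one_div_one_div, add_sub_cancel_right, Real.sqrt_sq hR.le,
        hgR R (by rw [Real.norm_eq_abs, abs_of_pos hR]),
        hgR x (by rwa [Real.norm_eq_abs, abs_of_pos hx])]
  rwa [e] at h1

/-- Integrability of the p-th power at 0 is ap > -1 and at infinity (a - 2)p < -1: the same interval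
as for α. -/
theorem memLp_rpow_div_sq_add {p : ℝ≥0∞} (hp1 : 1 < p) (hp : p ≠ ⊤) {a z : ℝ}
    (ha : a ∈ Ioo (-(1 / p.toReal)) (2 - 1 / p.toReal)) (hz : 0 < z) :
    MemLp (fun x : ℝ => ((x ^ a / (x ^ 2 + z) : ℝ) : ℂ)) p halfLine := by
  have hr : 1 < p.toReal := one_lt_toReal hp1 hp
  set r := p.toReal with hrdef
  have hr0 : 0 < r := by linarith
  have hm : Measurable (fun x : ℝ => ((x ^ a / (x ^ 2 + z) : ℝ) : ℂ)) := by fun_prop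
  have h1 : -1 < a * r := by
    have := mul_lt_mul_of_pos_right ha.1 hr0
    rwa [neg_mul, one_div_mul_cancel hr0.ne'] at this
  have h2 : (a - 2) * r < -1 := by
    have := mul_lt_mul_of_pos_right ha.2 hr0
    rw [sub_mul, one_div_mul_cancel hr0.ne'] at this
    linarith
  rw [← integrable_norm_rpow_iff hm.aestronglyMeasurable (by positivity) hp, ← hrdef]
  have hm2 : Measurable (fun x : ℝ => ‖((x ^ a / (x ^ 2 + z) : ℝ) : ℂ)‖ ^ r) := by fun_prop
  change IntegrableOn _ _ _
  rw [← Ioc_union_Ioi_eq_Ioi (zero_le_one (α := ℝ))]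
  refine IntegrableOn.union ?_ ?_
  · have h3 : IntegrableOn (fun x : ℝ => (z⁻¹) ^ r * x ^ (a * r)) (Ioc 0 1) :=
      (((intervalIntegral.integrableOn_Ioo_rpow_iff one_pos).2 h1).congr_set_ae
        Ioo_ae_eq_Ioc.symm).const_mul _
    refine h3.mono' hm2.aestronglyMeasurable ?_
    filter_upwards [ae_restrict_mem measurableSet_Ioc] with x hx
    have hx0 : 0 < x := hx.1
    rw [Real.norm_of_nonneg (by positivity), Complex.norm_real, Real.norm_of_nonneg (by positivity),
      Real.rpow_mul hx0.le, ← Real.mul_rpow (by positivity) (by positivity), div_eq_mul_inv,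
      mul_comm]
    gcongr
    nlinarith
  · refine ((integrableOn_Ioi_rpow_of_lt h2 one_pos)).mono' hm2.aestronglyMeasurable ?_
    filter_upwards [ae_restrict_mem measurableSet_Ioi] with x hx
    have hx1 : 1 < x := hx
    have hx0 : 0 < x := by linarith
    rw [Real.norm_of_nonneg (by positivity), Complex.norm_real, Real.norm_of_nonneg (by positivity),
      Real.rpow_mul hx0.le, Real.rpow_sub hx0, Real.rpow_two]
    gcongr
    linarith

section Density

variable {p : ℝ≥0∞}

/-- The class of the function `f` belongs to the submodule `V` of `L_p`. -/
def ClassMem (V : Submodule ℂ (LpHalf p)) (f : ℝ → ℂ) : Prop :=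
  ∃ hf : MemLp f p halfLine, hf.toLp f ∈ V

variable {V : Submodule ℂ (LpHalf p)} {f g : ℝ → ℂ}

theorem ClassMem.congr_ae (hf : ClassMem V f) (h : f =ᵐ[halfLine] g) : ClassMem V g := by
  obtain ⟨h1, h2⟩ := hf
  refine ⟨(memLp_congr_ae h).1 h1, ?_⟩
  rwa [← (MemLp.toLp_eq_toLp_iff h1 ((memLp_congr_ae h).1 h1)).2 h]

theorem ClassMem.add (hf : ClassMem V f) (hg : ClassMem V g) :
    ClassMem V (fun x => f x + g x) := by
  obtain ⟨h1, h2⟩ := hf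
  obtain ⟨h3, h4⟩ := hg
  refine ⟨h1.add h3, ?_⟩
  have := V.add_mem h2 h4
  rwa [← MemLp.toLp_add] at this

theorem ClassMem.const_mul (hf : ClassMem V f) (c : ℂ) : ClassMem V (fun x => c * f x) := by
  obtain ⟨h1, h2⟩ := hf
  refine ⟨h1.const_mul c, ?_⟩
  have := V.smul_mem c h2
  rwa [← MemLp.toLp_const_smul] at this

theorem classMem_zero : ClassMem V 0 :=
  ⟨MemLp.zero, by rw [MemLp.toLp_zero]; exact V.zero_mem⟩

theorem ClassMem.sum {ι : Type*} (s : Finset ι) {F : ι → ℝ → ℂ} (h : ∀ i ∈ s, ClassMem V (F i)) :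
    ClassMem V (fun x => ∑ i ∈ s, F i x) := by
  classical
  induction s using Finset.induction_on with
  | empty =>
    simp only [Finset.sum_empty]
    exact classMem_zero
  | insert i s hi ih =>
    simp only [Finset.sum_insert hi]
    exact (h i (by simp)).add (ih fun j hj => h j (by simp [hj]))

theorem classMem_of_forall_eLpNorm_sub_le [Fact (1 ≤ p)] (hV : IsClosed (V : Set (LpHalf p)))
    (hf : MemLp f p halfLine) (h : ∀ ε : ℝ≥0∞, ε ≠ 0 → ∃ g, ClassMem V g ∧
      eLpNorm (fun x => f x - g x) p halfLine ≤ ε) : ClassMem V f := by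
  refine ⟨hf, ?_⟩
  rw [← SetLike.mem_coe, ← hV.closure_eq, Metric.mem_closure_iff_infEDist_zero]
  refine le_antisymm (le_of_forall_pos_le_add fun ε hε => ?_) zero_le
  obtain ⟨g, ⟨hg, hgV⟩, hle⟩ := h ε hε.ne'
  rw [zero_add]
  refine (Metric.infEDist_le_edist_of_mem hgV).trans ?_
  rw [Lp.edist_toLp_toLp]
  exact hle

end Density

/-- Induction on n through (z - 1)/((x² + 1)(x² + z)) = 1/(x² + 1) - 1/(x² + z) for z > 1. The value
z = 1 is the limit of z = 1 + δ in the closed subspace, with error at most δ times the norm of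
x^a/(x² + 1). -/
theorem classMem_rpow_mul_pow_div {p : ℝ≥0∞} [Fact (1 ≤ p)] (hp1 : 1 < p) (hp : p ≠ ⊤) {a : ℝ}
    (ha : a ∈ Ioo (-(1 / p.toReal)) (2 - 1 / p.toReal)) {V : Submodule ℂ (LpHalf p)}
    (hV : IsClosed (V : Set (LpHalf p)))
    (h : ∀ z : ℝ, 1 ≤ z → ClassMem V fun x => ((x ^ a / (x ^ 2 + z) : ℝ) : ℂ)) (n : ℕ) :
    ∀ z : ℝ, 1 ≤ z →
      ClassMem V fun x => ((x ^ a * (1 / (x ^ 2 + 1)) ^ n / (x ^ 2 + z) : ℝ) : ℂ) := by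
  induction n with
  | zero => simpa using h
  | succ n ih =>
    have h1 : ∀ z : ℝ, 1 < z →
        ClassMem V fun x => ((x ^ a * (1 / (x ^ 2 + 1)) ^ (n + 1) / (x ^ 2 + z) : ℝ) : ℂ) := by
      intro z hz
      refine (((ih 1 le_rfl).add ((ih z hz.le).const_mul (-1))).const_mul
        (((z - 1)⁻¹ : ℝ) : ℂ)).congr_ae (ae_of_all _ fun x => ?_)
      have h2 : z - 1 ≠ 0 := by linarith
      have h3 : x ^ 2 + z ≠ 0 := by positivity
      have h4 : x ^ 2 + 1 ≠ 0 := by positivity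
      have e : x ^ a * (1 / (x ^ 2 + 1)) ^ (n + 1) / (x ^ 2 + z) =
          (z - 1)⁻¹ * (x ^ a * (1 / (x ^ 2 + 1)) ^ n / (x ^ 2 + 1) -
            x ^ a * (1 / (x ^ 2 + 1)) ^ n / (x ^ 2 + z)) := by
        rw [pow_succ]
        generalize (1 / (x ^ 2 + 1)) ^ n = B
        field_simp
        ring
      simp only []
      rw [e, Complex.ofReal_mul, Complex.ofReal_sub]
      ring
    intro z hz
    rcases hz.lt_or_eq with hz | rfl
    · exact h1 z hz
    have hW := memLp_rpow_div_sq_add hp1 hp ha one_pos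
    refine classMem_of_forall_eLpNorm_sub_le hV ?_ fun ε hε => ?_
    · refine hW.mono (Measurable.aestronglyMeasurable (by fun_prop)) ?_
      filter_upwards [ae_halfLine_pos] with x hx
      rw [Complex.norm_real, Complex.norm_real, Real.norm_of_nonneg (by positivity),
        Real.norm_of_nonneg (by positivity)]
      gcongr
      refine mul_le_of_le_one_right (by positivity) (pow_le_one₀ (by positivity) ?_)
      exact (div_le_one (by positivity)).2 (by nlinarith)
    · obtain ⟨δ, hδ, hδε⟩ := ENNReal.exists_nnreal_pos_mul_lt hW.2.ne hε
      refine ⟨_, h1 (1 + δ) (by simpa using hδ), ?_⟩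
      have h2 : ∀ᵐ x ∂halfLine, ‖((x ^ a * (1 / (x ^ 2 + 1)) ^ (n + 1) / (x ^ 2 + 1) : ℝ) : ℂ) -
          ((x ^ a * (1 / (x ^ 2 + 1)) ^ (n + 1) / (x ^ 2 + (1 + δ)) : ℝ) : ℂ)‖ ≤
          δ * ‖((x ^ a / (x ^ 2 + 1) : ℝ) : ℂ)‖ := by
        filter_upwards [ae_halfLine_pos] with x hx
        have hδ' : (0 : ℝ) < δ := hδ
        have e : x ^ a * (1 / (x ^ 2 + 1)) ^ (n + 1) / (x ^ 2 + 1) -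
            x ^ a * (1 / (x ^ 2 + 1)) ^ (n + 1) / (x ^ 2 + (1 + δ)) =
            δ * (x ^ a / (x ^ 2 + 1)) * ((1 / (x ^ 2 + 1)) ^ (n + 1) * (1 / (x ^ 2 + (1 + δ)))) := by
          field_simp
          ring
        rw [← Complex.ofReal_sub, Complex.norm_real, Complex.norm_real, e,
          Real.norm_of_nonneg (by positivity), Real.norm_of_nonneg (by positivity)]
        refine mul_le_of_le_one_right (by positivity) ?_
        refine mul_le_one₀ (pow_le_one₀ (by positivity) ?_) (by positivity) ?_
        · exact (div_le_one (by positivity)).2 (by nlinarith)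
        · exact (div_le_one (by positivity)).2 (by nlinarith)
      refine (eLpNorm_le_nnreal_smul_eLpNorm_of_ae_le_mul h2 p).trans ?_
      rw [ENNReal.smul_def, smul_eq_mul]
      exact hδε.le

/-- The functions `x ^ a / (x ^ 2 + z)`, `z ≥ 1`, span a dense subspace. -/
theorem eq_top_of_classMem_rpow_div {p : ℝ≥0∞} [Fact (1 ≤ p)] (hp1 : 1 < p) (hp : p ≠ ⊤) {a : ℝ}
    (ha : a ∈ Ioo (-(1 / p.toReal)) (2 - 1 / p.toReal)) {V : Submodule ℂ (LpHalf p)}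
    (hV : IsClosed (V : Set (LpHalf p)))
    (h : ∀ z : ℝ, 1 ≤ z → ClassMem V fun x => ((x ^ a / (x ^ 2 + z) : ℝ) : ℂ)) : V = ⊤ := by
  have hp0 : p ≠ 0 := by positivity
  set W : ℝ → ℂ := fun x => ((x ^ a / (x ^ 2 + 1) : ℝ) : ℂ) with hWdef
  have hWm : Measurable W := by fun_prop
  have hW : MemLp W p halfLine := memLp_rpow_div_sq_add hp1 hp ha one_pos
  have hpoly : ∀ q : Polynomial ℝ,
      ClassMem V fun x => W x * ((q.eval (1 / (x ^ 2 + 1)) : ℝ) : ℂ) := by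
    intro q
    refine (ClassMem.sum (Finset.range (q.natDegree + 1)) fun i _ =>
      (classMem_rpow_mul_pow_div hp1 hp ha hV h i 1 le_rfl).const_mul (q.coeff i : ℂ)).congr_ae
      (ae_of_all _ fun x => ?_)
    simp only [hWdef]
    rw [Polynomial.eval_eq_sum_range, Complex.ofReal_sum, Finset.mul_sum]
    refine Finset.sum_congr rfl fun i _ => ?_
    push_cast
    ring
  refine eq_top_iff.2 fun f _ => ?_
  have hf := Lp.memLp f
  suffices ClassMem V f by
    obtain ⟨h1, h2⟩ := this
    rwa [Lp.toLp_coeFn] at h2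
  refine classMem_of_forall_eLpNorm_sub_le hV hf fun ε hε => ?_
  have hε2 : ε / 2 ≠ 0 := (ENNReal.half_pos hε).ne'
  have hW0 : ∀ᵐ x ∂halfLine, W x ≠ 0 := by
    filter_upwards [ae_halfLine_pos] with x hx
    have : x ^ a / (x ^ 2 + 1) ≠ 0 := by positivity
    exact Complex.ofReal_ne_zero.2 this
  -- Half of ε pays for replacing f by W g with g continuous of compact support. The other half pays
  -- for replacing g by a polynomial in 1/(x² + 1): a uniform error δ becomes δ‖W‖ in L_p.
  obtain ⟨g, hgs, hgc, hg⟩ := exists_eLpNorm_sub_mul_le hp0 hp hWm hW hW0 hf hε2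
  obtain ⟨δ, hδ, hδε⟩ := ENNReal.exists_nnreal_pos_mul_lt hW.2.ne hε2
  have hδ' : (0 : ℝ) < δ / 2 := half_pos hδ
  obtain ⟨q₁, hq₁⟩ := exists_polynomial_near_of_hasCompactSupport (g := fun x => (g x).re)
    (Complex.continuous_re.comp hgc) (hgs.comp_left Complex.zero_re) hδ'
  obtain ⟨q₂, hq₂⟩ := exists_polynomial_near_of_hasCompactSupport (g := fun x => (g x).im)
    (Complex.continuous_im.comp hgc) (hgs.comp_left Complex.zero_im) hδ'
  set Q : ℝ → ℂ := fun x => ((q₁.eval (1 / (x ^ 2 + 1)) : ℝ) : ℂ) +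
    ((q₂.eval (1 / (x ^ 2 + 1)) : ℝ) : ℂ) * Complex.I with hQ
  have hQV : ClassMem V fun x => W x * Q x := by
    refine ((hpoly q₁).add ((hpoly q₂).const_mul Complex.I)).congr_ae (ae_of_all _ fun x => ?_)
    simp only [hQ]
    ring
  refine ⟨_, hQV, ?_⟩
  have h2 : ∀ᵐ x ∂halfLine, ‖W x * (g x - Q x)‖ ≤ δ * ‖W x‖ := by
    filter_upwards [ae_halfLine_pos] with x hx
    rw [norm_mul, mul_comm]
    refine mul_le_mul_of_nonneg_right ?_ (norm_nonneg _)
    have h3 := hq₁ x hx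
    have h4 := hq₂ x hx
    refine (Complex.norm_le_abs_re_add_abs_im _).trans ?_
    simp only [hQ, Complex.sub_re, Complex.sub_im, Complex.add_re, Complex.add_im,
      Complex.ofReal_re, Complex.ofReal_im, Complex.re_ofReal_mul, Complex.im_ofReal_mul,
      Complex.I_re, Complex.I_im, mul_zero, mul_one, add_zero, zero_add]
    rw [abs_sub_comm, abs_sub_comm (g x).im]
    linarith
  have hWg : AEStronglyMeasurable (fun x => W x * g x) halfLine :=
    (hWm.mul hgc.measurable).aestronglyMeasurable
  have e : (fun x => f x - W x * Q x) =
      (fun x => f x - W x * g x) + fun x => W x * (g x - Q x) := by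
    ext x
    simp only [Pi.add_apply]
    ring
  have hQm : AEStronglyMeasurable (fun x => W x * (g x - Q x)) halfLine :=
    (hWg.sub hQV.1.1).congr (ae_of_all _ fun x => by simp only [Pi.sub_apply]; ring)
  rw [e]
  refine (eLpNorm_add_le (hf.1.sub hWg) hQm Fact.out).trans ?_
  rw [← ENNReal.add_halves ε]
  refine add_le_add hg ((eLpNorm_le_nnreal_smul_eLpNorm_of_ae_le_mul h2 p).trans ?_)
  rw [ENNReal.smul_def, smul_eq_mul]
  exact hδε.le

/-! ### The inverse of I - kK_0. -/

theorem IsOpK.apply_toLp {p : ℝ≥0∞} [Fact (1 ≤ p)] {α : ℝ} {T : LpHalf p →L[ℂ] LpHalf p}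
    (hT : IsOpK p α T) {f g : ℝ → ℂ} (hf : MemLp f p halfLine) (hg : MemLp g p halfLine)
    (h : ∀ᵐ x ∂halfLine, HasPV α f x (g x)) : T (hf.toLp f) = hg.toLp g := by
  refine Lp.ext ?_
  filter_upwards [hT (hf.toLp f), h, hg.coeFn_toLp] with x h1 h2 h3
  rw [h3]
  exact tendsto_nhds_unique (h1.congr_ae hf.coeFn_toLp).2 h2.2

theorem ext_of_rpow_div {p : ℝ≥0∞} [Fact (1 ≤ p)] (hp1 : 1 < p) (hp : p ≠ ⊤) {a : ℝ}
    (ha : a ∈ Ioo (-(1 / p.toReal)) (2 - 1 / p.toReal)) {S T : LpHalf p →L[ℂ] LpHalf p}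
    (h : ∀ z : ℝ, (hz : 0 < z) → S ((memLp_rpow_div_sq_add hp1 hp ha hz).toLp _) =
      T ((memLp_rpow_div_sq_add hp1 hp ha hz).toLp _)) : S = T := by
  have h1 : LinearMap.ker (S - T).toLinearMap = ⊤ :=
    eq_top_of_classMem_rpow_div hp1 hp ha (ContinuousLinearMap.isClosed_ker (S - T)) fun z hz =>
      ⟨memLp_rpow_div_sq_add hp1 hp ha (by linarith), by
        rw [LinearMap.mem_ker, ContinuousLinearMap.coe_coe, sub_apply,
          sub_eq_zero]
        exact h z (by linarith)⟩
  ext1 f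
  have h2 : f ∈ LinearMap.ker (S - T).toLinearMap := by rw [h1]; trivial
  rwa [LinearMap.mem_ker, ContinuousLinearMap.coe_coe, sub_apply,
    sub_eq_zero] at h2

/-- I + kK_α sends u = 1/(x² + z) to a multiple of w = x^α/(x² + z), and I - kK_0 sends w back to a
multiple of u, because k cot θ = 1 removes the diagonal terms. The conditions α ≠ 0 and α ≠ 1 are
those under which sin θ and cos θ do not vanish. -/
theorem isOpK_inverse_formula {p : ℝ≥0∞} [Fact (1 ≤ p)] (hp1 : 1 < p) (hp : p ≠ ⊤) {α : ℝ}
    (hα : α ∈ Ioo (-(1 / p.toReal)) (2 - 1 / p.toReal)) (hα0 : α ≠ 0) (hα1 : α ≠ 1)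
    {K₀ Kα : LpHalf p →L[ℂ] LpHalf p} (hK₀ : IsOpK p 0 K₀) (hKα : IsOpK p α Kα) {k : ℝ}
    (hk : k = Real.tan (Real.pi / 2 * α)) :
    (1 - (k : ℂ) • K₀) * (1 + (k : ℂ) • Kα) = (1 + (k : ℂ) ^ 2) • 1 ∧
      (1 + (k : ℂ) • Kα) * (1 - (k : ℂ) • K₀) = (1 + (k : ℂ) ^ 2) • 1 := by
  have hr : 1 < p.toReal := one_lt_toReal hp1 hp
  have hr1 : 1 / p.toReal < 1 := (div_lt_one (by linarith)).2 hr
  have hr2 : 0 < 1 / p.toReal := by positivity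
  have h0 : (0 : ℝ) ∈ Ioo (-(1 / p.toReal)) (2 - 1 / p.toReal) := ⟨by linarith, by linarith⟩
  have hα2 : |α| < 2 := abs_lt.2 ⟨by linarith [hα.1], by linarith [hα.2]⟩
  set θ := Real.pi * (α / 2) with hθ
  have hkθ : k = Real.sin θ / Real.cos θ := by
    rw [hk, show Real.pi / 2 * α = θ by rw [hθ]; ring, Real.tan_eq_sin_div_cos]
  have hpi := Real.pi_pos
  have hs : Real.sin θ ≠ 0 := by
    rw [Ne, Real.sin_eq_zero_iff_of_lt_of_lt (by nlinarith [hα.1]) (by nlinarith [hα.2])]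
    exact mul_ne_zero hpi.ne' (by simpa using hα0)
  have hc : Real.cos θ ≠ 0 := by
    have h1 : Real.cos θ = Real.sin (Real.pi / 2 - θ) := (Real.sin_pi_div_two_sub θ).symm
    rw [h1, Ne, Real.sin_eq_zero_iff_of_lt_of_lt (by nlinarith [hα.2]) (by nlinarith [hα.1])]
    intro h2
    have h3 : Real.pi * (1 - α) = 0 := by rw [hθ] at h2; linarith
    rcases mul_eq_zero.1 h3 with h | h
    · exact hpi.ne' h
    · exact hα1 (by linarith)
  have hkct : k * Real.cot θ = 1 := by
    rw [hkθ, Real.cot_eq_cos_div_sin]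
    field_simp
  set u := fun (z : ℝ) (hz : 0 < z) => (memLp_rpow_div_sq_add hp1 hp h0 hz).toLp _ with hu
  set w := fun (z : ℝ) (hz : 0 < z) => (memLp_rpow_div_sq_add hp1 hp hα hz).toLp _ with hw
  have e1 : ∀ z : ℝ, (hz : 0 < z) → Kα (u z hz) = ((-Real.cot θ : ℝ) : ℂ) • u z hz +
      ((z ^ (-(α / 2)) / Real.sin θ : ℝ) : ℂ) • w z hz := by
    intro z hz
    simp only [hu, hw]
    rw [← MemLp.toLp_const_smul, ← MemLp.toLp_const_smul, ← MemLp.toLp_add]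
    refine hKα.apply_toLp _ _ ?_
    filter_upwards [ae_halfLine_pos] with x hx
    have h1 := hasPV_inv_sq_add hα2 hα0 hx hz
    simp only [Real.rpow_zero, Pi.add_apply, Pi.smul_apply, smul_eq_mul]
    refine (congrArg (HasPV α _ x) ?_).mp h1
    rw [← Complex.ofReal_mul, ← Complex.ofReal_mul, ← Complex.ofReal_add]
    congr 1
    ring
  have e2 : ∀ z : ℝ, (hz : 0 < z) → K₀ (w z hz) = ((Real.cot θ : ℝ) : ℂ) • w z hz +
      ((-(z ^ (α / 2) / Real.sin θ) : ℝ) : ℂ) • u z hz := by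
    intro z hz
    simp only [hu, hw]
    rw [← MemLp.toLp_const_smul, ← MemLp.toLp_const_smul, ← MemLp.toLp_add]
    refine hK₀.apply_toLp _ _ ?_
    filter_upwards [ae_halfLine_pos] with x hx
    have h1 := hasPV_zero_rpow_div hα2 hα0 hx hz
    simp only [Real.rpow_zero, Pi.add_apply, Pi.smul_apply, smul_eq_mul]
    refine (congrArg (HasPV 0 _ x) ?_).mp h1
    rw [← Complex.ofReal_mul, ← Complex.ofReal_mul, ← Complex.ofReal_add]
    congr 1
    ring
  have f1 : ∀ z : ℝ, (hz : 0 < z) → (1 + (k : ℂ) • Kα) (u z hz) =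
      ((k * (z ^ (-(α / 2)) / Real.sin θ) : ℝ) : ℂ) • w z hz := by
    intro z hz
    rw [add_apply, one_apply_eq_self,
      smul_apply, e1 z hz, smul_add, smul_smul, smul_smul, ← Complex.ofReal_mul,
      ← Complex.ofReal_mul, mul_neg, hkct, Complex.ofReal_neg, Complex.ofReal_one, neg_one_smul,
      add_neg_cancel_left]
  have f2 : ∀ z : ℝ, (hz : 0 < z) → (1 - (k : ℂ) • K₀) (w z hz) =
      ((k * (z ^ (α / 2) / Real.sin θ) : ℝ) : ℂ) • u z hz := by
    intro z hz
    rw [sub_apply, one_apply_eq_self,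
      smul_apply, e2 z hz, smul_add, smul_smul, smul_smul, ← Complex.ofReal_mul,
      ← Complex.ofReal_mul, hkct, Complex.ofReal_one, one_smul, sub_add_cancel_left,
      mul_neg, Complex.ofReal_neg, neg_smul, neg_neg]
  -- The powers of z cancel, leaving k²/sin²θ = 1/cos²θ = 1 + k².
  have hmul : ∀ z : ℝ, 0 < z → (k * (z ^ (-(α / 2)) / Real.sin θ)) *
      (k * (z ^ (α / 2) / Real.sin θ)) = 1 + k ^ 2 := by
    intro z hz
    have h1 : z ^ (α / 2) ≠ 0 := (Real.rpow_pos_of_pos hz _).ne'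
    rw [Real.rpow_neg hz.le, hkθ]
    field_simp
    linarith [Real.sin_sq_add_cos_sq θ]
  -- The first product is tested on the functions u (exponent 0), the second on the functions w
  -- (exponent α); each family spans a dense subspace.
  constructor
  · refine ext_of_rpow_div hp1 hp h0 fun z hz => ?_
    rw [mul_apply_eq_comp, f1 z hz, map_smul, f2 z hz, smul_smul, ← Complex.ofReal_mul,
      hmul z hz]
    simp only [hu, smul_apply, one_apply_eq_self]
    push_cast
    rfl
  · refine ext_of_rpow_div hp1 hp hα fun z hz => ?_
    rw [mul_apply_eq_comp, f2 z hz, map_smul, f1 z hz, smul_smul, ← Complex.ofReal_mul,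
      mul_comm (k * _), hmul z hz]
    simp only [hw, smul_apply, one_apply_eq_self]
    push_cast
    rfl

theorem exists_isOpK_inverse {p : ℝ≥0∞} [Fact (1 ≤ p)] (hp1 : 1 < p) (hp : p ≠ ⊤) {α : ℝ}
    (hα : α ∈ Ioo (-(1 / p.toReal)) (2 - 1 / p.toReal)) (hα1 : α ≠ 1) {k : ℝ}
    (hk : k = Real.tan (Real.pi / 2 * α)) :
    ∃ K₀ Kα : LpHalf p →L[ℂ] LpHalf p, IsOpK p 0 K₀ ∧ IsOpK p α Kα ∧
      (1 - (k : ℂ) • K₀) * ((1 / (1 + (k : ℂ) ^ 2)) • (1 + (k : ℂ) • Kα)) = 1 ∧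
      ((1 / (1 + (k : ℂ) ^ 2)) • (1 + (k : ℂ) • Kα)) * (1 - (k : ℂ) • K₀) = 1 := by
  have hr : 1 < p.toReal := one_lt_toReal hp1 hp
  have hr1 : 1 / p.toReal < 1 := (div_lt_one (by linarith)).2 hr
  have hr2 : 0 < 1 / p.toReal := by positivity
  obtain ⟨K₀, hK₀⟩ := exists_isOpK (α := 0) hp1 hp ⟨by linarith, by linarith⟩
  obtain ⟨Kα, hKα⟩ := exists_isOpK hp1 hp hα
  refine ⟨K₀, Kα, hK₀, hKα, ?_⟩
  -- At α = 0 the number k is 0 and both products are trivial, whereas the formulas with cot θ and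
  -- 1/sin θ break down.
  rcases eq_or_ne α 0 with rfl | hα0
  · simp [hk]
  have hk2 : 1 + (k : ℂ) ^ 2 ≠ 0 := by
    have : (1 + k ^ 2 : ℝ) ≠ 0 := by positivity
    exact_mod_cast this
  obtain ⟨h1, h2⟩ := isOpK_inverse_formula hp1 hp hα hα0 hα1 hK₀ hKα hk
  rw [mul_smul_comm, smul_mul_assoc, h1, h2, smul_smul, one_div_mul_cancel hk2, one_smul]
  exact ⟨rfl, rfl⟩

/-- The first claim is the boundedness criterion for `K_α` as an operator given by the principal
value on all of `L_p`; the second is the same criterion for the a priori estimate on test functions;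
the third is the inverse formula. At `α = 1` the number `k = tan (π α / 2)` is undefined. -/
theorem proposition3p5 (p : ℝ≥0∞) [Fact (1 ≤ p)] (hp1 : 1 < p) (hp : p ≠ ⊤) :
    (∀ α : ℝ, (∃ T : LpHalf p →L[ℂ] LpHalf p, IsOpK p α T) ↔
      α ∈ Ioo (-(1 / p.toReal)) (2 - 1 / p.toReal)) ∧
    (∀ α : ℝ, TestBoundK p α ↔ α ∈ Ioo (-(1 / p.toReal)) (2 - 1 / p.toReal)) ∧
    (∀ α : ℝ, α ∈ Ioo (-(1 / p.toReal)) (2 - 1 / p.toReal) → α ≠ 1 →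
      ∀ k : ℝ, k = Real.tan (Real.pi / 2 * α) →
      ∃ K₀ Kα : LpHalf p →L[ℂ] LpHalf p, IsOpK p 0 K₀ ∧ IsOpK p α Kα ∧
        (1 - (k : ℂ) • K₀) * ((1 / (1 + (k : ℂ) ^ 2)) • (1 + (k : ℂ) • Kα)) = 1 ∧
        ((1 / (1 + (k : ℂ) ^ 2)) • (1 + (k : ℂ) • Kα)) * (1 - (k : ℂ) • K₀) = 1) := by
  exact ⟨fun α => exists_isOpK_iff hp1 hp α, fun α => testBoundK_iff hp1 hp α,
    fun α hα hα1 k hk => exists_isOpK_inverse hp1 hp hα hα1 hk⟩
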